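/- Fix a sign $\pm$, a function $\phi_0\in H^1(\mathbb R)$, and a smooth cutoff $\varphi:\mathbb R\to\mathbb C$ with $\varphi(\xi)=1$ for $|\xi|\le 1$, $\operatorname{supp}\varphi\subseteq[-2,2]$ and $|\varphi|\le 1$. Write $\widehat f(\xi)=\int_{\mathbb R} f(x)e^{-ix\xi}\,dx$ for functions on the line (extended to $L^2(\mathbb R)$), $\widehat c(\theta)=\sum_{n\in\mathbb Z}c_ne^{-in\theta}$ for sequences $c\in\ell^2(\mathbb Z)$, and $\widehat{P_{\le N}f}(\xi)=\varphi(\xi/N)\widehat f(\xi)$. Let $h_0:=\min\bigl\{1,\tfrac{1}{100\|\phi_0\|_{L^2}^2}\bigr\}$, with $h_0:=1$ if $\phi_0=0$. For every $0<h\le h_0$ the modified Ablowitz--Ladik system $$\partial_t\alpha_n=-(1-\alpha_n\beta_n)(\alpha_{n+1}-\alpha_{n-1}),\qquad \beta_n=\pm\overline{\alpha_n},\qquad n\in\mathbb Z,$$ with initial data $\alpha_n(0)=h\,[P_{\le \frac{\pi}{2h}}\phi_0](hn)$ has a unique global solution $\alpha=\alpha^{h}\in C(\mathbb R;\ell^2(\mathbb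 Z))$. Put $$\phi^h(t,x):=h^{-1}\int_{-\pi}^{\pi}e^{ih^{-1}\theta(x+6h^{-2}t)}\,\widehat{\alpha^h}(3h^{-3}t,\theta)\,\frac{d\theta}{2\pi}.$$ Then for every fixed $T>0$, each $\phi^h$ with $0<h\le h_0$ belongs to $C([-T,T];L^2(\mathbb R))$, and the family $\{\phi^h: 0<h\le h_0\}$ is precompact in $C([-T,T];L^2(\mathbb R))$, that is, it has compact closure there. -/

import Mathlib

open MeasureTheory Complex
open scoped FourierTransform ComplexConjugate ContDiff ENNReal

noncomputable section

namespace AblowitzLadik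

/-- The Hilbert space of (classes of) square-integrable functions on the line. -/
abbrev L2R : Type := Lp ℂ 2 (volume : Measure ℝ)

/-- Square-summable complex sequences on the integers. -/
abbrev EllTwo : Type := lp (fun _ : ℤ => ℂ) 2

/-- Membership in the Sobolev space `H¹(ℝ)`. -/
def MemHOne (f : L2R) : Prop :=
  TemperedDistribution.MemSobolev 1 2 (f : TemperedDistribution ℝ ℂ)

/-- The Fourier transform on the line in the normalisation
`f̂(ξ) = ∫ f(x) exp(-i x ξ) dx`, extended to square-integrable functions.
Mathlib's transform is `∫ f(x) exp(-2 π i x η) dx`, so that `ξ = 2 π η`. -/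
def lineHat (f : L2R) (ξ : ℝ) : ℂ :=
  (𝓕 f : L2R) (ξ / (2 * Real.pi))

/-- Cutoff functions for the Littlewood--Paley projections to low frequencies: smooth, equal to
one on `|ξ| ≤ 1`, supported in `|ξ| ≤ 2`, and bounded by one. -/
structure IsLowFrequencyCutoff (φ : ℝ → ℂ) : Prop where
  smooth : ContDiff ℝ ∞ φ
  support_subset : tsupport φ ⊆ Metric.closedBall 0 2
  eq_one : ∀ ξ : ℝ, |ξ| ≤ 1 → φ ξ = 1
  norm_le_one : ∀ ξ : ℝ, ‖φ ξ‖ ≤ 1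

/-- The smooth representative of `P_{≤ N} f`, the function whose Fourier transform is
`φ(ξ / N) f̂(ξ)`. The integrand is a bounded compactly supported function times a
square-integrable one, so the inversion integral converges absolutely at every `x`. -/
def lowPass (φ : ℝ → ℂ) (N : ℝ) (f : L2R) (x : ℝ) : ℂ :=
  ∫ ξ : ℝ, exp (I * x * ξ) * (φ (ξ / N) * lineHat f ξ) / (2 * Real.pi)

/-- The right-hand side of the modified Ablowitz--Ladik system, with `β_n = σ * conj α_n`. -/
def mALField (σ : ℝ) (a : ℤ → ℂ) (n : ℤ) : ℂ :=
  -(1 - a n * ((σ : ℂ) * conj (a n))) * (a (n + 1) - a (n - 1))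

/-- `α` is a global solution, continuous in time with values in `ℓ²(ℤ)`, of the modified
Ablowitz--Ladik system, with initial data `α_n(0) = h [P_{≤ π/(2h)} φ₀](h n)`. -/
structure IsGlobalSolution (σ : ℝ) (φ : ℝ → ℂ) (φ₀ : L2R) (h : ℝ) (α : ℝ → EllTwo) :
    Prop where
  continuous : Continuous α
  hasDerivAt : ∀ (t : ℝ) (n : ℤ), HasDerivAt (fun s : ℝ => α s n) (mALField σ (α t) n) t
  initial : ∀ n : ℤ, α 0 n = h * lowPass φ (Real.pi / (2 * h)) φ₀ (h * n)

/-- The Fourier series `ĉ(θ) = ∑ c_n exp(-i n θ)` of a square-summable sequence, as a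
square-integrable `2 π`-periodic function. The inverse of `fourierBasis.repr` sends `c` to
`∑ c_n exp(i n θ)`, whence the sign. -/
def seqHat (c : EllTwo) (θ : ℝ) : ℂ :=
  haveI : Fact (0 < 2 * Real.pi) := ⟨Real.two_pi_pos⟩
  ((fourierBasis (T := 2 * Real.pi)).repr.symm c) ((-θ : ℝ) : AddCircle (2 * Real.pi))

/-- The band-limited interpolation operator
`[R c](x) = h⁻¹ ∫_{-π}^{π} exp(i x θ / h) ĉ(θ) dθ / (2 π)`. -/
def interp (h : ℝ) (c : EllTwo) (x : ℝ) : ℂ :=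
  (h : ℂ)⁻¹ * ∫ θ in (-Real.pi)..Real.pi,
    exp (I * x * θ / h) * seqHat c θ / (2 * Real.pi)

/-- The continuum representative `φ^h(t, x) = [R α(3 h⁻³ t)](x + 6 h⁻² t)`. -/
def continuumRep (h : ℝ) (α : ℝ → EllTwo) (t x : ℝ) : ℂ :=
  interp h (α (3 * t / h ^ 3)) (x + 6 * t / h ^ 2)

/-- The threshold `h₀ = min {1, 1 / (100 ‖φ₀‖²)}`, which equals `1` if `φ₀ = 0`. -/
def hZero (φ₀ : L2R) : ℝ :=
  open Classical in if φ₀ = 0 then 1 else min 1 (1 / (100 * ‖φ₀‖ ^ 2))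

end AblowitzLadik

end

noncomputable section

namespace AblowitzLadik

/-! By Arzelà–Ascoli, precompactness in $C([-T,T];L^2)$ needs two facts uniform in $h$: the values
lie in one totally bounded subset of $L^2$, and the curves share a modulus of continuity. The
Fourier transform is isometric, so both are proved for `moving`, which at time $3t/h^3$ is the
Fourier transform of $\phi^h(t)$ (`fourierInv_moving_ae`).

Two conservation laws supply the bounds. With $\rho(s)=\int_0^s dr/(1-\sigma r)$ the mass
$\sum\rho(|\alpha_n|^2)$ is conserved and comparable to $\|\alpha\|^2$; hence small data stay small,
solutions are global, and $\|\alpha(t)\|\lesssim\sqrt h$. Also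
$\mathrm{Re}\sum\overline{\alpha_n}\alpha_{n+1}$ is conserved. Since $\rho(s)-s=O(s^2)$ and
$\|\alpha\|_\infty^2\le2\|\alpha\|\|D\alpha\|$, where $D$ is the forward difference, the two laws
together give $\|D\alpha(t)\|\le\|D\alpha(0)\|+O(\sup_t\|\alpha\|^3)\lesssim h^{3/2}$
(`IsSmallSolution.norm_forwardDiff_le`), a discrete form of the $H^1$ bound. Frequencies above $K$
therefore contribute $O(1/K)$ in $L^2$, uniformly in $h$ and $t$.

Equicontinuity: in the frame moving at speed $2$ the linear symbol is $4\pi h\eta-2\sin(2\pi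
h\eta)=O((hK)^3)$ for $|\eta|\le K$, and the nonlinearity has norm at most
$4\|\alpha\|\|D\alpha\|^2=O(h^{7/2})$. Both match the time scale $h^{-3}$, so the low frequencies
move at bounded speed (`norm_sharpCutoff_moving_sub_le`).

Spatial tightness: the mass is tested against the bounded weight $w(s(n-2t))$ with
$w(x)=x^2/(1+x^2)$ and $s=h/L$. The translation at speed $2$ cancels the leading part of the mass
flux, and the remainder integrates to $O(h/L)$ over times $O(h^{-3})$
(`IsSmallSolution.weighted_mass_growth`). For the initial data, tails are small because a Schwartz
approximation of $\widehat{\phi_0}$ has rapidly decaying samples.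

Truncating in space and in frequency leaves trigonometric polynomials in $\eta$ that are uniformly
bounded and Lipschitz on a bounded interval, hence a totally bounded set (`totallyBounded_band`). -/

/-! ### Fourier transforms and the Sobolev space on the line -/

/-- Multiplication by an essentially bounded function, linear in the multiplier. -/
def mulTop : Lp ℂ ∞ (volume : Measure ℝ) →L[ℂ] L2R →L[ℂ] L2R :=
  (ContinuousLinearMap.mul ℂ ℂ).holderL volume ∞ 2 2

lemma coeFn_mulTop (m : Lp ℂ ∞ (volume : Measure ℝ)) (f : L2R) :
    mulTop m f =ᵐ[volume] fun x => m x * f x :=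
  (ContinuousLinearMap.mul ℂ ℂ).coeFn_holder (r := 2) m f

/-- Two functions that are locally integrable and have equal pairings with Schwartz functions
agree almost everywhere. -/
lemma ae_eq_of_forall_schwartz {u v : ℝ → ℂ} (hu : LocallyIntegrable u) (hv : LocallyIntegrable v)
    (h : ∀ g : SchwartzMap ℝ ℂ, ∫ x, g x * u x = ∫ x, g x * v x) : u =ᵐ[volume] v := by
  apply ae_eq_of_integral_contDiff_smul_eq hu hv
  intro g g_smooth g_cpt
  have hg₁ : HasCompactSupport (Complex.ofRealCLM ∘ g) := g_cpt.comp_left rfl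
  have hg₂ : ContDiff ℝ ∞ (Complex.ofRealCLM ∘ g) := by fun_prop
  simpa using h (hg₁.toSchwartzMap hg₂)

/-- On integrable square-integrable functions the two inverse Fourier transforms agree. -/
lemma fourierInv_ae_eq (u : L2R) (hu : Integrable u) :
    ((𝓕⁻ u : L2R) : ℝ → ℂ) =ᵐ[volume] 𝓕⁻ (u : ℝ → ℂ) := by
  have hc : Continuous (𝓕⁻ (u : ℝ → ℂ)) := by
    have := VectorFourier.fourierIntegral_continuous Real.continuous_fourierChar
      (L := -innerₗ ℝ) (by simp only [LinearMap.neg_apply, innerₗ_apply_apply]; fun_prop) hu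
    exact this
  apply ae_eq_of_forall_schwartz ((Lp.memLp _).locallyIntegrable (by norm_num))
    hc.locallyIntegrable
  intro g
  have h1 := congrArg (fun T : TemperedDistribution ℝ ℂ => T g)
    (Lp.fourierInv_toTemperedDistribution_eq u)
  simp only [TemperedDistribution.fourierInv_apply, Lp.toTemperedDistribution_apply,
    smul_eq_mul] at h1
  rw [← h1]
  -- The inverse transform is the Fourier integral for the pairing `-innerₗ ℝ`. This pairing is
  -- symmetric, so the multiplication formula moves the transform from `g` to `u` unchanged.
  have h2 := VectorFourier.integral_fourierIntegral_smul_eq_flip (μ := volume) (ν := volume)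
    (L := -innerₗ ℝ) (f := fun x => g x) (g := fun x => u x) Real.continuous_fourierChar
    (by simp only [LinearMap.neg_apply, innerₗ_apply_apply]; fun_prop) g.integrable hu
  have h3 : (-innerₗ ℝ).flip = -innerₗ ℝ := by ext; simp
  rw [h3] at h2
  simp only [smul_eq_mul] at h2
  simp only [SchwartzMap.fourierInv_coe]
  exact h2

/-- Membership in $H^1$ provides $u\in L^2$ equal to $\langle\eta\rangle\widehat f$ as a
distribution. Multiplying by $\langle\eta\rangle^{-1}$, which is smooth and bounded, recovers
$\widehat f$ as a function, and $|\eta|\langle\eta\rangle^{-1}\le1$. -/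
lemma memLp_mul_fourier {f : L2R} (hf : MemHOne f) :
    MemLp (fun x : ℝ => (x : ℂ) * (𝓕 f : L2R) x) 2 volume := by
  obtain ⟨u, hu⟩ := TemperedDistribution.memSobolev_iff_exists_smulLeftCLM_fourier.mp hf
  set w : ℝ → ℂ := fun x ↦ Complex.ofReal ((1 + ‖x‖ ^ 2) ^ (-1 / 2 : ℝ) : ℝ) with hw
  have hwb : ∀ x, ‖w x‖ ≤ 1 := by
    intro x
    rw [hw, Complex.norm_real, Real.norm_eq_abs, abs_eq_self.mpr (by positivity)]
    exact Real.rpow_le_one_of_one_le_of_nonpos (by simp [sq_nonneg]) (by norm_num)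
  have hwT : w.HasTemperateGrowth := by fun_prop
  have hwm : MemLp w ∞ volume := memLp_top_of_bound hwT.1.continuous.aestronglyMeasurable 1
    (Filter.Eventually.of_forall hwb)
  have key : (𝓕 f : L2R) = hwm.toLp • u := by
    -- $L^2$ embeds injectively in the tempered distributions, so the identity may be checked there.
    rw [← sub_eq_zero, ← (Submodule.mem_bot ℂ),
      ← Lp.ker_toTemperedDistributionCLM_eq_bot (μ := (volume : Measure ℝ)), LinearMap.mem_ker,
      ContinuousLinearMap.coe_coe, map_sub, sub_eq_zero, Lp.toTemperedDistributionCLM_apply,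
      Lp.toTemperedDistributionCLM_apply, Lp.toTemperedDistribution_smul_eq hwT, ← hu,
      TemperedDistribution.smulLeftCLM_smulLeftCLM_apply (by fun_prop) hwT,
      Lp.fourier_toTemperedDistribution_eq]
    have h1 : ((fun x : ℝ => (((1 + ‖x‖ ^ 2) ^ ((1:ℝ) / 2) : ℝ) : ℂ)) * w) = fun _ => 1 := by
      ext x
      simp only [Pi.mul_apply, hw]
      rw [← ofReal_mul, ← Real.rpow_add (by positivity)]
      norm_num
    rw [h1, TemperedDistribution.smulLeftCLM_const, one_smul]
  refine MemLp.of_le (Lp.memLp u) ((continuous_ofReal.aestronglyMeasurable).mul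
    (Lp.aestronglyMeasurable _)) ?_
  rw [key]
  filter_upwards [Lp.coeFn_lpSMul (r := 2) hwm.toLp u, hwm.coeFn_toLp] with x h1 h2
  rw [h1, Pi.smul_apply', h2, smul_eq_mul, ← mul_assoc, norm_mul]
  refine mul_le_of_le_one_left (norm_nonneg _) ?_
  rw [hw, norm_mul, Complex.norm_real, Complex.norm_real, Real.norm_eq_abs, Real.norm_eq_abs,
    abs_of_nonneg (by positivity : (0:ℝ) ≤ (1 + |x| ^ 2) ^ (-1 / 2 : ℝ)), sq_abs,
    show (-1 / 2 : ℝ) = -(1/2) by norm_num, Real.rpow_neg (by positivity), ← Real.sqrt_eq_rpow]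
  rw [mul_inv_le_iff₀ (by positivity), one_mul]
  apply Real.abs_le_sqrt
  linarith

lemma norm_le_of_ae_le_indicator {f : L2R} {s : Set ℝ} (hs : MeasurableSet s)
    (hsv : volume s ≠ (⊤ : ENNReal)) {B : ℝ} (hB : 0 ≤ B)
    (hf : ∀ᵐ x, ‖f x‖ ≤ s.indicator (fun _ => B) x) :
    ‖f‖ ≤ B * √(volume.real s) := by
  have h1 : ‖f‖ ≤ ‖indicatorConstLp (μ := volume) 2 hs hsv (B : ℂ)‖ := by
    apply Lp.norm_le_norm_of_ae_le
    filter_upwards [hf, indicatorConstLp_coeFn (p := 2) (hs := hs) (hμs := hsv) (c := (B : ℂ))]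
      with x h1 h2
    rw [h2, norm_indicator_eq_indicator_norm]
    simpa [abs_of_nonneg hB] using h1
  rw [norm_indicatorConstLp (by norm_num) (by norm_num)] at h1
  simpa [abs_of_nonneg hB, Real.sqrt_eq_rpow] using h1

/-! ### Totally bounded sets of functions of bounded frequency -/

lemma totallyBounded_of_approx {X : Type*} [PseudoMetricSpace X] {S : Set X}
    (h : ∀ ε > 0, ∃ S' : Set X, TotallyBounded S' ∧ ∀ x ∈ S, ∃ y ∈ S', dist x y < ε) :
    TotallyBounded S := by
  rw [Metric.totallyBounded_iff]
  intro ε hε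
  obtain ⟨S', hS', hd⟩ := h (ε / 2) (by positivity)
  obtain ⟨t, ht, hst⟩ := Metric.totallyBounded_iff.mp hS' (ε / 2) (by positivity)
  refine ⟨t, ht, fun x hx => ?_⟩
  obtain ⟨y, hy, hxy⟩ := hd x hx
  obtain ⟨z, hz, hyz⟩ := Set.mem_iUnion₂.mp (hst hy)
  refine Set.mem_iUnion₂.mpr ⟨z, hz, ?_⟩
  rw [Metric.mem_ball] at hyz ⊢
  linarith [dist_triangle x y z]

lemma memLp_indicator_IccExtend {K : ℝ} (hK : -K ≤ K) (κ : ℝ)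
    (G : BoundedContinuousFunction (Set.Icc (-K) K) ℂ) :
    MemLp ((Set.Icc (-κ) κ).indicator (Set.IccExtend hK G)) 2 volume := by
  refine (memLp_indicator_iff_restrict measurableSet_Icc).mpr ?_
  refine MemLp.of_bound (G.continuous.Icc_extend'.aestronglyMeasurable) ‖G‖ ?_
  exact Filter.Eventually.of_forall fun x => G.norm_coe_le_norm _

/-- Extension by zero outside `[-κ, κ]`. -/
def bandExtend {K : ℝ} (hK : -K ≤ K) (κ : ℝ)
    (G : BoundedContinuousFunction (Set.Icc (-K) K) ℂ) : L2R :=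
  (memLp_indicator_IccExtend hK κ G).toLp _

lemma norm_bandExtend_sub_le {K : ℝ} (hK : -K ≤ K) {κ : ℝ} (hκ : κ ≤ K)
    (G G' : BoundedContinuousFunction (Set.Icc (-K) K) ℂ) :
    ‖bandExtend hK κ G - bandExtend hK κ G'‖ ≤ ‖G - G'‖ * √(2 * K) := by
  have hv : volume.real (Set.Icc (-K) K) = 2 * K := by
    rw [Real.volume_real_Icc_of_le hK]; ring
  rw [← hv]
  refine norm_le_of_ae_le_indicator measurableSet_Icc (by simp) (norm_nonneg _) ?_
  filter_upwards [Lp.coeFn_sub (bandExtend hK κ G) (bandExtend hK κ G'),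
    (memLp_indicator_IccExtend hK κ G).coeFn_toLp,
    (memLp_indicator_IccExtend hK κ G').coeFn_toLp] with x h1 h2 h3
  rw [h1, Pi.sub_apply, bandExtend, bandExtend, h2, h3]
  by_cases hx : x ∈ Set.Icc (-κ) κ
  · have hx' : x ∈ Set.Icc (-K) K := ⟨by linarith [hx.1], by linarith [hx.2]⟩
    rw [Set.indicator_of_mem hx, Set.indicator_of_mem hx, Set.indicator_of_mem hx']
    exact (G - G').norm_coe_le_norm _
  · rw [Set.indicator_of_notMem hx, Set.indicator_of_notMem hx, sub_zero, norm_zero]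
    exact Set.indicator_nonneg (fun _ _ => norm_nonneg _) _

/-- Moving the edge from `κ` to `κ'` alters the function only on two intervals of length `|κ - κ'|`.
This gives continuity in the edge, which varies with $h$ as long as the band $|\eta|\le1/(2h)$ is
narrower than the cutoff. -/
lemma norm_bandExtend_sub_le' {K : ℝ} (hK : -K ≤ K) {κ κ' : ℝ} (h : κ' ≤ κ)
    (G : BoundedContinuousFunction (Set.Icc (-K) K) ℂ) :
    ‖bandExtend hK κ G - bandExtend hK κ' G‖ ≤ ‖G‖ * √(2 * |κ - κ'|) := by
  set s : Set ℝ := Set.Icc (-κ) (-κ') ∪ Set.Icc κ' κ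
  have hv : volume.real s ≤ 2 * |κ - κ'| := by
    refine (measureReal_union_le _ _).trans ?_
    rw [Real.volume_real_Icc_of_le (by linarith), Real.volume_real_Icc_of_le h,
      abs_of_nonneg (by linarith)]
    linarith
  refine (norm_le_of_ae_le_indicator (s := s) (measurableSet_Icc.union measurableSet_Icc) ?_
    (norm_nonneg G) ?_).trans (mul_le_mul_of_nonneg_left (Real.sqrt_le_sqrt hv) (norm_nonneg _))
  · exact (measure_union_lt_top (by simp) (by simp)).ne
  filter_upwards [Lp.coeFn_sub (bandExtend hK κ G) (bandExtend hK κ' G),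
    (memLp_indicator_IccExtend hK κ G).coeFn_toLp,
    (memLp_indicator_IccExtend hK κ' G).coeFn_toLp] with x h1 h2 h3
  rw [h1, Pi.sub_apply, bandExtend, bandExtend, h2, h3]
  by_cases hx : x ∈ Set.Icc (-κ') κ'
  · have hx' : x ∈ Set.Icc (-κ) κ := ⟨by linarith [hx.1], by linarith [hx.2]⟩
    rw [Set.indicator_of_mem hx, Set.indicator_of_mem hx', sub_self, norm_zero]
    exact Set.indicator_nonneg (fun _ _ => norm_nonneg _) _
  · rw [Set.indicator_of_notMem hx, sub_zero]
    by_cases hx' : x ∈ Set.Icc (-κ) κ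
    · have hs : x ∈ s := by
        rcases le_or_gt x (-κ') with h4 | h4
        · exact Or.inl ⟨hx'.1, h4⟩
        · exact Or.inr ⟨(not_le.mp fun h5 => hx ⟨h4.le, h5⟩).le, hx'.2⟩
      rw [Set.indicator_of_mem hx', Set.indicator_of_mem hs]
      exact G.norm_coe_le_norm _
    · rw [Set.indicator_of_notMem hx', norm_zero]
      exact Set.indicator_nonneg (fun _ _ => norm_nonneg _) _

/-- Functions that are uniformly bounded and uniformly Lipschitz on an interval `[-κ, κ]` with
`κ ≤ K`, extended by zero, form a totally bounded subset of `L²(ℝ)`. -/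
lemma totallyBounded_band (K B : ℝ) (C : NNReal) :
    TotallyBounded {f : L2R | ∃ G : ℝ → ℂ, ∃ κ ∈ Set.Icc 0 K, (∀ x, ‖G x‖ ≤ B) ∧
      LipschitzWith C G ∧ f =ᵐ[volume] (Set.Icc (-κ) κ).indicator G} := by
  rcases lt_or_ge K 0 with hK0 | hK0
  · convert totallyBounded_empty
    ext f
    simp only [Set.mem_ofPred_eq, Set.mem_empty_iff_false, iff_false]
    rintro ⟨G, κ, hκ, -⟩
    linarith [hκ.1, hκ.2]
  have hK : -K ≤ K := by linarith
  set A : Set (BoundedContinuousFunction (Set.Icc (-K) K) ℂ) :=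
    {G | (∀ x, ‖G x‖ ≤ B) ∧ LipschitzWith C G} with hA
  have hAc : IsCompact (closure A) := by
    refine BoundedContinuousFunction.arzela_ascoli (Metric.closedBall (0 : ℂ) B)
      (isCompact_closedBall _ _) A (fun G x hG => by simpa using hG.1 x) ?_
    exact (LipschitzWith.uniformEquicontinuous _ C fun G => G.2.2).equicontinuous
  -- The functions in question form a subset of the image of the compact set `Set.Icc 0 K ×ˢ closure
  -- A`; joint continuity of extension by zero finishes the argument.
  have hcont : ContinuousOn (fun p : ℝ × BoundedContinuousFunction (Set.Icc (-K) K) ℂ =>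
      bandExtend hK p.1 p.2) (Set.Icc 0 K ×ˢ closure A) := by
    rintro ⟨κ, G⟩ ⟨hκ, -⟩
    rw [ContinuousWithinAt, tendsto_iff_dist_tendsto_zero]
    have hlim : Filter.Tendsto (fun p : ℝ × BoundedContinuousFunction (Set.Icc (-K) K) ℂ =>
        ‖p.2 - G‖ * √(2 * K) + ‖G‖ * √(2 * |p.1 - κ|))
        (nhdsWithin (κ, G) (Set.Icc 0 K ×ˢ closure A)) (nhds 0) := by
      have : Continuous (fun p : ℝ × BoundedContinuousFunction (Set.Icc (-K) K) ℂ =>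
        ‖p.2 - G‖ * √(2 * K) + ‖G‖ * √(2 * |p.1 - κ|)) := by fun_prop
      have h := this.tendsto (κ, G)
      simp only [sub_self, norm_zero, abs_zero, mul_zero, zero_mul, Real.sqrt_zero, add_zero] at h
      exact h.mono_left nhdsWithin_le_nhds
    refine squeeze_zero' (Filter.Eventually.of_forall fun _ => dist_nonneg) ?_ hlim
    filter_upwards [self_mem_nhdsWithin] with p hp
    rw [dist_eq_norm, ← sub_add_sub_cancel _ (bandExtend hK p.1 G)]
    refine (norm_add_le _ _).trans (add_le_add (norm_bandExtend_sub_le hK hp.1.2 _ _) ?_)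
    rcases le_total κ p.1 with h | h
    · exact norm_bandExtend_sub_le' hK h G
    · rw [norm_sub_rev, abs_sub_comm]
      exact norm_bandExtend_sub_le' hK h G
  refine ((isCompact_Icc.prod hAc).image_of_continuousOn hcont).totallyBounded.subset ?_
  rintro f ⟨G, κ, hκ, hGB, hGC, hf⟩
  have hGl : LipschitzWith C (fun x : Set.Icc (-K) K => G x) := by
    have := hGC.comp (LipschitzWith.subtype_val (Set.Icc (-K) K))
    rwa [mul_one] at this
  refine ⟨⟨κ, BoundedContinuousFunction.ofNormedAddCommGroup (fun x : Set.Icc (-K) K => G x)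
    hGl.continuous B fun x => hGB x⟩, ⟨hκ, subset_closure ⟨fun x => hGB x, hGl⟩⟩, ?_⟩
  apply Lp.ext
  refine ((memLp_indicator_IccExtend hK κ _).coeFn_toLp).trans (Filter.EventuallyEq.trans ?_ hf.symm)
  refine Filter.Eventually.of_forall fun x => ?_
  by_cases hx : x ∈ Set.Icc (-κ) κ
  · have hx' : x ∈ Set.Icc (-K) K := ⟨by linarith [hx.1, hκ.2], by linarith [hx.2, hκ.2]⟩
    simp only [Set.indicator_of_mem hx]
    rw [Set.IccExtend_of_mem _ _ hx']
    rfl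
  · simp only [Set.indicator_of_notMem hx]

/-! ### Sequences as functions supported in a frequency band -/

instance instFactTwoPiPos : Fact (0 < 2 * Real.pi) := ⟨Real.two_pi_pos⟩

/-- The frequency band `|η| ≤ 1 / (2 h)` of functions sampled at step `h`. -/
def band (h : ℝ) : Set ℝ := Set.Icc (-(1 / (2 * h))) (1 / (2 * h))

lemma measurableSet_band (h : ℝ) : MeasurableSet (band h) := measurableSet_Icc

/-- The covering of the circle by the frequency band. -/
def bandMap (h η : ℝ) : AddCircle (2 * Real.pi) := ((-(2 * Real.pi * h * η) : ℝ) : AddCircle _)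

/-- The substitution $\theta=-2\pi h\eta$ carries the band onto one period. The factor $h$ is the
reciprocal of the band's length, which makes the measure a probability measure like normalised Haar
measure. -/
lemma measurePreserving_bandMap {h : ℝ} (hh : 0 < h) :
    MeasurePreserving (bandMap h) (ENNReal.ofReal h • volume.restrict (band h))
      (AddCircle.haarAddCircle (T := 2 * Real.pi)) := by
  have hpi := Real.pi_pos
  set a : ℝ := -(2 * Real.pi * h) with ha
  have ha0 : a ≠ 0 := by rw [ha]; exact neg_ne_zero.mpr (by positivity)
  have h1 : MeasurePreserving (fun η : ℝ => a * η) (ENNReal.ofReal (2 * Real.pi * h) • volume)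
      volume := by
    refine ⟨by fun_prop, ?_⟩
    rw [Measure.map_smul, Real.map_volume_mul_left ha0, smul_smul, ha, abs_inv, abs_neg,
      abs_of_pos (by positivity), ← ENNReal.ofReal_mul (by positivity),
      mul_inv_cancel₀ (by positivity), ENNReal.ofReal_one, one_smul]
  have h2 := h1.restrict_preimage (s := Set.Ioc (-Real.pi) (-Real.pi + 2 * Real.pi))
    measurableSet_Ioc
  have h3 := (AddCircle.measurePreserving_mk (2 * Real.pi) (-Real.pi)).comp h2
  have h4 := h3.smul_measure (ENNReal.ofReal (2 * Real.pi))⁻¹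
  rw [AddCircle.volume_eq_smul_haarAddCircle, smul_smul, ENNReal.inv_mul_cancel (by simp; positivity)
    ENNReal.ofReal_ne_top, one_smul, Measure.restrict_smul, smul_smul] at h4
  -- The slope is negative, so the half-open period pulls back to an interval open at the other end;
  -- the endpoints are null.
  have h5 : (fun η : ℝ => a * η) ⁻¹' Set.Ioc (-Real.pi) (-Real.pi + 2 * Real.pi) =
      Set.Ico (-(1 / (2 * h))) (1 / (2 * h)) := by
    ext η
    simp only [Set.mem_preimage, Set.mem_Ioc, Set.mem_Ico, ha]
    have e1 : -(1 / (2 * h)) ≤ η ↔ -(2 * Real.pi * h) * η ≤ -Real.pi + 2 * Real.pi := by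
      rw [neg_le, div_eq_mul_inv, one_mul, ← mul_le_mul_iff_right₀ (by positivity : 0 < 2 * Real.pi * h),
        show 2 * Real.pi * h * (2 * h)⁻¹ = Real.pi by field_simp]
      constructor <;> intro h <;> linarith
    have e2 : η < 1 / (2 * h) ↔ -Real.pi < -(2 * Real.pi * h) * η := by
      rw [div_eq_mul_inv, one_mul, ← mul_lt_mul_iff_right₀ (by positivity : 0 < 2 * Real.pi * h),
        show 2 * Real.pi * h * (2 * h)⁻¹ = Real.pi by field_simp]
      constructor <;> intro h <;> linarith
    rw [e1, e2, and_comm]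
  rw [h5, ← ENNReal.ofReal_inv_of_pos (by positivity), ← ENNReal.ofReal_mul (by positivity),
    show (2 * Real.pi)⁻¹ * (2 * Real.pi * h) = h by field_simp,
    Measure.restrict_congr_set Ico_ae_eq_Icc] at h4
  rw [band]
  convert! h4 using 1
  ext η
  simp [bandMap, ha]

lemma ae_restrict_band {h : ℝ} (hh : 0 < h) {p : AddCircle (2 * Real.pi) → Prop}
    (hp : ∀ᵐ x ∂(AddCircle.haarAddCircle (T := 2 * Real.pi)), p x) :
    ∀ᵐ η ∂(volume.restrict (band h)), p (bandMap h η) := by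
  have h1 := (measurePreserving_bandMap hh).quasiMeasurePreserving.ae hp
  exact (Measure.absolutelyContinuous_smul (by simpa using hh)).ae_le h1

lemma seqHat_eq (c : EllTwo) (h η : ℝ) : seqHat c (2 * Real.pi * h * η) =
    ((fourierBasis (T := 2 * Real.pi)).repr.symm c) (bandMap h η) := rfl

/-- Parseval on the circle, transported by `bandMap`; the factor `1 / √h` comes from the
normalisation of the measure. -/
lemma eLpNorm_seqHat {h : ℝ} (hh : 0 < h) (c : EllTwo) :
    eLpNorm ((band h).indicator fun η => seqHat c (2 * Real.pi * h * η)) 2 volume =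
      ENNReal.ofReal (‖c‖ / √h) := by
  rw [eLpNorm_indicator_eq_eLpNorm_restrict (measurableSet_band h)]
  set F := (fourierBasis (T := 2 * Real.pi)).repr.symm c
  have h1 := eLpNorm_comp_measurePreserving (p := 2) (Lp.aestronglyMeasurable F)
    (measurePreserving_bandMap hh)
  rw [eLpNorm_smul_measure_of_ne_top (by norm_num), ← Lp.enorm_def] at h1
  have h2 : ‖F‖ = ‖c‖ := LinearIsometryEquiv.norm_map _ _
  rw [← ofReal_norm, h2, smul_eq_mul] at h1
  have h3 : (ENNReal.ofReal h ^ (1 / (2 : ENNReal)).toReal) = ENNReal.ofReal √h := by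
    rw [ENNReal.ofReal_rpow_of_pos hh, Real.sqrt_eq_rpow]; simp
  rw [h3] at h1
  have hs : 0 < √h := Real.sqrt_pos.mpr hh
  rw [ENNReal.ofReal_div_of_pos hs, ← h1, ENNReal.eq_div_iff
    (by simpa using hh) (by simp)]
  rfl

lemma memLp_seqHat {h : ℝ} (hh : 0 < h) (c : EllTwo) :
    MemLp ((band h).indicator fun η => seqHat c (2 * Real.pi * h * η)) 2 volume := by
  refine ⟨?_, by rw [eLpNorm_seqHat hh]; exact ENNReal.ofReal_lt_top⟩
  refine (aestronglyMeasurable_indicator_iff (measurableSet_band h)).mpr ?_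
  have h1 := (Lp.aestronglyMeasurable ((fourierBasis (T := 2 * Real.pi)).repr.symm c)).comp_measurePreserving
    (measurePreserving_bandMap hh)
  exact h1.mono_ac (Measure.absolutelyContinuous_smul (by simpa using hh))

/-- The map from sequences to the Fourier transforms of their band-limited interpolations (up to
the factor `h`), in the variable dual to Mathlib's Fourier transform. -/
def toBand {h : ℝ} (hh : 0 < h) : EllTwo →L[ℂ] L2R :=
  LinearMap.mkContinuous
    { toFun := fun c => (memLp_seqHat hh c).toLp _
      map_add' := by
        intro c d
        rw [← MemLp.toLp_add]
        refine MemLp.toLp_congr _ _ ?_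
        have h1 := ae_restrict_band hh (Lp.coeFn_add ((fourierBasis (T := 2 * Real.pi)).repr.symm c)
          ((fourierBasis (T := 2 * Real.pi)).repr.symm d))
        rw [ae_restrict_iff' (measurableSet_band h)] at h1
        filter_upwards [h1] with η h2
        by_cases hη : η ∈ band h
        · simp only [Set.indicator_of_mem hη, Pi.add_apply]
          rw [seqHat_eq, map_add, h2 hη]
          rfl
        · simp [Set.indicator_of_notMem hη]
      map_smul' := by
        intro z c
        rw [RingHom.id_apply, ← MemLp.toLp_const_smul]
        refine MemLp.toLp_congr _ _ ?_
        have h1 := ae_restrict_band hh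
          (Lp.coeFn_smul z ((fourierBasis (T := 2 * Real.pi)).repr.symm c))
        rw [ae_restrict_iff' (measurableSet_band h)] at h1
        filter_upwards [h1] with η h2
        by_cases hη : η ∈ band h
        · simp only [Set.indicator_of_mem hη, Pi.smul_apply]
          rw [seqHat_eq, map_smul, h2 hη]
          rfl
        · simp [Set.indicator_of_notMem hη] }
    (1 / √h) (fun c => by
      change ‖(memLp_seqHat hh c).toLp _‖ ≤ _
      rw [Lp.norm_toLp, eLpNorm_seqHat hh, ENNReal.toReal_ofReal (by positivity)]
      exact le_of_eq (by ring))

lemma toBand_ae {h : ℝ} (hh : 0 < h) (c : EllTwo) :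
    toBand hh c =ᵐ[volume] (band h).indicator fun η => seqHat c (2 * Real.pi * h * η) :=
  (memLp_seqHat hh c).coeFn_toLp

lemma norm_toBand {h : ℝ} (hh : 0 < h) (c : EllTwo) : ‖toBand hh c‖ = ‖c‖ / √h := by
  change ‖(memLp_seqHat hh c).toLp _‖ = _
  rw [Lp.norm_toLp, eLpNorm_seqHat hh, ENNReal.toReal_ofReal (by positivity)]

lemma toBand_single {h : ℝ} (hh : 0 < h) (n : ℤ) :
    toBand hh (lp.single 2 n (1 : ℂ)) =ᵐ[volume]
      (band h).indicator fun η => exp (-(2 * Real.pi * I * (h * n) * η)) := by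
  refine (toBand_ae hh _).trans ?_
  have h1 := ae_restrict_band hh (coeFn_fourierLp (T := 2 * Real.pi) 2 n)
  rw [ae_restrict_iff' (measurableSet_band h)] at h1
  filter_upwards [h1] with η h2
  by_cases hη : η ∈ band h
  · simp only [Set.indicator_of_mem hη]
    rw [seqHat_eq, HilbertBasis.repr_symm_single, coe_fourierBasis, h2 hη, bandMap,
      fourier_coe_apply]
    congr 1
    have : (Real.pi : ℂ) ≠ 0 := by exact_mod_cast Real.pi_ne_zero
    push_cast
    field_simp
  · simp [Set.indicator_of_notMem hη]

/-- The adjoint of `toBand` samples the inverse Fourier transform at the points `h n`. -/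
lemma adjoint_toBand_apply {h : ℝ} (hh : 0 < h) (f : L2R) (n : ℤ) :
    (ContinuousLinearMap.adjoint (toBand hh) f) n =
      ∫ η in band h, exp (2 * Real.pi * I * (h * n) * η) * f η := by
  have h1 : (ContinuousLinearMap.adjoint (toBand hh) f) n =
      inner ℂ (lp.single 2 n (1 : ℂ)) (ContinuousLinearMap.adjoint (toBand hh) f) := by
    rw [lp.inner_single_left]; simp
  rw [h1, ContinuousLinearMap.adjoint_inner_right, L2.inner_def,
    ← integral_indicator (measurableSet_band h)]
  refine integral_congr_ae ?_
  filter_upwards [toBand_single hh n] with η hη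
  rw [hη, RCLike.inner_apply']
  by_cases hb : η ∈ band h
  · simp only [Set.indicator_of_mem hb]
    rw [← exp_conj]
    simp [conj_ofNat]
  · simp [Set.indicator_of_notMem hb]

lemma norm_adjoint_toBand_le {h : ℝ} (hh : 0 < h) (f : L2R) :
    ‖ContinuousLinearMap.adjoint (toBand hh) f‖ ≤ ‖f‖ / √h := by
  refine (ContinuousLinearMap.le_opNorm _ _).trans ?_
  rw [LinearIsometryEquiv.norm_map, div_eq_inv_mul]
  gcongr
  refine ContinuousLinearMap.opNorm_le_bound _ (by positivity) fun c => ?_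
  rw [norm_toBand, div_eq_inv_mul]

/-! ### Elementary operations on square-summable sequences -/

lemma hasSum_sq (c : EllTwo) : HasSum (fun n => ‖c n‖ ^ 2) (‖c‖ ^ 2) := by
  have := lp.hasSum_norm (p := 2) (by norm_num) c
  simpa using this

lemma memEllTwo_of_summable {f : ℤ → ℂ} (hf : Summable fun n => ‖f n‖ ^ 2) : Memℓp f 2 :=
  memℓp_gen (by simpa using hf)

lemma norm_apply_le (c : EllTwo) (n : ℤ) : ‖c n‖ ≤ ‖c‖ :=
  lp.norm_apply_le_norm (by norm_num) c n

/-- The sequence of absolute values. -/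
def absSeq (c : EllTwo) : EllTwo :=
  ⟨fun n => (‖c n‖ : ℂ), memEllTwo_of_summable (by simpa using (hasSum_sq c).summable)⟩

lemma absSeq_apply (c : EllTwo) (n : ℤ) : absSeq c n = (‖c n‖ : ℂ) := rfl

lemma norm_le_of_norm_apply_le {c d : EllTwo} (h : ∀ n, ‖c n‖ ≤ ‖d n‖) : ‖c‖ ≤ ‖d‖ := by
  refine (sq_le_sq₀ (norm_nonneg _) (norm_nonneg _)).mp ?_
  exact hasSum_le (fun n => pow_le_pow_left₀ (norm_nonneg _) (h n) 2) (hasSum_sq c) (hasSum_sq d)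

lemma norm_absSeq (c : EllTwo) : ‖absSeq c‖ = ‖c‖ :=
  le_antisymm (norm_le_of_norm_apply_le fun n => by simp [absSeq_apply])
    (norm_le_of_norm_apply_le fun n => by simp [absSeq_apply])

/-- The triangle inequality applied to the sequences of moduli. It turns coordinatewise estimates of
nonlinear terms into $\ell^2$ estimates. -/
lemma norm_le_add_of_norm_apply_le {c d e : EllTwo} {A B : ℝ} (hA : 0 ≤ A) (hB : 0 ≤ B)
    (h : ∀ n, ‖c n‖ ≤ A * ‖d n‖ + B * ‖e n‖) : ‖c‖ ≤ A * ‖d‖ + B * ‖e‖ := by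
  set d' : EllTwo := (A : ℂ) • absSeq d
  set e' : EllTwo := (B : ℂ) • absSeq e
  have hd : ‖d'‖ = A * ‖d‖ := by
    rw [norm_smul, norm_absSeq, Complex.norm_real, Real.norm_of_nonneg hA]
  have he : ‖e'‖ = B * ‖e‖ := by
    rw [norm_smul, norm_absSeq, Complex.norm_real, Real.norm_of_nonneg hB]
  rw [← hd, ← he]
  refine (norm_le_of_norm_apply_le fun n => (h n).trans (le_of_eq ?_)).trans (norm_add_le d' e')
  change _ = ‖(A : ℂ) * (‖d n‖ : ℂ) + (B : ℂ) * (‖e n‖ : ℂ)‖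
  rw [← ofReal_mul, ← ofReal_mul, ← ofReal_add, Complex.norm_real,
    Real.norm_of_nonneg (by positivity)]

lemma norm_le_of_norm_apply_le_mul {c d : EllTwo} {A : ℝ} (hA : 0 ≤ A)
    (h : ∀ n, ‖c n‖ ≤ A * ‖d n‖) : ‖c‖ ≤ A * ‖d‖ := by
  simpa using norm_le_add_of_norm_apply_le (e := 0) hA le_rfl (fun n => by simpa using h n)

lemma hasSum_sq_shift (c : EllTwo) (k : ℤ) : HasSum (fun n => ‖c (n + k)‖ ^ 2) (‖c‖ ^ 2) :=
  (Equiv.hasSum_iff (f := fun n => ‖c n‖ ^ 2) (Equiv.addRight k)).mpr (hasSum_sq c)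

/-- Translation of sequences. -/
def translate (k : ℤ) (c : EllTwo) : EllTwo :=
  ⟨fun n => c (n + k), memEllTwo_of_summable (hasSum_sq_shift c k).summable⟩

lemma norm_translate (k : ℤ) (c : EllTwo) : ‖translate k c‖ = ‖c‖ :=
  (sq_eq_sq₀ (norm_nonneg _) (norm_nonneg _)).mp
    ((hasSum_sq (translate k c)).unique (hasSum_sq_shift c k))

/-- Translation of sequences as a linear isometry. -/
def shift (k : ℤ) : EllTwo →ₗᵢ[ℂ] EllTwo where
  toFun := translate k
  map_add' _ _ := lp.ext rfl
  map_smul' _ _ := lp.ext rfl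
  norm_map' := norm_translate k

@[simp] lemma shift_apply (k : ℤ) (c : EllTwo) (n : ℤ) : shift k c n = c (n + k) := rfl

/-- The symmetric difference `c_{n+1} - c_{n-1}`. -/
def symmetricDiff : EllTwo →L[ℂ] EllTwo :=
  (shift 1).toContinuousLinearMap - (shift (-1)).toContinuousLinearMap

lemma symmetricDiff_apply (c : EllTwo) (n : ℤ) : symmetricDiff c n = c (n + 1) - c (n - 1) := rfl

lemma norm_symmetricDiff_le (c : EllTwo) : ‖symmetricDiff c‖ ≤ 2 * ‖c‖ := by
  change ‖shift 1 c - shift (-1) c‖ ≤ _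
  refine (norm_sub_le _ _).trans ?_
  rw [LinearIsometry.norm_map, LinearIsometry.norm_map, two_mul]

/-- The forward difference `c_{n+1} - c_n`. -/
def forwardDiff : EllTwo →L[ℂ] EllTwo :=
  (shift 1).toContinuousLinearMap - ContinuousLinearMap.id ℂ EllTwo

lemma forwardDiff_apply (c : EllTwo) (n : ℤ) : forwardDiff c n = c (n + 1) - c n := rfl

lemma norm_symmetricDiff_le_forwardDiff (c : EllTwo) : ‖symmetricDiff c‖ ≤ 2 * ‖forwardDiff c‖ := by
  have h : symmetricDiff c = forwardDiff c + shift (-1) (forwardDiff c) := by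
    ext n
    simp [symmetricDiff_apply, forwardDiff_apply]
    ring_nf
  rw [h, two_mul]
  exact (norm_add_le _ _).trans (by rw [LinearIsometry.norm_map])

/-- Pointwise multiplication of a square-summable sequence by a bounded sequence. -/
def mulSeq (m : ℤ → ℂ) (c : EllTwo) : EllTwo :=
  open Classical in if h : Memℓp (fun n => m n * c n) 2 then ⟨_, h⟩ else 0

lemma mulSeq_apply {m : ℤ → ℂ} {B : ℝ} (hm : ∀ n, ‖m n‖ ≤ B) (c : EllTwo) (n : ℤ) :
    mulSeq m c n = m n * c n := by
  have h : Memℓp (fun n => m n * c n) 2 := by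
    refine memEllTwo_of_summable (((hasSum_sq c).summable.mul_left (B ^ 2)).of_nonneg_of_le
      (fun n => by positivity) fun n => ?_)
    rw [norm_mul, mul_pow]
    gcongr
    exact hm n
  rw [mulSeq, dif_pos h]

/-! ### Global solutions of ordinary differential equations -/

/-- The speed is at most `L`, so over a time `N + 1` the solution stays within `L * (N + 1)` of
`x₀`; Picard–Lindelöf then applies on every interval, and uniqueness glues the pieces. -/
lemma exists_global_solution {E : Type*} [NormedAddCommGroup E] [NormedSpace ℝ E] [CompleteSpace E]
    {f : E → E} {K L : NNReal} (hf : LipschitzWith K f) (hb : ∀ x, ‖f x‖ ≤ L) (x₀ : E) :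
    ∃ α : ℝ → E, α 0 = x₀ ∧ ∀ t, HasDerivAt α (f (α t)) t := by
  have hex : ∀ N : ℕ, ∃ α : ℝ → E, α 0 = x₀ ∧
      ∀ t ∈ Set.Ioo (-(N + 1 : ℝ)) (N + 1), HasDerivAt α (f (α t)) t := by
    intro N
    have h0 : (0 : ℝ) ∈ Set.Icc (-(N + 1 : ℝ)) (N + 1) := ⟨by linarith [N.cast_nonneg (α := ℝ)],
      by positivity⟩
    have hP : IsPicardLindelof (fun _ => f) (⟨0, h0⟩ : Set.Icc (-(N + 1 : ℝ)) (N + 1)) x₀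
        (L * (N + 1)) 0 L K :=
      IsPicardLindelof.of_time_independent (fun x _ => hb x) hf.lipschitzOnWith (by simp)
    obtain ⟨α, h1, h2⟩ := hP.exists_eq_forall_mem_Icc_hasDerivWithinAt₀
    exact ⟨α, h1, fun t ht => (h2 t (Set.Ioo_subset_Icc_self ht)).hasDerivAt (Icc_mem_nhds ht.1 ht.2)⟩
  choose β hβ0 hβ using hex
  have huniq : ∀ N M : ℕ, ∀ t : ℝ, |t| < N + 1 → |t| < M + 1 → β N t = β M t := by
    intro N M t hN hM
    set r : ℝ := min (N + 1) (M + 1)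
    have hr : 0 < r := by positivity
    have hrN : r ≤ N + 1 := min_le_left _ _
    have hrM : r ≤ M + 1 := min_le_right _ _
    refine ODE_solution_unique_of_mem_Ioo (v := fun _ => f) (s := fun _ => Set.univ) (K := K)
      (a := -r) (b := r) (t₀ := 0)
      (fun _ _ => hf.lipschitzOnWith) ⟨by linarith, hr⟩
      (fun s hs => ⟨hβ N s ⟨by linarith [hs.1], by linarith [hs.2]⟩, trivial⟩)
      (fun s hs => ⟨hβ M s ⟨by linarith [hs.1], by linarith [hs.2]⟩, trivial⟩)
      (by rw [hβ0, hβ0]) (abs_lt.mp (lt_min hN hM))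
  -- At time `t` the piece of index `⌈|t|⌉₊` is read; its interval reaches strictly beyond `|t|`.
  refine ⟨fun t => β ⌈|t|⌉₊ t, hβ0 _, fun t => ?_⟩
  have hc : ∀ s : ℝ, |s| < (⌈|s|⌉₊ : ℝ) + 1 := fun s =>
    lt_of_le_of_lt (Nat.le_ceil _) (lt_add_one _)
  have ht := hc t
  refine (hβ ⌈|t|⌉₊ t (abs_lt.mp ht)).congr_of_eventuallyEq ?_
  filter_upwards [(continuous_abs.tendsto t).eventually_lt_const ht] with s hs
  exact huniq _ _ s (hc s) hs

/-- A continuous curve in `ℓ²` whose coordinates have derivatives that form a continuous curve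
in `ℓ²` is differentiable in `ℓ²`. -/
lemma hasDerivAt_of_forall_apply {α V : ℝ → EllTwo} (hV : Continuous V)
    (h : ∀ t n, HasDerivAt (fun s => α s n) (V t n) t) (t : ℝ) : HasDerivAt α (V t) t := by
  set β : ℝ → EllTwo := fun t => α 0 + ∫ s in (0 : ℝ)..t, V s with hβ
  have hd : ∀ t, HasDerivAt β (V t) t := fun t =>
    (intervalIntegral.integral_hasDerivAt_right (hV.intervalIntegrable _ _)
      (hV.stronglyMeasurableAtFilter _ _) hV.continuousAt).const_add _
  have heq : α = β := by
    ext t n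
    have hn : ∀ t, HasDerivAt (fun s => α s n - β s n) 0 t := fun t => by
      have h1 : HasDerivAt (fun s => β s n) (V t n) t :=
        ((lp.evalCLM ℂ (fun _ : ℤ => ℂ) 2 n).restrictScalars ℝ).hasFDerivAt.comp_hasDerivAt t (hd t)
      have h2 := (h t n).sub h1
      rwa [sub_self] at h2
    have h2 := is_const_of_deriv_eq_zero (fun t => (hn t).differentiableAt)
      (fun t => (hn t).deriv) t 0
    simp only [hβ, intervalIntegral.integral_same, add_zero, sub_self] at h2
    exact sub_eq_zero.mp h2
  rw [heq]
  exact hd t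

section

/-! ### The density of the conserved mass -/

/-- The coefficient `1 - σ s`, frozen outside `0 ≤ s ≤ 1 / 4`. -/
def coeff (σ s : ℝ) : ℝ := 1 - σ * min (max s 0) (1 / 4)

lemma coeff_eq {σ s : ℝ} (h0 : 0 ≤ s) (h1 : s ≤ 1 / 4) : coeff σ s = 1 - σ * s := by
  rw [coeff, max_eq_left h0, min_eq_left h1]

lemma continuous_coeff (σ : ℝ) : Continuous (coeff σ) := by
  unfold coeff; fun_prop

lemma coeff_bounds {σ : ℝ} (hσ : |σ| ≤ 1) (s : ℝ) : 3 / 4 ≤ coeff σ s ∧ coeff σ s ≤ 5 / 4 := by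
  have h0 : 0 ≤ min (max s 0) (1 / 4) := le_min (le_max_right _ _) (by norm_num)
  have h1 : min (max s 0) (1 / 4) ≤ 1 / 4 := min_le_right _ _
  have h2 := abs_le.mp hσ
  unfold coeff
  constructor <;> nlinarith

lemma coeff_pos {σ : ℝ} (hσ : |σ| ≤ 1) (s : ℝ) : 0 < coeff σ s :=
  lt_of_lt_of_le (by norm_num) (coeff_bounds hσ s).1

lemma abs_inv_coeff_sub_one_le {σ s : ℝ} (hσ : |σ| ≤ 1) (hs : 0 ≤ s) :
    |(coeff σ s)⁻¹ - 1| ≤ 4 / 3 * s := by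
  have hp := coeff_pos hσ s
  have hb := (coeff_bounds hσ s).1
  have h1 : (coeff σ s)⁻¹ - 1 = (1 - coeff σ s) / coeff σ s := by field_simp
  rw [h1, abs_div, abs_of_pos hp, div_le_iff₀ hp]
  have h2 : |1 - coeff σ s| ≤ s := by
    rw [coeff, max_eq_left hs, sub_sub_cancel, abs_mul,
      abs_of_nonneg (le_min hs (by norm_num) : 0 ≤ min s (1 / 4))]
    calc |σ| * min s (1 / 4) ≤ 1 * s := by gcongr; exact min_le_left _ _
      _ = s := one_mul s
  nlinarith

/-- The mass density `∫₀ˢ dr / (1 - σ r)` as a function of `s = |α_n|²`. -/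
def massDensity (σ s : ℝ) : ℝ := ∫ r in (0 : ℝ)..s, (coeff σ r)⁻¹

lemma continuous_inv_coeff {σ : ℝ} (hσ : |σ| ≤ 1) : Continuous fun r => (coeff σ r)⁻¹ :=
  (continuous_coeff σ).inv₀ fun r => (coeff_pos hσ r).ne'

lemma hasDerivAt_massDensity {σ : ℝ} (hσ : |σ| ≤ 1) (s : ℝ) :
    HasDerivAt (massDensity σ) (coeff σ s)⁻¹ s :=
  intervalIntegral.integral_hasDerivAt_right ((continuous_inv_coeff hσ).intervalIntegrable _ _)
    ((continuous_inv_coeff hσ).stronglyMeasurableAtFilter _ _) (continuous_inv_coeff hσ).continuousAt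

lemma massDensity_bounds {σ s : ℝ} (hσ : |σ| ≤ 1) (hs : 0 ≤ s) :
    4 / 5 * s ≤ massDensity σ s ∧ massDensity σ s ≤ 4 / 3 * s := by
  have hi := (continuous_inv_coeff hσ).intervalIntegrable (μ := volume) 0 s
  constructor
  · have := intervalIntegral.integral_mono_on hs (intervalIntegrable_const (c := (4 / 5 : ℝ))) hi
      fun r _ => by
        rw [le_inv_comm₀ (by norm_num) (coeff_pos hσ r)]
        exact (coeff_bounds hσ r).2.trans (by norm_num)
    rw [intervalIntegral.integral_const, sub_zero, smul_eq_mul, mul_comm] at this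
    exact this
  · have := intervalIntegral.integral_mono_on hs hi (intervalIntegrable_const (c := (4 / 3 : ℝ)))
      fun r _ => by
        rw [inv_le_comm₀ (coeff_pos hσ r) (by norm_num)]
        exact le_trans (by norm_num) (coeff_bounds hσ r).1
    rw [intervalIntegral.integral_const, sub_zero, smul_eq_mul, mul_comm s] at this
    exact this

lemma massDensity_nonneg {σ s : ℝ} (hσ : |σ| ≤ 1) (hs : 0 ≤ s) : 0 ≤ massDensity σ s :=
  le_trans (by positivity) (massDensity_bounds hσ hs).1

lemma abs_massDensity_sub_le {σ s : ℝ} (hσ : |σ| ≤ 1) (hs : 0 ≤ s) :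
    |massDensity σ s - s| ≤ 4 / 3 * s ^ 2 := by
  have h1 : massDensity σ s - s = ∫ r in (0 : ℝ)..s, ((coeff σ r)⁻¹ - 1) := by
    rw [intervalIntegral.integral_sub ((continuous_inv_coeff hσ).intervalIntegrable _ _)
      intervalIntegrable_const]
    simp [massDensity]
  rw [h1]
  have h2 := intervalIntegral.norm_integral_le_of_norm_le_const (a := 0) (b := s)
    (f := fun r => (coeff σ r)⁻¹ - 1) (C := 4 / 3 * s) fun r hr => by
      rw [Set.uIoc_of_le hs] at hr
      exact (abs_inv_coeff_sub_one_le hσ hr.1.le).trans (by linarith [hr.2])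
  rw [Real.norm_eq_abs, sub_zero, abs_of_nonneg hs] at h2
  linarith [h2, sq s]

/-! ### Evolution of sums over the lattice -/

/-- Each term is the integral of its derivative. The dominating series has a continuous sum, so
dominated convergence allows the integral and the sum over `n` to be exchanged. -/
lemma tsum_sub_tsum_eq_integral {f d b : ℤ → ℝ → ℝ} {B D : ℝ → ℝ}
    (hf : ∀ n t, HasDerivAt (f n) (d n t) t) (hd : ∀ n, Continuous (d n))
    (hdb : ∀ n t, |d n t| ≤ b n t) (hb : ∀ t, HasSum (b · t) (B t)) (hB : Continuous B)
    (hD : ∀ t, HasSum (d · t) (D t)) (hs : ∀ t, Summable (f · t)) (t₀ t : ℝ) :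
    ∑' n, f n t - ∑' n, f n t₀ = ∫ s in t₀..t, D s := by
  have h1 := intervalIntegral.hasSum_integral_of_dominated_convergence (μ := volume)
    (F := d) (f := D) (a := t₀) (b := t) b
    (fun n => (hd n).aestronglyMeasurable)
    (fun n => Filter.Eventually.of_forall fun s _ => hdb n s)
    (Filter.Eventually.of_forall fun s _ => (hb s).summable)
    (by simpa only [(hb _).tsum_eq] using hB.intervalIntegrable _ _)
    (Filter.Eventually.of_forall fun s _ => hD s)
  have h2 : ∀ n, ∫ s in t₀..t, d n s = f n t - f n t₀ := fun n =>
    intervalIntegral.integral_eq_sub_of_hasDerivAt (fun s _ => hf n s)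
      ((hd n).intervalIntegrable _ _)
  simp only [h2] at h1
  rw [← (hs t).tsum_sub (hs t₀)]
  exact h1.tsum_eq

lemma continuous_apply {a : ℝ → EllTwo} (ha : Continuous a) (n : ℤ) : Continuous fun t => a t n :=
  (lp.evalCLM ℂ (fun _ : ℤ => ℂ) 2 n).continuous.comp ha

/-- The mass current `2 Re (conj c_n (c_{n+1} - c_{n-1}))`. -/
def current (c : ℤ → ℂ) (n : ℤ) : ℝ := 2 * (conj (c n) * (c (n + 1) - c (n - 1))).re

lemma abs_current_le (c : ℤ → ℂ) (n : ℤ) :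
    |current c n| ≤ ‖c (n + 1)‖ ^ 2 + 2 * ‖c n‖ ^ 2 + ‖c (n - 1)‖ ^ 2 := by
  rw [current, abs_mul, abs_two]
  have h1 : |(conj (c n) * (c (n + 1) - c (n - 1))).re| ≤
      ‖c n‖ * (‖c (n + 1)‖ + ‖c (n - 1)‖) := by
    refine (abs_re_le_norm _).trans ?_
    rw [norm_mul, norm_conj]
    gcongr
    exact norm_sub_le _ _
  nlinarith [sq_nonneg (‖c n‖ - ‖c (n + 1)‖), sq_nonneg (‖c n‖ - ‖c (n - 1)‖)]

lemma hasDerivAt_norm_sq {f : ℝ → ℂ} {f' : ℂ} {t : ℝ} (hf : HasDerivAt f f' t) :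
    HasDerivAt (fun t => ‖f t‖ ^ 2) (2 * (conj (f t) * f').re) t := by
  have h1 := hf.norm_sq
  convert h1 using 1
  rw [Complex.inner, mul_comm (conj (f t))]

variable {σ : ℝ} {s : ℝ → ℝ} {a : ℝ → EllTwo}

/-- The derivative of the density is `1 / coeff`, which cancels the coefficient of the equation and
leaves a current that is quadratic and free of `σ`. The time factor `s` accommodates the flow
truncated by `radial`. -/
lemma hasDerivAt_massDensity_norm_sq (hσ : |σ| ≤ 1)
    (hder : ∀ t n, HasDerivAt (fun r => a r n)
      (-((s t * coeff σ (‖a t n‖ ^ 2) : ℝ) : ℂ) * (a t (n + 1) - a t (n - 1))) t)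
    (t : ℝ) (n : ℤ) :
    HasDerivAt (fun r => massDensity σ (‖a r n‖ ^ 2)) (-(s t * current (a t) n)) t := by
  have h1 := (hasDerivAt_massDensity hσ (‖a t n‖ ^ 2)).comp t (hasDerivAt_norm_sq (hder t n))
  refine h1.congr_deriv ?_
  have hp := (coeff_pos hσ (‖a t n‖ ^ 2)).ne'
  rw [show conj (a t n : ℂ) * (-((s t * coeff σ (‖a t n‖ ^ 2) : ℝ) : ℂ) * (a t (n + 1) - a t (n - 1))) =
    ((-(s t * coeff σ (‖a t n‖ ^ 2)) : ℝ) : ℂ) * (conj (a t n : ℂ) * (a t (n + 1) - a t (n - 1))) by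
      push_cast; ring, re_ofReal_mul, current]
  field_simp

lemma summable_massDensity (hσ : |σ| ≤ 1) (c : EllTwo) :
    Summable fun n => massDensity σ (‖c n‖ ^ 2) :=
  ((hasSum_sq c).summable.mul_left (4 / 3)).of_nonneg_of_le
    (fun _ => massDensity_nonneg hσ (by positivity)) fun _ =>
      (massDensity_bounds hσ (by positivity)).2

lemma weighted_mass_evolution (hσ : |σ| ≤ 1) (ha : Continuous a) (hs : Continuous s)
    (hs1 : ∀ t, |s t| ≤ 1)
    (hder : ∀ t n, HasDerivAt (fun r => a r n)
      (-((s t * coeff σ (‖a t n‖ ^ 2) : ℝ) : ℂ) * (a t (n + 1) - a t (n - 1))) t)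
    {W W' : ℤ → ℝ → ℝ} {B : ℝ} (hW : ∀ n t, HasDerivAt (W n) (W' n t) t)
    (hW' : ∀ n, Continuous (W' n)) (hW1 : ∀ n t, |W n t| ≤ 1) (hWB : ∀ n t, |W' n t| ≤ B)
    {D : ℝ → ℝ} (hD : ∀ t, HasSum (fun n => W' n t * massDensity σ (‖a t n‖ ^ 2) -
      W n t * (s t * current (a t) n)) (D t)) (t₀ t : ℝ) :
    ∑' n, W n t * massDensity σ (‖a t n‖ ^ 2) - ∑' n, W n t₀ * massDensity σ (‖a t₀ n‖ ^ 2) =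
      ∫ r in t₀..t, D r := by
  have hB : 0 ≤ B := (abs_nonneg _).trans (hWB 0 0)
  have hmc : Continuous (massDensity σ) :=
    continuous_iff_continuousAt.mpr fun r => (hasDerivAt_massDensity hσ r).continuousAt
  have hac := continuous_apply ha
  have hWc : ∀ n, Continuous (W n) := fun n =>
    continuous_iff_continuousAt.mpr fun r => (hW n r).continuousAt
  refine tsum_sub_tsum_eq_integral
    (f := fun n r => W n r * massDensity σ (‖a r n‖ ^ 2))
    (b := fun n r => (4 / 3 * B + 2) * ‖a r n‖ ^ 2 + ‖a r (n + 1)‖ ^ 2 + ‖a r (n + -1)‖ ^ 2)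
    (B := fun r => (4 / 3 * B + 2) * ‖a r‖ ^ 2 + ‖a r‖ ^ 2 + ‖a r‖ ^ 2)
    (fun n r => ?_) (fun n => ?_) (fun n r => ?_) (fun r => ?_) (by fun_prop) hD (fun r => ?_) t₀ t
  · have h1 := (hW n r).mul (hasDerivAt_massDensity_norm_sq hσ hder r n)
    refine h1.congr_deriv ?_
    ring
  · unfold current
    have h1 := hac n
    have h2 := hac (n + 1)
    have h3 := hac (n - 1)
    have h4 := hW' n
    have h5 := hWc n
    have h6 : Continuous fun r => conj (a r n) := continuous_conj.comp h1
    fun_prop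
  · have h1 := (massDensity_bounds hσ (sq_nonneg ‖a r n‖)).2
    have h2 := massDensity_nonneg hσ (sq_nonneg ‖a r n‖)
    have h3 := abs_current_le (a r) n
    refine (abs_sub _ _).trans ?_
    rw [abs_mul, abs_mul, abs_mul, abs_of_nonneg h2]
    have h4 : |W' n r| * massDensity σ (‖a r n‖ ^ 2) ≤ B * (4 / 3 * ‖a r n‖ ^ 2) := by
      gcongr
      exact hWB n r
    have h5 : |W n r| * (|s r| * |current (a r) n|) ≤ 1 * (1 * |current (a r) n|) := by
      gcongr
      · exact hW1 n r
      · exact hs1 r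
    rw [← sub_eq_add_neg n 1]
    linarith
  · exact (((hasSum_sq (a r)).mul_left _).add (hasSum_sq_shift (a r) 1)).add
      (hasSum_sq_shift (a r) (-1))
  · refine (summable_massDensity hσ (a r)).of_norm_bounded fun n => ?_
    rw [norm_mul, Real.norm_eq_abs, Real.norm_eq_abs,
      abs_of_nonneg (massDensity_nonneg hσ (sq_nonneg ‖a r n‖))]
    exact mul_le_of_le_one_left (massDensity_nonneg hσ (sq_nonneg ‖a r n‖)) (hW1 n r)

lemma hasSum_of_eq {f g : ℤ → ℝ} {x : ℝ} (hg : HasSum g x) (h : ∀ n, f n = g n) : HasSum f x := by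
  rwa [funext h]

lemma hasSum_re_inner_shift (c : EllTwo) (k : ℤ) :
    HasSum (fun n => (conj (c n) * c (n + k)).re) (inner ℂ c (shift k c)).re := by
  have h1 := lp.hasSum_inner (𝕜 := ℂ) c (shift k c)
  have h2 := Complex.hasSum_re h1
  simpa [RCLike.inner_apply', mul_comm] using h2

lemma hasSum_re_succ_pred (c : EllTwo) :
    HasSum (fun n => (conj (c n) * c (n - 1)).re) (inner ℂ c (shift 1 c)).re := by
  have h1 := (Equiv.hasSum_iff (f := fun n => (conj (c n) * c (n + 1)).re)
    (Equiv.addRight (-1))).mpr (hasSum_re_inner_shift c 1)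
  refine hasSum_of_eq h1 fun n => ?_
  simp only [Function.comp_apply, Equiv.coe_addRight, ← sub_eq_add_neg,
    sub_add_cancel]
  rw [← conj_re]
  simp [mul_comm]

/-- The current is $K_n-K_{n-1}$ with $K_n=2\,\mathrm{Re}(\overline{c_n}c_{n+1})$, so its sum
telescopes. -/
lemma hasSum_current (c : EllTwo) : HasSum (current c) 0 := by
  have h1 := ((hasSum_re_inner_shift c 1).sub (hasSum_re_succ_pred c)).mul_left 2
  rw [sub_self, mul_zero] at h1
  refine hasSum_of_eq h1 fun n => ?_
  rw [current, mul_sub, sub_re]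

/-- The total mass is constant and lies between $\tfrac45\|a\|^2$ and $\tfrac43\|a\|^2$; the
constant is the ratio of these factors. -/
lemma norm_sq_le_of_flow (hσ : |σ| ≤ 1) (ha : Continuous a) (hs : Continuous s)
    (hs1 : ∀ t, |s t| ≤ 1)
    (hder : ∀ t n, HasDerivAt (fun r => a r n)
      (-((s t * coeff σ (‖a t n‖ ^ 2) : ℝ) : ℂ) * (a t (n + 1) - a t (n - 1))) t) (t : ℝ) :
    ‖a t‖ ^ 2 ≤ 5 / 3 * ‖a 0‖ ^ 2 := by
  have h1 := weighted_mass_evolution hσ ha hs hs1 hder (W := fun _ _ => 1) (W' := fun _ _ => 0)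
    (B := 0) (fun n t => hasDerivAt_const t 1) (fun n => continuous_const) (by simp) (by simp)
    (D := fun _ => 0) (fun t => by
      have := ((hasSum_current (a t)).mul_left (s t)).neg
      simpa using this) 0 t
  simp only [one_mul, intervalIntegral.integral_zero] at h1
  have h2 : 4 / 5 * ‖a t‖ ^ 2 ≤ ∑' n, massDensity σ (‖a t n‖ ^ 2) :=
    hasSum_le (fun n => (massDensity_bounds hσ (sq_nonneg _)).1) ((hasSum_sq (a t)).mul_left _)
      (summable_massDensity hσ (a t)).hasSum
  have h3 : ∑' n, massDensity σ (‖a 0 n‖ ^ 2) ≤ 4 / 3 * ‖a 0‖ ^ 2 :=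
    hasSum_le (fun n => (massDensity_bounds hσ (sq_nonneg _)).2)
      (summable_massDensity hσ (a 0)).hasSum ((hasSum_sq (a 0)).mul_left _)
  linarith

end

/-! ### Global well-posedness in `ℓ²` -/

/-- The radial retraction onto the unit ball. -/
def radial (c : EllTwo) : EllTwo := (((max 1 ‖c‖)⁻¹ : ℝ) : ℂ) • c

lemma radial_apply (c : EllTwo) (n : ℤ) : radial c n = (((max 1 ‖c‖)⁻¹ : ℝ) : ℂ) * c n := rfl

lemma norm_radial_le (c : EllTwo) : ‖radial c‖ ≤ 1 := by
  have h : 0 < max 1 ‖c‖ := lt_of_lt_of_le one_pos (le_max_left _ _)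
  rw [radial, norm_smul, Complex.norm_real, Real.norm_of_nonneg (by positivity), inv_mul_le_iff₀ h,
    mul_one]
  exact le_max_right _ _

lemma norm_radial_sub_le (c d : EllTwo) : ‖radial c - radial d‖ ≤ 2 * ‖c - d‖ := by
  set p := max 1 ‖c‖
  set q := max 1 ‖d‖
  have hp1 : 1 ≤ p := le_max_left _ _
  have hq1 : 1 ≤ q := le_max_left _ _
  have hp : 0 < p := one_pos.trans_le hp1
  have hq : 0 < q := one_pos.trans_le hq1
  have h1 : radial c - radial d = ((p⁻¹ : ℝ) : ℂ) • (c - d) + ((p⁻¹ - q⁻¹ : ℝ) : ℂ) • d := by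
    rw [radial, radial, smul_sub, ofReal_sub, sub_smul]; abel
  have h2 : ‖((p⁻¹ : ℝ) : ℂ) • (c - d)‖ ≤ ‖c - d‖ := by
    rw [norm_smul, Complex.norm_real, Real.norm_of_nonneg (by positivity)]
    exact mul_le_of_le_one_left (norm_nonneg _) (inv_le_one_of_one_le₀ hp1)
  have h3 : ‖((p⁻¹ - q⁻¹ : ℝ) : ℂ) • d‖ ≤ ‖c - d‖ := by
    rw [norm_smul, Complex.norm_real, Real.norm_eq_abs, inv_sub_inv hp.ne' hq.ne', abs_div,
      abs_of_pos (mul_pos hp hq), div_mul_eq_mul_div, div_le_iff₀ (mul_pos hp hq)]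
    have h4 : |q - p| ≤ ‖c - d‖ := by
      have h5 := abs_max_sub_max_le_abs ‖d‖ ‖c‖ 1
      rw [max_comm ‖d‖, max_comm ‖c‖] at h5
      refine h5.trans ((abs_norm_sub_norm_le d c).trans (le_of_eq (norm_sub_rev d c)))
    have h5 : ‖d‖ ≤ p * q := (le_max_right 1 ‖d‖).trans (le_mul_of_one_le_left hq.le hp1)
    gcongr
  rw [h1, two_mul]
  exact (norm_add_le _ _).trans (add_le_add h2 h3)

/-- The vector field of the system, made globally Lipschitz. -/
def truncField (σ : ℝ) (c : EllTwo) : EllTwo :=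
  -mulSeq (fun n => (coeff σ (‖c n‖ ^ 2) : ℂ)) (symmetricDiff (radial c))

lemma norm_coeff_le {σ : ℝ} (hσ : |σ| ≤ 1) (s : ℝ) : ‖(coeff σ s : ℂ)‖ ≤ 5 / 4 := by
  rw [Complex.norm_real, Real.norm_of_nonneg (coeff_pos hσ s).le]
  exact (coeff_bounds hσ s).2

lemma truncField_apply {σ : ℝ} (hσ : |σ| ≤ 1) (c : EllTwo) (n : ℤ) :
    truncField σ c n = -(coeff σ (‖c n‖ ^ 2) * symmetricDiff (radial c) n) := by
  rw [truncField, lp.coeFn_neg, Pi.neg_apply, mulSeq_apply (fun n => norm_coeff_le hσ _)]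

lemma norm_truncField_le {σ : ℝ} (hσ : |σ| ≤ 1) (c : EllTwo) : ‖truncField σ c‖ ≤ 5 / 2 := by
  have h1 : ‖truncField σ c‖ ≤ 5 / 4 * ‖symmetricDiff (radial c)‖ := by
    refine norm_le_of_norm_apply_le_mul (by norm_num) fun n => ?_
    rw [truncField_apply hσ, norm_neg, norm_mul]
    gcongr
    exact norm_coeff_le hσ _
  linarith [norm_symmetricDiff_le (radial c), norm_radial_le c]

/-- Freezing at `1 / 4` makes the coefficient a function of $\min(x,1/2)^2$, which is Lipschitz with
constant $1$ even for large `x`. -/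
lemma abs_coeff_sub_le {σ : ℝ} (hσ : |σ| ≤ 1) {x y : ℝ} (hx : 0 ≤ x) (hy : 0 ≤ y) :
    |coeff σ (x ^ 2) - coeff σ (y ^ 2)| ≤ |x - y| := by
  have hm : ∀ z : ℝ, 0 ≤ z → min (max (z ^ 2) 0) (1 / 4) = (min z (1 / 2)) ^ 2 := by
    intro z hz
    rw [max_eq_left (by positivity)]
    rcases le_total z (1 / 2) with h | h
    · rw [min_eq_left h, min_eq_left]; nlinarith
    · rw [min_eq_right h, min_eq_right]
      · norm_num
      · nlinarith
  have h1 : coeff σ (x ^ 2) - coeff σ (y ^ 2) =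
      -(σ * ((min x (1 / 2) + min y (1 / 2)) * (min x (1 / 2) - min y (1 / 2)))) := by
    rw [coeff, coeff, hm x hx, hm y hy]; ring
  have h2 : |min x (1 / 2) - min y (1 / 2)| ≤ |x - y| := by
    refine (abs_min_sub_min_le_max x (1 / 2) y (1 / 2)).trans ?_
    simp
  have h3 : |min x (1 / 2) + min y (1 / 2)| ≤ 1 := by
    rw [abs_of_nonneg (add_nonneg (le_min hx (by norm_num)) (le_min hy (by norm_num)))]
    linarith [min_le_right x (1 / 2), min_le_right y (1 / 2)]
  rw [h1, abs_neg, abs_mul, abs_mul]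
  calc _ ≤ 1 * (1 * |x - y|) := by gcongr
    _ = _ := by ring

/-- The retraction bounds the difference term by $2$ at every site, so a change of coefficient costs
at most $2\|c-d\|$. The constant is $\tfrac54\cdot2\cdot2+2$, with one $2$ from `symmetricDiff` and
one from `radial`. -/
lemma lipschitzWith_truncField {σ : ℝ} (hσ : |σ| ≤ 1) : LipschitzWith 7 (truncField σ) := by
  refine LipschitzWith.of_dist_le_mul fun c d => ?_
  rw [dist_eq_norm, dist_eq_norm]
  have h1 : ‖truncField σ c - truncField σ d‖ ≤
      5 / 4 * ‖symmetricDiff (radial c - radial d)‖ + 2 * ‖c - d‖ := by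
    refine norm_le_add_of_norm_apply_le (by norm_num) (by norm_num) fun n => ?_
    rw [lp.coeFn_sub, Pi.sub_apply, truncField_apply hσ, truncField_apply hσ, map_sub, lp.coeFn_sub,
      Pi.sub_apply, lp.coeFn_sub, Pi.sub_apply]
    set u := symmetricDiff (radial c) n
    set v := symmetricDiff (radial d) n
    have hv : ‖v‖ ≤ 2 := (norm_apply_le _ _).trans
      (by linarith [norm_symmetricDiff_le (radial d), norm_radial_le d])
    have h2 : -((coeff σ (‖c n‖ ^ 2) : ℂ) * u) - -((coeff σ (‖d n‖ ^ 2) : ℂ) * v) =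
        -(coeff σ (‖c n‖ ^ 2) * (u - v)) -
          ((coeff σ (‖c n‖ ^ 2) - coeff σ (‖d n‖ ^ 2) : ℝ) : ℂ) * v := by
      push_cast; ring
    rw [h2]
    refine (norm_sub_le _ _).trans ?_
    rw [norm_neg, norm_mul, norm_mul]
    have h3 : ‖((coeff σ (‖c n‖ ^ 2) - coeff σ (‖d n‖ ^ 2) : ℝ) : ℂ)‖ ≤ ‖c n - d n‖ := by
      rw [Complex.norm_real, Real.norm_eq_abs]
      exact (abs_coeff_sub_le hσ (norm_nonneg _) (norm_nonneg _)).trans (abs_norm_sub_norm_le _ _)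
    have h4 := norm_coeff_le hσ (‖c n‖ ^ 2)
    rw [mul_comm 2 ‖c n - d n‖]
    gcongr
  have h2 := norm_symmetricDiff_le (radial c - radial d)
  have h3 := norm_radial_sub_le c d
  simp only [NNReal.coe_ofNat]
  linarith

lemma abs_sign_le {σ : ℝ} (hσ : σ = 1 ∨ σ = -1) : |σ| ≤ 1 := by
  rcases hσ with rfl | rfl <;> simp

lemma one_sub_mul_conj (σ : ℝ) (z : ℂ) :
    1 - z * ((σ : ℂ) * conj z) = ((1 - σ * ‖z‖ ^ 2 : ℝ) : ℂ) := by
  push_cast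
  rw [← Complex.mul_conj']
  ring

lemma mALField_eq_coeff (σ : ℝ) (c : ℤ → ℂ) (n : ℤ) (hc : ‖c n‖ ^ 2 ≤ 1 / 4) :
    mALField σ c n = -(coeff σ (‖c n‖ ^ 2) : ℂ) * (c (n + 1) - c (n - 1)) := by
  rw [mALField, one_sub_mul_conj, coeff_eq (by positivity) hc]

/-- Solutions of the modified Ablowitz--Ladik system exist globally for small data. -/
lemma exists_solution {σ : ℝ} (hσ : |σ| ≤ 1) (c : EllTwo) (hc : ‖c‖ ^ 2 ≤ 1 / 10) :
    ∃ a : ℝ → EllTwo, Continuous a ∧ a 0 = c ∧ (∀ t, ‖a t‖ ^ 2 ≤ 5 / 3 * ‖c‖ ^ 2) ∧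
      ∀ t n, HasDerivAt (fun r => a r n) (mALField σ (a t) n) t := by
  obtain ⟨a, h0, hder⟩ := exists_global_solution (K := 7) (L := 5 / 2) (lipschitzWith_truncField hσ)
    (fun x => by simpa using norm_truncField_le hσ x) c
  have ha : Continuous a := continuous_iff_continuousAt.mpr fun t => (hder t).continuousAt
  have hder' : ∀ t n, HasDerivAt (fun r => a r n)
      (-(((max 1 ‖a t‖)⁻¹ * coeff σ (‖a t n‖ ^ 2) : ℝ) : ℂ) * (a t (n + 1) - a t (n - 1))) t := by
    intro t n
    have h1 : HasDerivAt (fun s => a s n) (truncField σ (a t) n) t :=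
      ((lp.evalCLM ℂ (fun _ : ℤ => ℂ) 2 n).restrictScalars ℝ).hasFDerivAt.comp_hasDerivAt t (hder t)
    refine h1.congr_deriv ?_
    rw [truncField_apply hσ, symmetricDiff_apply, radial_apply, radial_apply]
    push_cast
    ring
  have hb : ∀ t, ‖a t‖ ^ 2 ≤ 5 / 3 * ‖c‖ ^ 2 := by
    intro t
    rw [← h0]
    -- Along the truncated flow the retraction acts only as a scalar factor `s t` in $(0,1]$ on the
    -- current, so the mass law still holds.
    have hpos : ∀ t, 0 < max 1 ‖a t‖ := fun t => lt_of_lt_of_le one_pos (le_max_left _ _)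
    refine norm_sq_le_of_flow hσ ha (s := fun t => (max 1 ‖a t‖)⁻¹)
      ((continuous_const.max ha.norm).inv₀ fun t => (hpos t).ne') (fun t => ?_) hder' t
    rw [abs_of_nonneg (inv_nonneg.mpr (hpos t).le)]
    exact inv_le_one_of_one_le₀ (le_max_left _ _)
  refine ⟨a, ha, h0, hb, fun t n => ?_⟩
  -- Since $\tfrac53\cdot\tfrac1{10}<\tfrac14$, neither the retraction nor the freezing is ever
  -- active, and the truncated equation is the original one.
  have h1 : ‖a t‖ ^ 2 ≤ 1 / 4 := (hb t).trans (by linarith)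
  have h2 : ‖a t n‖ ^ 2 ≤ 1 / 4 :=
    (pow_le_pow_left₀ (norm_nonneg _) (norm_apply_le (a t) n) 2).trans h1
  have h3 : max 1 ‖a t‖ = 1 := max_eq_left (by nlinarith [norm_nonneg (a t)])
  refine (hder' t n).congr_deriv ?_
  rw [h3, mALField_eq_coeff σ _ n h2, inv_one, one_mul]

/-- The vector field of the system as a map of `ℓ²`. -/
def fieldSeq (σ : ℝ) (c : EllTwo) : EllTwo :=
  -mulSeq (fun n => 1 - c n * ((σ : ℂ) * conj (c n))) (symmetricDiff c)

lemma norm_one_sub_mul_conj_le {σ : ℝ} (hσ : |σ| ≤ 1) {z : ℂ} {R : ℝ} (hz : ‖z‖ ≤ R) :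
    ‖1 - z * ((σ : ℂ) * conj z)‖ ≤ 1 + R ^ 2 := by
  refine (norm_sub_le _ _).trans ?_
  rw [norm_one, norm_mul, norm_mul, norm_conj, Complex.norm_real, Real.norm_eq_abs]
  have : ‖z‖ ^ 2 ≤ R ^ 2 := pow_le_pow_left₀ (norm_nonneg _) hz 2
  nlinarith [norm_nonneg z, abs_nonneg σ, mul_le_mul_of_nonneg_right hσ (sq_nonneg ‖z‖)]

lemma fieldSeq_apply {σ : ℝ} (hσ : |σ| ≤ 1) (c : EllTwo) (n : ℤ) :
    fieldSeq σ c n = mALField σ c n := by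
  rw [fieldSeq, lp.coeFn_neg, Pi.neg_apply,
    mulSeq_apply (fun n => norm_one_sub_mul_conj_le hσ (norm_apply_le c n)), mALField,
    symmetricDiff_apply, neg_mul]

lemma lipschitzOnWith_fieldSeq {σ : ℝ} (hσ : |σ| ≤ 1) (R : NNReal) :
    LipschitzOnWith (2 * (1 + R ^ 2) + 4 * R ^ 2) (fieldSeq σ) (Metric.closedBall 0 R) := by
  refine LipschitzOnWith.of_dist_le_mul fun c hc d hd => ?_
  rw [mem_closedBall_zero_iff] at hc hd
  rw [dist_eq_norm, dist_eq_norm]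
  have h1 : ‖fieldSeq σ c - fieldSeq σ d‖ ≤
      (1 + R ^ 2) * ‖symmetricDiff (c - d)‖ + 4 * R ^ 2 * ‖c - d‖ := by
    refine norm_le_add_of_norm_apply_le (by positivity) (by positivity) fun n => ?_
    rw [lp.coeFn_sub, Pi.sub_apply, fieldSeq_apply hσ, fieldSeq_apply hσ, mALField, mALField,
      ← symmetricDiff_apply, ← symmetricDiff_apply, map_sub, lp.coeFn_sub,
      Pi.sub_apply, lp.coeFn_sub, Pi.sub_apply]
    set u := symmetricDiff c n
    set v := symmetricDiff d n
    have hv : ‖v‖ ≤ 2 * R := (norm_apply_le _ _).trans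
      (by linarith [norm_symmetricDiff_le d])
    have hcn := (norm_apply_le c n).trans hc
    have hdn := (norm_apply_le d n).trans hd
    have h2 : -(1 - c n * ((σ : ℂ) * conj (c n))) * u - -(1 - d n * ((σ : ℂ) * conj (d n))) * v =
        -((1 - c n * ((σ : ℂ) * conj (c n))) * (u - v)) +
          (σ : ℂ) * (c n * conj (c n - d n) + (c n - d n) * conj (d n)) * v := by
      rw [map_sub]; ring
    rw [h2]
    refine (norm_add_le _ _).trans (add_le_add ?_ ?_)
    · rw [norm_neg, norm_mul]
      gcongr
      exact norm_one_sub_mul_conj_le hσ hcn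
    · have h3 : ‖c n * conj (c n - d n) + (c n - d n) * conj (d n)‖ ≤ 2 * R * ‖c n - d n‖ := by
        refine (norm_add_le _ _).trans ?_
        rw [norm_mul, norm_mul, norm_conj, norm_conj]
        nlinarith [norm_nonneg (c n - d n)]
      rw [norm_mul, norm_mul, Complex.norm_real, Real.norm_eq_abs]
      calc _ ≤ 1 * (2 * R * ‖c n - d n‖) * (2 * R) := by gcongr
        _ = _ := by ring
  have h2 := norm_symmetricDiff_le (c - d)
  push_cast
  have h3 : (1 + (R : ℝ) ^ 2) * ‖symmetricDiff (c - d)‖ ≤ (1 + (R : ℝ) ^ 2) * (2 * ‖c - d‖) := by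
    gcongr
  linarith

lemma continuous_fieldSeq {σ : ℝ} (hσ : |σ| ≤ 1) : Continuous (fieldSeq σ) := by
  refine continuous_iff_continuousAt.mpr fun c => ?_
  refine (lipschitzOnWith_fieldSeq hσ (‖c‖₊ + 1)).continuousOn.continuousAt ?_
  refine Filter.mem_of_superset (Metric.ball_mem_nhds c one_pos) fun d hd => ?_
  rw [mem_closedBall_zero_iff]
  rw [Metric.mem_ball, dist_eq_norm] at hd
  have := norm_le_norm_add_norm_sub c d
  rw [norm_sub_rev] at this
  push_cast
  linarith

lemma hasDerivAt_fieldSeq {σ : ℝ} (hσ : |σ| ≤ 1) {a : ℝ → EllTwo} (ha : Continuous a)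
    (hder : ∀ t n, HasDerivAt (fun r => a r n) (mALField σ (a t) n) t) (t : ℝ) :
    HasDerivAt a (fieldSeq σ (a t)) t :=
  hasDerivAt_of_forall_apply ((continuous_fieldSeq hσ).comp ha)
    (fun t n => (hder t n).congr_deriv (fieldSeq_apply hσ (a t) n).symm) t

/-- No smallness is assumed: on a compact time interval both continuous curves stay in some ball,
where `fieldSeq` is Lipschitz. -/
lemma solution_unique {σ : ℝ} (hσ : |σ| ≤ 1) {a b : ℝ → EllTwo} (ha : Continuous a)
    (hda : ∀ t n, HasDerivAt (fun r => a r n) (mALField σ (a t) n) t) (hb : Continuous b)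
    (hdb : ∀ t n, HasDerivAt (fun r => b r n) (mALField σ (b t) n) t) (h0 : a 0 = b 0) :
    a = b := by
  ext1 t
  set r : ℝ := |t| + 1
  have hr : 0 < r := by positivity
  obtain ⟨A, hA⟩ := isCompact_Icc.exists_bound_of_continuousOn (s := Set.Icc (-r) r) ha.continuousOn
  obtain ⟨B, hB⟩ := isCompact_Icc.exists_bound_of_continuousOn (s := Set.Icc (-r) r) hb.continuousOn
  set R : NNReal := Real.toNNReal (max A B)
  have hmem : ∀ {c : EllTwo}, ‖c‖ ≤ max A B → c ∈ Metric.closedBall (0 : EllTwo) R := fun hc => by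
    rw [mem_closedBall_zero_iff]
    exact hc.trans (Real.le_coe_toNNReal _)
  refine ODE_solution_unique_of_mem_Ioo (v := fun _ => fieldSeq σ)
    (s := fun _ => Metric.closedBall 0 R) (a := -r) (b := r) (t₀ := 0)
    (fun _ _ => lipschitzOnWith_fieldSeq hσ R) ⟨by linarith, hr⟩
    (fun s hs => ⟨hasDerivAt_fieldSeq hσ ha hda s,
      hmem ((hA s (Set.Ioo_subset_Icc_self hs)).trans (le_max_left _ _))⟩)
    (fun s hs => ⟨hasDerivAt_fieldSeq hσ hb hdb s,
      hmem ((hB s (Set.Ioo_subset_Icc_self hs)).trans (le_max_right _ _))⟩) h0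
    (abs_lt.mp (lt_add_one |t|))

section

/-! ### Conservation laws of small solutions -/

/-- A global solution that stays in the ball of radius `1 / 2`. -/
structure IsSmallSolution (σ : ℝ) (a : ℝ → EllTwo) : Prop where
  continuous : Continuous a
  hasDerivAt : ∀ t n, HasDerivAt (fun r => a r n) (mALField σ (a t) n) t
  norm_sq_le : ∀ t, ‖a t‖ ^ 2 ≤ 1 / 4

variable {σ : ℝ} {a : ℝ → EllTwo}

lemma IsSmallSolution.norm_apply_sq_le (ha : IsSmallSolution σ a) (t : ℝ) (n : ℤ) :
    ‖a t n‖ ^ 2 ≤ 1 / 4 :=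
  (pow_le_pow_left₀ (norm_nonneg _) (norm_apply_le (a t) n) 2).trans (ha.norm_sq_le t)

lemma IsSmallSolution.hasDerivAt_coeff (ha : IsSmallSolution σ a) (t : ℝ) (n : ℤ) :
    HasDerivAt (fun r => a r n)
      (-(coeff σ (‖a t n‖ ^ 2) : ℂ) * (a t (n + 1) - a t (n - 1))) t :=
  (ha.hasDerivAt t n).congr_deriv (mALField_eq_coeff σ _ n (ha.norm_apply_sq_le t n))

lemma IsSmallSolution.weighted_mass_evolution (hσ : |σ| ≤ 1) (ha : IsSmallSolution σ a)
    {W W' : ℤ → ℝ → ℝ} {B : ℝ} (hW : ∀ n t, HasDerivAt (W n) (W' n t) t)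
    (hW' : ∀ n, Continuous (W' n)) (hW1 : ∀ n t, |W n t| ≤ 1) (hWB : ∀ n t, |W' n t| ≤ B)
    {D : ℝ → ℝ} (hD : ∀ t, HasSum (fun n => W' n t * massDensity σ (‖a t n‖ ^ 2) -
      W n t * current (a t) n) (D t)) (t₀ t : ℝ) :
    ∑' n, W n t * massDensity σ (‖a t n‖ ^ 2) - ∑' n, W n t₀ * massDensity σ (‖a t₀ n‖ ^ 2) =
      ∫ r in t₀..t, D r :=
  AblowitzLadik.weighted_mass_evolution hσ ha.continuous (s := fun _ => 1) continuous_const (by simp)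
    (fun t n => by simpa using ha.hasDerivAt_coeff t n) hW hW' hW1 hWB
    (fun t => by simpa using hD t) t₀ t

lemma IsSmallSolution.mass_conserved (hσ : |σ| ≤ 1) (ha : IsSmallSolution σ a) (t₀ t : ℝ) :
    ∑' n, massDensity σ (‖a t n‖ ^ 2) = ∑' n, massDensity σ (‖a t₀ n‖ ^ 2) := by
  have h1 := ha.weighted_mass_evolution hσ (W := fun _ _ => 1) (W' := fun _ _ => 0)
    (B := 0) (fun n t => hasDerivAt_const t 1) (fun n => continuous_const) (by simp) (by simp)
    (D := fun _ => 0) (fun t => by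
      have := (hasSum_current (a t)).neg
      simpa using this) t₀ t
  simp only [one_mul, intervalIntegral.integral_zero] at h1
  linarith

lemma hasDerivAt_re_conj_mul {f g : ℝ → ℂ} {f' g' : ℂ} {t : ℝ} (hf : HasDerivAt f f' t)
    (hg : HasDerivAt g g' t) :
    HasDerivAt (fun t => (conj (f t) * g t).re) ((conj f' * g t).re + (conj (f t) * g').re) t := by
  have h1 := (hf.star.mul hg)
  have h2 := Complex.reCLM.hasFDerivAt.comp_hasDerivAt t h1
  refine h2.congr_deriv ?_
  simp

lemma summable_norm_mul (c d : EllTwo) :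
    Summable (fun n => ‖c n‖ * ‖d n‖) ∧ ∑' n, ‖c n‖ * ‖d n‖ ≤ ‖c‖ * ‖d‖ := by
  have h1 := Complex.hasSum_re (lp.hasSum_inner (𝕜 := ℂ) (absSeq c) (absSeq d))
  have h2 : HasSum (fun n => ‖c n‖ * ‖d n‖) (inner ℂ (absSeq c) (absSeq d)).re := by
    refine hasSum_of_eq h1 fun n => ?_
    simp [absSeq_apply, mul_comm]
  refine ⟨h2.summable, h2.tsum_eq.trans_le ?_⟩
  refine (re_le_norm _).trans ((norm_inner_le_norm _ _).trans ?_)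
  rw [norm_absSeq, norm_absSeq]

lemma hasSum_shift {f : ℤ → ℝ} {x : ℝ} (hf : HasSum f x) (k : ℤ) :
    HasSum (fun n => f (n + k)) x :=
  (Equiv.hasSum_iff (f := f) (Equiv.addRight k)).mpr hf

/-- A discrete Gagliardo–Nirenberg inequality: $|c_n|^2$ is the telescoping sum of
$|c_k|^2-|c_{k+1}|^2\le|Dc_k|(|c_k|+|c_{k+1}|)$ over $k\ge n$, because $c_k\to0$; Cauchy–Schwarz
bounds the sum. -/
lemma sq_apply_le (c : EllTwo) (n : ℤ) : ‖c n‖ ^ 2 ≤ 2 * ‖c‖ * ‖forwardDiff c‖ := by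
  set g : ℤ → ℝ := fun k => ‖forwardDiff c k‖ * ‖c k‖ + ‖forwardDiff c k‖ * ‖shift 1 c k‖
  have hg0 : ∀ k, 0 ≤ g k := fun k => by positivity
  obtain ⟨s1, b1⟩ := summable_norm_mul (forwardDiff c) c
  obtain ⟨s2, b2⟩ := summable_norm_mul (forwardDiff c) (shift 1 c)
  rw [LinearIsometry.norm_map] at b2
  have hgs : Summable g := s1.add s2
  have hgb : ∑' k, g k ≤ 2 * ‖c‖ * ‖forwardDiff c‖ := by
    rw [s1.tsum_add s2]; linarith
  have hstep : ∀ k, ‖c k‖ ^ 2 - ‖c (k + 1)‖ ^ 2 ≤ g k := by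
    intro k
    have h1 := abs_norm_sub_norm_le (c (k + 1)) (c k)
    have h2 : ‖c k‖ - ‖c (k + 1)‖ ≤ ‖forwardDiff c k‖ := by
      rw [forwardDiff_apply]; linarith [neg_abs_le (‖c (k + 1)‖ - ‖c k‖)]
    have h3 : ‖shift 1 c k‖ = ‖c (k + 1)‖ := by rw [shift_apply]
    simp only [g, h3]
    nlinarith [norm_nonneg (c k), norm_nonneg (c (k + 1))]
  have htel : ∀ N : ℕ, ‖c n‖ ^ 2 - ‖c (n + N)‖ ^ 2 ≤ ∑ k ∈ Finset.range N, g (n + k) := by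
    intro N
    induction N with
    | zero => simp
    | succ N ih =>
      rw [Finset.sum_range_succ]
      have := hstep (n + N)
      push_cast
      rw [← add_assoc]
      linarith
  have hinj : Function.Injective fun k : ℕ => n + (k : ℤ) := fun i j hij => by simpa using hij
  have hfin : ∀ N : ℕ, ‖c n‖ ^ 2 ≤ 2 * ‖c‖ * ‖forwardDiff c‖ + ‖c (n + N)‖ ^ 2 := by
    intro N
    have h1 : ∑ k ∈ Finset.range N, g (n + k) ≤ ∑' k : ℕ, g (n + k) :=
      (hgs.comp_injective hinj).sum_le_tsum _ fun k _ => hg0 _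
    have h2 : ∑' k : ℕ, g (n + k) ≤ ∑' k, g k :=
      tsum_comp_le_tsum_of_inj hgs hg0 hinj
    linarith [htel N]
  have hlim : Filter.Tendsto (fun N : ℕ => 2 * ‖c‖ * ‖forwardDiff c‖ + ‖c (n + N)‖ ^ 2)
      Filter.atTop (nhds (2 * ‖c‖ * ‖forwardDiff c‖ + 0)) :=
    tendsto_const_nhds.add
      (((hasSum_sq c).summable.comp_injective hinj).tendsto_atTop_zero)
  rw [add_zero] at hlim
  exact ge_of_tendsto' hlim hfin

lemma tsum_pow_four_le (c : EllTwo) :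
    Summable (fun n => (‖c n‖ ^ 2) ^ 2) ∧
      ∑' n, (‖c n‖ ^ 2) ^ 2 ≤ 2 * ‖c‖ ^ 3 * ‖forwardDiff c‖ := by
  have h1 : ∀ n, (‖c n‖ ^ 2) ^ 2 ≤ 2 * ‖c‖ * ‖forwardDiff c‖ * ‖c n‖ ^ 2 := fun n => by
    rw [sq (‖c n‖ ^ 2)]
    exact mul_le_mul_of_nonneg_right (sq_apply_le c n) (by positivity)
  have h2 := (hasSum_sq c).mul_left (2 * ‖c‖ * ‖forwardDiff c‖)
  have hs : Summable (fun n => (‖c n‖ ^ 2) ^ 2) :=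
    h2.summable.of_nonneg_of_le (fun n => by positivity) h1
  refine ⟨hs, (hasSum_le h1 hs.hasSum h2).trans (le_of_eq (by ring))⟩

lemma abs_tsum_massDensity_sub_le (hσ : |σ| ≤ 1) (c : EllTwo) :
    |∑' n, massDensity σ (‖c n‖ ^ 2) - ‖c‖ ^ 2| ≤ 8 / 3 * ‖c‖ ^ 3 * ‖forwardDiff c‖ := by
  obtain ⟨hs, hb⟩ := tsum_pow_four_le c
  rw [← (hasSum_sq c).tsum_eq, ← (summable_massDensity hσ c).tsum_sub (hasSum_sq c).summable,
    ← Real.norm_eq_abs]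
  refine (tsum_of_norm_bounded (hs.mul_left (4 / 3)).hasSum fun n =>
    abs_massDensity_sub_le hσ (sq_nonneg _)).trans ?_
  rw [tsum_mul_left]
  linarith

lemma norm_forwardDiff_sq (c : EllTwo) :
    ‖forwardDiff c‖ ^ 2 = 2 * ‖c‖ ^ 2 - 2 * (inner ℂ c (shift 1 c)).re := by
  change ‖shift 1 c - c‖ ^ 2 = _
  rw [@norm_sub_sq ℂ, LinearIsometry.norm_map, ← inner_conj_symm, RCLike.conj_re, RCLike.re_eq_complex_re]
  ring

lemma norm_coeff_mul_le (hσ : |σ| ≤ 1) (s : ℝ) (x y z : ℂ) :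
    |(-(coeff σ s) * (conj (x - y) * z).re)| ≤ 2 * ((‖x‖ + ‖y‖) * ‖z‖) := by
  rw [abs_mul, abs_neg, abs_of_pos (coeff_pos hσ s)]
  have h1 : |(conj (x - y) * z).re| ≤ (‖x‖ + ‖y‖) * ‖z‖ := by
    refine (abs_re_le_norm _).trans ?_
    rw [norm_mul, norm_conj]
    gcongr
    exact norm_sub_le _ _
  have h2 : coeff σ s ≤ 2 := (coeff_bounds hσ s).2.trans (by norm_num)
  gcongr

/-- The derivative of $\mathrm{Re}(\overline{a_n}a_{n+1})$ is $p_n+q_{n+1}$. After reindexing, the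
sum is that of $p_n+q_n=-(1-\sigma|a_n|^2)(|a_{n+1}|^2-|a_{n-1}|^2)$, whose quadratic and quartic
parts both telescope. -/
lemma IsSmallSolution.energy_conserved (hσ : |σ| ≤ 1) (ha : IsSmallSolution σ a) (t₀ t : ℝ) :
    (inner ℂ (a t) (shift 1 (a t))).re = (inner ℂ (a t₀) (shift 1 (a t₀))).re := by
  set p : ℝ → ℤ → ℝ := fun r n =>
    -(coeff σ (‖a r n‖ ^ 2)) * (conj (a r (n + 1) - a r (n - 1)) * a r (n + 1)).re with hp
  set q : ℝ → ℤ → ℝ := fun r n =>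
    -(coeff σ (‖a r n‖ ^ 2)) * (conj (a r (n + 1) - a r (n - 1)) * a r (n - 1)).re with hq
  have hpb : ∀ r n, |p r n| ≤ 3 * ‖a r (n + 1)‖ ^ 2 + ‖a r (n - 1)‖ ^ 2 := fun r n => by
    refine (norm_coeff_mul_le hσ _ _ _ _).trans ?_
    nlinarith [sq_nonneg (‖a r (n + 1)‖ - ‖a r (n - 1)‖)]
  have hqb : ∀ r n, |q r n| ≤ 3 * ‖a r (n - 1)‖ ^ 2 + ‖a r (n + 1)‖ ^ 2 := fun r n => by
    refine (norm_coeff_mul_le hσ _ _ _ _).trans ?_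
    nlinarith [sq_nonneg (‖a r (n + 1)‖ - ‖a r (n - 1)‖)]
  have hS1 : ∀ r, HasSum (fun n => ‖a r (n + 1)‖ ^ 2) (‖a r‖ ^ 2) := fun r => hasSum_sq_shift _ _
  have hS2 : ∀ r, HasSum (fun n => ‖a r (n - 1)‖ ^ 2) (‖a r‖ ^ 2) := fun r => hasSum_sq_shift _ (-1)
  have hps : ∀ r, Summable (p r) := fun r =>
    (((hS1 r).summable.mul_left 3).add (hS2 r).summable).of_norm_bounded (hpb r)
  have hqs : ∀ r, Summable (q r) := fun r =>
    (((hS2 r).summable.mul_left 3).add (hS1 r).summable).of_norm_bounded (hqb r)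
  have hpq : ∀ r, HasSum (fun n => p r n + q r n) 0 := by
    intro r
    have h1 : Summable fun n => ‖a r n‖ ^ 2 * ‖a r (n + 1)‖ ^ 2 := by
      refine ((hS1 r).summable.mul_left (1 / 4)).of_nonneg_of_le (fun n => by positivity)
        fun n => ?_
      exact mul_le_mul_of_nonneg_right (ha.norm_apply_sq_le r n) (by positivity)
    have h2 := ((h1.hasSum.sub (hasSum_shift h1.hasSum (-1))).mul_left σ).sub ((hS1 r).sub (hS2 r))
    rw [sub_self, sub_self, mul_zero, sub_zero] at h2
    refine hasSum_of_eq h2 fun n => ?_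
    have h3 : (conj (a r (n + 1) - a r (n - 1)) * a r (n + 1)).re +
        (conj (a r (n + 1) - a r (n - 1)) * a r (n - 1)).re =
        ‖a r (n + 1)‖ ^ 2 - ‖a r (n - 1)‖ ^ 2 := by
      rw [← normSq_eq_norm_sq, ← normSq_eq_norm_sq, normSq_apply, normSq_apply]
      simp only [mul_re, conj_re, conj_im, sub_re, sub_im]
      ring
    simp only [hp, hq]
    rw [← mul_add, h3, coeff_eq (by positivity) (ha.norm_apply_sq_le r n), neg_add_cancel_right,
      ← sub_eq_add_neg]
    ring
  have hac := continuous_apply ha.continuous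
  have hcc : ∀ n, Continuous fun r => coeff σ (‖a r n‖ ^ 2) := fun n =>
    (continuous_coeff σ).comp ((hac n).norm.pow 2)
  have hcj : ∀ n, Continuous fun r => conj (a r (n + 1) - a r (n - 1) : ℂ) := fun n =>
    continuous_conj.comp ((hac _).sub (hac _))
  have hpc : ∀ n, Continuous fun r => p r n := fun n =>
    (hcc n).neg.mul (continuous_re.comp ((hcj n).mul (hac _)))
  have hqc : ∀ n, Continuous fun r => q r n := fun n =>
    (hcc n).neg.mul (continuous_re.comp ((hcj n).mul (hac _)))
  have h1 := tsum_sub_tsum_eq_integral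
    (f := fun n r => (conj (a r n : ℂ) * a r (n + 1)).re)
    (d := fun n r => p r n + q r (n + 1)) (D := fun _ => 0)
    (b := fun n r => (3 * ‖a r (n + 1)‖ ^ 2 + ‖a r (n - 1)‖ ^ 2) +
      (3 * ‖a r n‖ ^ 2 + ‖a r (n + 2)‖ ^ 2))
    (B := fun r => (3 * ‖a r‖ ^ 2 + ‖a r‖ ^ 2) + (3 * ‖a r‖ ^ 2 + ‖a r‖ ^ 2))
    (fun n r => ?_) (fun n => (hpc n).add (hqc (n + 1))) (fun n r => ?_) (fun r => ?_) ?_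
    (fun r => ?_) (fun r => (hasSum_re_inner_shift (a r) 1).summable) t₀ t
  · rw [(hasSum_re_inner_shift (a t) 1).tsum_eq, (hasSum_re_inner_shift (a t₀) 1).tsum_eq,
      intervalIntegral.integral_zero] at h1
    linarith
  · refine (hasDerivAt_re_conj_mul (ha.hasDerivAt_coeff r n)
      (ha.hasDerivAt_coeff r (n + 1))).congr_deriv ?_
    simp only [hp, hq, add_sub_cancel_right, mul_re, mul_im, conj_re, conj_im, sub_re, sub_im,
      neg_re, neg_im, ofReal_re, ofReal_im]
    ring
  · refine (abs_add_le _ _).trans (add_le_add (hpb r n) ((hqb r (n + 1)).trans (le_of_eq ?_)))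
    rw [add_sub_cancel_right, add_assoc, one_add_one_eq_two]
  · exact (((hS1 r).mul_left 3).add (hS2 r)).add
      (((hasSum_sq (a r)).mul_left 3).add (hasSum_sq_shift (a r) 2))
  · have := ha.continuous
    fun_prop
  · have h2 := (hps r).hasSum.add (hasSum_shift (hqs r).hasSum 1)
    rwa [← (hps r).tsum_add (hqs r), (hpq r).tsum_eq] at h2

/-- As $\|Da\|^2=2\|a\|^2-2\,\mathrm{Re}\langle a,Sa\rangle$ for the shift $S$, energy conservation
equates the growth of $\|Da\|^2$ with twice that of $\|a\|^2$. Mass conservation bounds the latter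
by $\tfrac83A^3(x+y)$, so $x^2-y^2\le\tfrac{16}3A^3(x+y)$ and $x-y\le6A^3$. -/
lemma IsSmallSolution.norm_forwardDiff_le (hσ : |σ| ≤ 1) (ha : IsSmallSolution σ a) {A : ℝ}
    (hA : ∀ t, ‖a t‖ ≤ A) (t : ℝ) :
    ‖forwardDiff (a t)‖ ≤ ‖forwardDiff (a 0)‖ + 6 * A ^ 3 := by
  have hA0 : 0 ≤ A := (norm_nonneg _).trans (hA 0)
  set x := ‖forwardDiff (a t)‖
  set y := ‖forwardDiff (a 0)‖
  have hx : 0 ≤ x := norm_nonneg _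
  have hy : 0 ≤ y := norm_nonneg _
  have h1 : x ^ 2 - y ^ 2 = 2 * (‖a t‖ ^ 2 - ‖a 0‖ ^ 2) := by
    rw [norm_forwardDiff_sq, norm_forwardDiff_sq, ha.energy_conserved hσ 0 t]; ring
  have h2 := abs_le.mp (abs_tsum_massDensity_sub_le hσ (a t))
  have h3 := abs_le.mp (abs_tsum_massDensity_sub_le hσ (a 0))
  rw [ha.mass_conserved hσ 0 t] at h2
  have h4 : 8 / 3 * ‖a t‖ ^ 3 * x ≤ 8 / 3 * A ^ 3 * x := by gcongr; exact hA t
  have h5 : 8 / 3 * ‖a 0‖ ^ 3 * y ≤ 8 / 3 * A ^ 3 * y := by gcongr; exact hA 0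
  by_contra hlt
  push Not at hlt
  have h6 : 0 ≤ A ^ 3 := by positivity
  nlinarith

end

section

/-! ### Localisation in space -/

/-- A weight that vanishes at the origin and tends to one at infinity. -/
def weight (x : ℝ) : ℝ := x ^ 2 / (1 + x ^ 2)

/-- The derivative of `weight`. -/
def weightDeriv (x : ℝ) : ℝ := 2 * x / (1 + x ^ 2) ^ 2

lemma weight_nonneg (x : ℝ) : 0 ≤ weight x := by unfold weight; positivity

lemma weight_le_one (x : ℝ) : weight x ≤ 1 := by
  unfold weight
  rw [div_le_one (by positivity)]
  linarith

lemma abs_weight_le_one (x : ℝ) : |weight x| ≤ 1 := by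
  rw [abs_of_nonneg (weight_nonneg x)]
  exact weight_le_one x

lemma weight_le_sq (x : ℝ) : weight x ≤ x ^ 2 :=
  div_le_self (by positivity) (by nlinarith [sq_nonneg x])

lemma half_le_weight {x : ℝ} (hx : 1 ≤ |x|) : 1 / 2 ≤ weight x := by
  unfold weight
  have : 1 ≤ x ^ 2 := by rw [← sq_abs]; nlinarith
  rw [le_div_iff₀ (by positivity)]
  linarith

lemma hasDerivAt_weight (x : ℝ) : HasDerivAt weight (weightDeriv x) x := by
  have h1 : HasDerivAt (fun x : ℝ => x ^ 2) (2 * x) x := by simpa using hasDerivAt_pow 2 x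
  have h2 := h1.div (h1.const_add 1) (by positivity : (1 + x ^ 2 : ℝ) ≠ 0)
  refine h2.congr_deriv ?_
  rw [weightDeriv]
  ring

lemma continuous_weightDeriv : Continuous weightDeriv := by
  unfold weightDeriv
  exact Continuous.div (by fun_prop) (by fun_prop) fun x => by positivity

lemma abs_weightDeriv_le (x : ℝ) : |weightDeriv x| ≤ 1 := by
  rw [weightDeriv, abs_div, abs_of_pos (by positivity : (0 : ℝ) < (1 + x ^ 2) ^ 2),
    div_le_one (by positivity), abs_le]
  constructor <;> nlinarith [sq_nonneg (x - 1), sq_nonneg (x + 1), sq_nonneg (x ^ 2)]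

lemma abs_weight_sub_le (x y : ℝ) : |weight x - weight y| ≤ |x - y| := by
  have h := Convex.norm_image_sub_le_of_norm_hasDerivWithin_le (f := weight) (f' := weightDeriv)
    (C := 1) (s := Set.univ) (x := y) (y := x) (fun z _ => (hasDerivAt_weight z).hasDerivWithinAt)
    (fun z _ => abs_weightDeriv_le z) convex_univ trivial trivial
  simpa using h

/-- The even-order terms cancel in a symmetric difference, so the error is cubic. Over the time
scale $h^{-3}$ with `s` of order $h$, a quadratic error would be too large. -/
lemma abs_weight_symm_sub_le (x : ℝ) {s : ℝ} (hs0 : 0 ≤ s) (hs1 : s ≤ 1) :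
    |weight (x + s) - weight (x - s) - 2 * s * weightDeriv x| ≤ 6 * s ^ 3 := by
  set P : ℝ := (1 + (x + s) ^ 2) * (1 + (x - s) ^ 2) with hP
  have hP1 : 1 ≤ P := by
    rw [hP]; nlinarith [sq_nonneg (x + s), sq_nonneg (x - s), mul_nonneg (sq_nonneg (x + s)) (sq_nonneg (x - s))]
  have h1 : weight (x + s) - weight (x - s) - 2 * s * weightDeriv x =
      -(4 * s ^ 3) * (x * (2 - 2 * x ^ 2 + s ^ 2)) / ((1 + x ^ 2) ^ 2 * P) := by
    rw [weight, weight, weightDeriv, hP]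
    have e1 : (1 + (x + s) ^ 2) ≠ 0 := by positivity
    have e2 : (1 + (x - s) ^ 2) ≠ 0 := by positivity
    have e3 : (1 + x ^ 2) ≠ 0 := by positivity
    field_simp
    ring
  have h2 : |x * (2 - 2 * x ^ 2 + s ^ 2)| ≤ 3 / 2 * (1 + x ^ 2) ^ 2 := by
    have h3 : |x| ≤ (1 + x ^ 2) / 2 := by
      rw [abs_le]; constructor <;> nlinarith [sq_nonneg (x - 1), sq_nonneg (x + 1)]
    have h4 : |2 - 2 * x ^ 2 + s ^ 2| ≤ 3 * (1 + x ^ 2) := by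
      rw [abs_le]; constructor <;> nlinarith [sq_nonneg x]
    rw [abs_mul]
    calc _ ≤ (1 + x ^ 2) / 2 * (3 * (1 + x ^ 2)) := by gcongr
      _ = _ := by ring
  have hpos : 0 < (1 + x ^ 2) ^ 2 * P := by positivity
  rw [h1, abs_div, abs_of_pos hpos, div_le_iff₀ hpos, abs_mul, abs_neg,
    abs_of_nonneg (by positivity : 0 ≤ 4 * s ^ 3)]
  calc 4 * s ^ 3 * |x * (2 - 2 * x ^ 2 + s ^ 2)| ≤ 4 * s ^ 3 * (3 / 2 * (1 + x ^ 2) ^ 2) := by gcongr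
    _ = 6 * s ^ 3 * ((1 + x ^ 2) ^ 2 * 1) := by ring
    _ ≤ _ := by gcongr

lemma summable_bdd_mul {W f : ℤ → ℝ} (hW : ∀ n, |W n| ≤ 1) (hf : Summable fun n => |f n|) :
    Summable fun n => W n * f n :=
  hf.of_norm_bounded fun n => by
    rw [norm_mul, Real.norm_eq_abs, Real.norm_eq_abs]
    exact mul_le_of_le_one_left (abs_nonneg _) (hW n)

/-- Summation by parts in the flux of the weighted mass. -/
lemma hasSum_weight_mul_current (c : EllTwo) {W : ℤ → ℝ} (hW : ∀ n, |W n| ≤ 1) :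
    HasSum (fun n => W n * current c n)
      (∑' n, ((W (n + 1) - W n) * ‖forwardDiff c n‖ ^ 2 - (W (n + 1) - W (n - 1)) * ‖c n‖ ^ 2)) := by
  set K : ℤ → ℝ := fun n => 2 * (conj (c n) * c (n + 1)).re with hK
  have hKs : Summable fun n => |K n| := ((hasSum_re_inner_shift c 1).summable.mul_left 2).abs
  have hcs : Summable fun n => |‖c n‖ ^ 2| := (hasSum_sq c).summable.abs
  have hds : Summable fun n => |‖forwardDiff c n‖ ^ 2| := (hasSum_sq (forwardDiff c)).summable.abs
  have hK' : Summable fun n => |K (n - 1)| := (hasSum_shift hKs.hasSum (-1)).summable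
  -- The weighted current differs from the claimed summand exactly by $v_n-v_{n+1}$, which sums to
  -- zero.
  set v : ℤ → ℝ := fun n => W n * K (n - 1) - W n * ‖c n‖ ^ 2 + W (n - 1) * ‖c n‖ ^ 2 with hv
  have hvs : Summable v := ((summable_bdd_mul hW hK').sub (summable_bdd_mul hW hcs)).add
    (summable_bdd_mul (fun n => hW (n - 1)) hcs)
  have hz : Summable fun n => (W (n + 1) - W n) * ‖forwardDiff c n‖ ^ 2 -
      (W (n + 1) - W (n - 1)) * ‖c n‖ ^ 2 := by
    simp only [sub_mul]
    exact ((summable_bdd_mul (fun n => hW (n + 1)) hds).sub (summable_bdd_mul hW hds)).sub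
      ((summable_bdd_mul (fun n => hW (n + 1)) hcs).sub (summable_bdd_mul (fun n => hW (n - 1)) hcs))
  have h1 := hz.hasSum.sub (hvs.hasSum.sub (hasSum_shift hvs.hasSum 1))
  rw [sub_self, sub_zero] at h1
  refine hasSum_of_eq h1 fun n => ?_
  have h2 : current c n = K n - K (n - 1) := by
    simp only [current, hK, sub_add_cancel, mul_re, conj_re, conj_im, sub_re, sub_im]
    ring
  have h3 : ‖forwardDiff c n‖ ^ 2 = ‖c n‖ ^ 2 + ‖c (n + 1)‖ ^ 2 - K n := by
    rw [forwardDiff_apply, hK, ← normSq_eq_norm_sq, ← normSq_eq_norm_sq, ← normSq_eq_norm_sq,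
      normSq_apply, normSq_apply, normSq_apply]
    simp only [mul_re, conj_re, conj_im, sub_re, sub_im]
    ring
  simp only [hv, add_sub_cancel_right]
  rw [h2, h3]
  ring

variable {σ : ℝ} {a : ℝ → EllTwo}

lemma summable_weight_mul (c : EllTwo) {W : ℤ → ℝ} (hW : ∀ n, |W n| ≤ 1) :
    Summable fun n => W n * ‖c n‖ ^ 2 :=
  summable_bdd_mul hW (hasSum_sq c).summable.abs

/-- The weight moves with the group velocity $2$ of long waves, so its time derivative cancels the
main flux $(W_{n+1}-W_{n-1})|a_n|^2$. The three terms in the rate come from $W_{n+1}-W_n$ against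
$|Da_n|^2$, the cubic error of the symmetric difference, and $\rho(|a_n|^2)-|a_n|^2$. -/
lemma IsSmallSolution.weighted_mass_growth (hσ : |σ| ≤ 1) (ha : IsSmallSolution σ a) {A E s : ℝ}
    (hA : ∀ t, ‖a t‖ ≤ A) (hE : ∀ t, ‖forwardDiff (a t)‖ ≤ E) (hs0 : 0 ≤ s) (hs1 : s ≤ 1) (t : ℝ) :
    ∑' n : ℤ, weight (s * (n - 2 * t)) * ‖a t n‖ ^ 2 ≤
      5 / 3 * ∑' n : ℤ, weight (s * n) * ‖a 0 n‖ ^ 2 +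
        5 / 4 * (s * E ^ 2 + 6 * s ^ 3 * A ^ 2 + 6 * s * A ^ 3 * E) * |t| := by
  have hA0 : 0 ≤ A := (norm_nonneg _).trans (hA 0)
  have hE0 : 0 ≤ E := (norm_nonneg _).trans (hE 0)
  set W : ℤ → ℝ → ℝ := fun n r => weight (s * (n - 2 * r)) with hW
  set W' : ℤ → ℝ → ℝ := fun n r => -(2 * s * weightDeriv (s * (n - 2 * r))) with hW'
  have hW1 : ∀ n r, |W n r| ≤ 1 := fun n r => abs_weight_le_one _
  set z : ℝ → ℤ → ℝ := fun r n => W' n r * massDensity σ (‖a r n‖ ^ 2) -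
    ((W (n + 1) r - W n r) * ‖forwardDiff (a r) n‖ ^ 2 -
      (W (n + 1) r - W (n - 1) r) * ‖a r n‖ ^ 2) with hz
  set β : ℝ → ℤ → ℝ := fun r n => 2 * s * (4 / 3 * (‖a r n‖ ^ 2) ^ 2) + 6 * s ^ 3 * ‖a r n‖ ^ 2 +
    s * ‖forwardDiff (a r) n‖ ^ 2 with hβ
  have hW'b : ∀ n r, |W' n r| ≤ 2 * s := fun n r => by
    simp only [hW']
    rw [abs_neg, abs_mul, abs_of_nonneg (by positivity)]
    exact mul_le_of_le_one_right (by positivity) (abs_weightDeriv_le _)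
  have hzb : ∀ r n, |z r n| ≤ β r n := by
    intro r n
    have e : z r n = W' n r * (massDensity σ (‖a r n‖ ^ 2) - ‖a r n‖ ^ 2) +
        (W (n + 1) r - W (n - 1) r + W' n r) * ‖a r n‖ ^ 2 -
          (W (n + 1) r - W n r) * ‖forwardDiff (a r) n‖ ^ 2 := by
      simp only [hz]; ring
    have h1 : |W' n r * (massDensity σ (‖a r n‖ ^ 2) - ‖a r n‖ ^ 2)| ≤
        2 * s * (4 / 3 * (‖a r n‖ ^ 2) ^ 2) := by
      rw [abs_mul]
      gcongr
      · exact hW'b n r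
      · exact abs_massDensity_sub_le hσ (by positivity)
    have h2 : |(W (n + 1) r - W (n - 1) r + W' n r) * ‖a r n‖ ^ 2| ≤ 6 * s ^ 3 * ‖a r n‖ ^ 2 := by
      rw [abs_mul, abs_of_nonneg (by positivity : 0 ≤ ‖a r n‖ ^ 2)]
      gcongr
      have h3 := abs_weight_symm_sub_le (s * (n - 2 * r)) hs0 hs1
      simp only [hW, hW']
      push_cast
      rwa [show s * ((n : ℝ) + 1 - 2 * r) = s * (n - 2 * r) + s by ring,
        show s * ((n : ℝ) - 1 - 2 * r) = s * (n - 2 * r) - s by ring, ← sub_eq_add_neg]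
    have h3 : |(W (n + 1) r - W n r) * ‖forwardDiff (a r) n‖ ^ 2| ≤
        s * ‖forwardDiff (a r) n‖ ^ 2 := by
      rw [abs_mul, abs_of_nonneg (by positivity : 0 ≤ ‖forwardDiff (a r) n‖ ^ 2)]
      gcongr
      refine (abs_weight_sub_le _ _).trans (le_of_eq ?_)
      push_cast
      rw [show s * ((n : ℝ) + 1 - 2 * r) - s * (n - 2 * r) = s by ring, abs_of_nonneg hs0]
    rw [e]
    refine (abs_sub _ _).trans (add_le_add ((abs_add_le _ _).trans (add_le_add h1 h2)) h3)
  have hβs : ∀ r, HasSum (β r) (2 * s * (4 / 3 * ∑' n, (‖a r n‖ ^ 2) ^ 2) + 6 * s ^ 3 * ‖a r‖ ^ 2 +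
      s * ‖forwardDiff (a r)‖ ^ 2) := fun r =>
    ((((tsum_pow_four_le (a r)).1.hasSum.mul_left (4 / 3)).mul_left (2 * s)).add
      ((hasSum_sq (a r)).mul_left (6 * s ^ 3))).add ((hasSum_sq (forwardDiff (a r))).mul_left s)
  have hzs : ∀ r, Summable (z r) := fun r => (hβs r).summable.of_norm_bounded (hzb r)
  set C : ℝ := s * E ^ 2 + 6 * s ^ 3 * A ^ 2 + 6 * s * A ^ 3 * E with hC
  have hzC : ∀ r, |∑' n, z r n| ≤ C := by
    intro r
    refine (tsum_of_norm_bounded (f := z r) (hβs r) (hzb r)).trans ?_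
    have h1 : ∑' n, (‖a r n‖ ^ 2) ^ 2 ≤ 2 * A ^ 3 * E := by
      refine (tsum_pow_four_le (a r)).2.trans ?_
      gcongr
      · exact hA r
      · exact hE r
    have h2 : 6 * s ^ 3 * ‖a r‖ ^ 2 ≤ 6 * s ^ 3 * A ^ 2 := by gcongr; exact hA r
    have h3 : s * ‖forwardDiff (a r)‖ ^ 2 ≤ s * E ^ 2 := by gcongr; exact hE r
    have h4 : 2 * s * (4 / 3 * ∑' n, (‖a r n‖ ^ 2) ^ 2) ≤ 2 * s * (4 / 3 * (2 * A ^ 3 * E)) := by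
      gcongr
    have h5 : 0 ≤ s * (A ^ 3 * E) := by positivity
    rw [hC]
    linarith
  have hmain := ha.weighted_mass_evolution hσ (W := W) (W' := W') (B := 2 * s)
    (fun n r => by
      have h1 : HasDerivAt (fun r : ℝ => s * ((n : ℝ) - 2 * r)) (s * (-(2 * 1))) r :=
        (((hasDerivAt_id r).const_mul 2).const_sub _).const_mul s
      refine ((hasDerivAt_weight _).comp r h1).congr_deriv ?_
      simp only [hW']; ring)
    (fun n => by
      have := continuous_weightDeriv
      simp only [hW']; fun_prop)
    hW1 hW'b (D := fun r => ∑' n, z r n) (fun r => by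
      have h1 := hasSum_weight_mul_current (a r) (W := fun n => W n r) (fun n => hW1 n r)
      have h2 : Summable fun n => W' n r * massDensity σ (‖a r n‖ ^ 2) := by
        refine ((summable_massDensity hσ (a r)).mul_left (2 * s)).of_norm_bounded fun n => ?_
        have h3 := massDensity_nonneg hσ (sq_nonneg ‖a r n‖)
        rw [norm_mul, Real.norm_eq_abs, Real.norm_eq_abs, abs_of_nonneg h3]
        exact mul_le_mul_of_nonneg_right (hW'b n r) h3
      have h3 := h2.hasSum.sub h1
      have h5 : Summable fun n => (W (n + 1) r - W n r) * ‖forwardDiff (a r) n‖ ^ 2 -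
          (W (n + 1) r - W (n - 1) r) * ‖a r n‖ ^ 2 := by
        have := h2.sub (hzs r)
        simpa [hz] using this
      rw [← h2.tsum_sub h5] at h3
      exact h3) 0 t
  have hint : |∫ r in (0 : ℝ)..t, ∑' n, z r n| ≤ C * |t| := by
    have := intervalIntegral.norm_integral_le_of_norm_le_const (a := 0) (b := t)
      (f := fun r => ∑' n, z r n) (C := C) fun r _ => hzC r
    simpa using this
  have hlow : 4 / 5 * ∑' n, W n t * ‖a t n‖ ^ 2 ≤
      ∑' n, W n t * massDensity σ (‖a t n‖ ^ 2) := by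
    rw [← tsum_mul_left]
    refine Summable.tsum_le_tsum (fun n => ?_) ((summable_weight_mul (a t) fun n => hW1 n t).mul_left _)
      (summable_bdd_mul (fun n => hW1 n t) (summable_massDensity hσ (a t)).abs)
    have := mul_le_mul_of_nonneg_left (massDensity_bounds hσ (sq_nonneg ‖a t n‖)).1
      (weight_nonneg (s * (n - 2 * t)))
    simp only [hW]
    linarith
  have hhigh : ∑' n, W n 0 * massDensity σ (‖a 0 n‖ ^ 2) ≤
      4 / 3 * ∑' n, W n 0 * ‖a 0 n‖ ^ 2 := by
    rw [← tsum_mul_left]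
    refine Summable.tsum_le_tsum (fun n => ?_)
      (summable_bdd_mul (fun n => hW1 n 0) (summable_massDensity hσ (a 0)).abs)
      ((summable_weight_mul (a 0) fun n => hW1 n 0).mul_left _)
    have := mul_le_mul_of_nonneg_left (massDensity_bounds hσ (sq_nonneg ‖a 0 n‖)).2
      (weight_nonneg (s * (n - 2 * 0)))
    simp only [hW]
    linarith
  have h0 : ∑' n : ℤ, W n 0 * ‖a 0 n‖ ^ 2 = ∑' n : ℤ, weight (s * n) * ‖a 0 n‖ ^ 2 := by
    simp [hW]
  rw [h0] at hhigh
  have := (abs_le.mp hint).2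
  rw [← hmain] at this
  change ∑' n, W n t * ‖a t n‖ ^ 2 ≤ _
  linarith

end

/-! ### Sampling and the initial data -/

lemma memLp_top_of_continuous {m : ℝ → ℂ} (hm : Continuous m) {B : ℝ} (hB : ∀ x, ‖m x‖ ≤ B) :
    MemLp m ∞ (volume : Measure ℝ) :=
  memLp_top_of_bound hm.aestronglyMeasurable B (Filter.Eventually.of_forall hB)

/-- Multiplication of square-integrable functions by a bounded function. -/
def multiplier (m : ℝ → ℂ) (hm : MemLp m ∞ (volume : Measure ℝ)) : L2R →L[ℂ] L2R :=
  mulTop hm.toLp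

lemma multiplier_ae {m : ℝ → ℂ} (hm : MemLp m ∞ (volume : Measure ℝ)) (f : L2R) :
    multiplier m hm f =ᵐ[volume] fun x => m x * f x := by
  filter_upwards [coeFn_mulTop hm.toLp f, hm.coeFn_toLp] with x h1 h2
  rw [multiplier, h1, h2]

lemma norm_multiplier_le {m : ℝ → ℂ} (hm : MemLp m ∞ (volume : Measure ℝ)) {B : ℝ}
    (hB : ∀ x, ‖m x‖ ≤ B) (f : L2R) : ‖multiplier m hm f‖ ≤ B * ‖f‖ := by
  refine Lp.norm_le_mul_norm_of_ae_le_mul ?_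
  filter_upwards [multiplier_ae hm f] with x h1
  rw [h1, norm_mul]
  gcongr
  exact hB x

lemma norm_exp_mul_I_mul (a b c : ℝ) : ‖exp (2 * Real.pi * I * (a * b) * c)‖ = 1 := by
  rw [show 2 * Real.pi * I * (a * b) * c = ((2 * Real.pi * (a * b) * c : ℝ) : ℂ) * I by
    push_cast; ring]
  exact norm_exp_ofReal_mul_I _

/-- The samples at the points `h n`, multiplied by `h`, of the function with Fourier transform
`f` restricted to the frequency band. -/
def sample {h : ℝ} (hh : 0 < h) : L2R →L[ℂ] EllTwo :=
  (h : ℂ) • ContinuousLinearMap.adjoint (toBand hh)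

lemma sample_apply {h : ℝ} (hh : 0 < h) (f : L2R) (n : ℤ) :
    sample hh f n = h * ∫ η in band h, exp (2 * Real.pi * I * (h * n) * η) * f η := by
  rw [← adjoint_toBand_apply hh]
  rfl

lemma norm_sample_le {h : ℝ} (hh : 0 < h) (f : L2R) : ‖sample hh f‖ ≤ √h * ‖f‖ := by
  have h1 : ‖sample hh f‖ = h * ‖ContinuousLinearMap.adjoint (toBand hh) f‖ := by
    rw [sample, smul_apply, norm_smul, norm_real, Real.norm_eq_abs,
      abs_of_pos hh]
  rw [h1]
  refine (mul_le_mul_of_nonneg_left (norm_adjoint_toBand_le hh f) hh.le).trans (le_of_eq ?_)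
  have hs : 0 < √h := Real.sqrt_pos.mpr hh
  field_simp
  rw [Real.sq_sqrt hh.le, mul_comm]

lemma integrableOn_exp_mul {h : ℝ} (f : L2R) (x : ℝ) (y : ℝ) :
    IntegrableOn (fun η : ℝ => exp (2 * Real.pi * I * (x * y) * η) * f η) (band h) := by
  have h1 : IntegrableOn (fun η => f η) (band h) := by
    have : IsFiniteMeasure (volume.restrict (band h)) := ⟨by simp [band]⟩
    exact ((Lp.memLp f).restrict _).integrable (q := 2) (by norm_num)
  refine Integrable.bdd_mul (c := 1) h1 (by fun_prop) (Filter.Eventually.of_forall fun η => ?_)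
  exact (norm_exp_mul_I_mul x y η).le

lemma memLp_top_exp_sub_one (h : ℝ) :
    MemLp (fun η : ℝ => exp (2 * Real.pi * I * h * η) - 1) ∞ volume := by
  refine memLp_top_of_continuous (B := 2) (by fun_prop) fun η => ?_
  refine (norm_sub_le _ _).trans ?_
  have := norm_exp_mul_I_mul h 1 η
  rw [ofReal_one, mul_one] at this
  rw [this, norm_one]
  norm_num

lemma norm_exp_sub_one_le (h η : ℝ) :
    ‖exp (2 * Real.pi * I * h * η) - 1‖ ≤ 2 * Real.pi * |h| * |η| := by
  have := Real.norm_exp_I_mul_ofReal_sub_one_le (x := 2 * Real.pi * h * η)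
  rw [show 2 * Real.pi * I * h * η = I * ((2 * Real.pi * h * η : ℝ) : ℂ) by push_cast; ring]
  refine this.trans (le_of_eq ?_)
  rw [Real.norm_eq_abs, abs_mul, abs_mul, abs_of_pos Real.two_pi_pos]

/-- Shifting the sampling point by $h$ multiplies the transform by $e^{2\pi ih\eta}$. The multiplier
is at most $2\pi h|\eta|$, so one derivative of the datum yields a factor $h$. -/
lemma forwardDiff_sample {h : ℝ} (hh : 0 < h) (f : L2R) :
    forwardDiff (sample hh f) = sample hh (multiplier _ (memLp_top_exp_sub_one h) f) := by
  ext n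
  rw [forwardDiff_apply, sample_apply, sample_apply, sample_apply, ← mul_sub]
  congr 1
  have h1 := integrableOn_exp_mul (h := h) f h ((n + 1 : ℤ) : ℝ)
  have h2 := integrableOn_exp_mul (h := h) f h (n : ℝ)
  simp only [ofReal_intCast] at h1 h2
  rw [← integral_sub h1 h2]
  refine integral_congr_ae (ae_restrict_of_ae ?_)
  filter_upwards [multiplier_ae (memLp_top_exp_sub_one h) f] with η h3
  have h4 : exp (2 * Real.pi * I * (h * ((n + 1 : ℤ) : ℂ)) * η) =
      exp (2 * Real.pi * I * (h * n) * η) * exp (2 * Real.pi * I * h * η) := by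
    rw [← exp_add]
    congr 1
    push_cast
    ring
  rw [h3, h4]
  ring

lemma IsLowFrequencyCutoff.eq_zero {φ : ℝ → ℂ} (hφ : IsLowFrequencyCutoff φ) {x : ℝ}
    (hx : 2 < |x|) : x ∉ tsupport φ := by
  intro h
  have := hφ.support_subset h
  rw [Metric.mem_closedBall, dist_zero_right, Real.norm_eq_abs] at this
  linarith

lemma four_mul_abs_of_notMem_band {h η : ℝ} (hh : 0 < h) (hη : η ∉ band h) :
    2 < |4 * h * η| := by
  rw [band, Set.mem_Icc, ← abs_le, not_le, div_lt_iff₀ (by positivity)] at hη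
  rw [abs_mul, abs_of_pos (by positivity : 0 < 4 * h)]
  linarith

lemma IsLowFrequencyCutoff.memLp_top {φ : ℝ → ℂ} (hφ : IsLowFrequencyCutoff φ) (h : ℝ) :
    MemLp (fun η : ℝ => φ (4 * h * η)) ∞ volume :=
  memLp_top_of_continuous (hφ.smooth.continuous.comp (by fun_prop)) fun _ => hφ.norm_le_one _

/-- The projection to low frequencies on the Fourier side, at the scale of the step `h`. -/
def lowFreq {φ : ℝ → ℂ} (hφ : IsLowFrequencyCutoff φ) (h : ℝ) : L2R →L[ℂ] L2R :=
  multiplier _ (hφ.memLp_top h)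

lemma lowFreq_ae {φ : ℝ → ℂ} (hφ : IsLowFrequencyCutoff φ) (h : ℝ) (f : L2R) :
    lowFreq hφ h f =ᵐ[volume] fun η => φ (4 * h * η) * f η := multiplier_ae _ f

lemma norm_lowFreq_le {φ : ℝ → ℂ} (hφ : IsLowFrequencyCutoff φ) (h : ℝ) (f : L2R) :
    ‖lowFreq hφ h f‖ ≤ ‖f‖ :=
  (norm_multiplier_le (hφ.memLp_top h) (fun _ => hφ.norm_le_one _) f).trans (one_mul _).le

lemma sample_apply_of_eq_zero {h : ℝ} (hh : 0 < h) (f : L2R) {g : ℝ → ℂ} (hfg : f =ᵐ[volume] g)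
    (hg : ∀ η ∉ band h, g η = 0) (n : ℤ) :
    sample hh f n = h * ∫ η : ℝ, exp (2 * Real.pi * I * (h * n) * η) * g η := by
  rw [sample_apply]
  congr 1
  rw [← setIntegral_eq_integral_of_forall_compl_eq_zero (s := band h) (μ := volume)
    (f := fun η : ℝ => exp (2 * Real.pi * I * (h * n) * η) * g η)
    (fun η hη => by rw [hg η hη, mul_zero])]
  refine integral_congr_ae (ae_restrict_of_ae ?_)
  filter_upwards [hfg] with η h1
  rw [h1]

/-- With $\xi=2\pi\eta$ and $N=\pi/(2h)$ one has $\xi/N=4h\eta$. The cutoff then vanishes outside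
$|\eta|\le1/(2h)$, so restricting to the band loses nothing. -/
lemma sample_lowFreq {φ : ℝ → ℂ} (hφ : IsLowFrequencyCutoff φ) {h : ℝ} (hh : 0 < h) (φ₀ : L2R)
    (n : ℤ) : sample hh (lowFreq hφ h (𝓕 φ₀ : L2R)) n =
      h * lowPass φ (Real.pi / (2 * h)) φ₀ (h * n) := by
  rw [sample_apply_of_eq_zero hh _ (lowFreq_ae hφ h _) fun η hη => by
    rw [image_eq_zero_of_notMem_tsupport (hφ.eq_zero (four_mul_abs_of_notMem_band hh hη)), zero_mul]]
  congr 1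
  have h1 := Measure.integral_comp_mul_left (fun ξ : ℝ => exp (I * ((h * n : ℝ) : ℂ) * ξ) *
    (φ (ξ / (Real.pi / (2 * h))) * lineHat φ₀ ξ) / (2 * Real.pi)) (2 * Real.pi)
  have hpi := Real.pi_pos
  rw [abs_of_pos (by positivity)] at h1
  have h2 := (inv_smul_eq_iff₀ (by positivity)).mp h1.symm
  rw [lowPass, h2, ← integral_smul]
  refine integral_congr_ae (Filter.Eventually.of_forall fun η => ?_)
  have h3 : 2 * Real.pi * η / (Real.pi / (2 * h)) = 4 * h * η := by field_simp; ring
  have h4 : lineHat φ₀ (2 * Real.pi * η) = (𝓕 φ₀ : L2R) η := by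
    rw [lineHat, mul_div_cancel_left₀ _ (by positivity)]
  have h5 : (2 * Real.pi : ℂ) ≠ 0 := by exact_mod_cast Real.two_pi_pos.ne'
  have h6 : I * ((h * n : ℝ) : ℂ) * ((2 * Real.pi * η : ℝ) : ℂ) =
      2 * Real.pi * I * (h * n) * η := by push_cast; ring
  simp only
  rw [h3, h4, h6, real_smul, ofReal_mul, ofReal_ofNat, mul_div_cancel₀ _ h5]

lemma norm_forwardDiff_sample_lowFreq_le {φ : ℝ → ℂ} (hφ : IsLowFrequencyCutoff φ) {h : ℝ}
    (hh : 0 < h) {φ₀ : L2R} (hφ₀ : MemHOne φ₀) :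
    ‖forwardDiff (sample hh (lowFreq hφ h (𝓕 φ₀ : L2R)))‖ ≤
      √h * (2 * Real.pi * h * ‖(memLp_mul_fourier hφ₀).toLp‖) := by
  rw [forwardDiff_sample]
  refine (norm_sample_le hh _).trans (mul_le_mul_of_nonneg_left ?_ (Real.sqrt_nonneg _))
  refine Lp.norm_le_mul_norm_of_ae_le_mul ?_
  filter_upwards [multiplier_ae (memLp_top_exp_sub_one h) (lowFreq hφ h (𝓕 φ₀ : L2R)),
    lowFreq_ae hφ h (𝓕 φ₀ : L2R), (memLp_mul_fourier hφ₀).coeFn_toLp] with η h1 h2 h3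
  rw [h1, h2, h3, norm_mul, norm_mul, norm_mul, norm_real, Real.norm_eq_abs]
  have h4 := norm_exp_sub_one_le h η
  rw [abs_of_pos hh] at h4
  calc _ ≤ (2 * Real.pi * h * |η|) * (1 * ‖(𝓕 φ₀ : L2R) η‖) := by
        gcongr
        exact hφ.norm_le_one _
    _ = _ := by ring

/-- Integration by parts for the samples of a smooth function of frequency. -/
lemma sample_deriv_apply {h : ℝ} (hh : 0 < h) {G G' : ℝ → ℂ} {f f' : L2R}
    (hG : ∀ x, HasDerivAt G (G' x) x) (hG0 : ∀ η ∉ band h, G η = 0)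
    (hG0' : ∀ η ∉ band h, G' η = 0) (hGc : Continuous G')
    (hf : f =ᵐ[volume] G) (hf' : f' =ᵐ[volume] G') (n : ℤ) :
    sample hh f' n = -(2 * Real.pi * I * (h * n)) * sample hh f n := by
  rw [sample_apply_of_eq_zero hh f hf hG0, sample_apply_of_eq_zero hh f' hf' hG0']
  have hGc0 : Continuous G := continuous_iff_continuousAt.mpr fun x => (hG x).continuousAt
  have hint : ∀ {u : ℝ → ℂ}, Continuous u → (∀ η ∉ band h, u η = 0) → Integrable u :=
    fun hu h0 => hu.integrable_of_hasCompactSupport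
      (HasCompactSupport.intro (isCompact_Icc (a := -(1 / (2 * h))) (b := 1 / (2 * h))) h0)
  have h1 : ∀ x : ℝ, HasDerivAt (fun η : ℝ => exp (2 * Real.pi * I * (h * n) * η))
      (2 * Real.pi * I * (h * n) * exp (2 * Real.pi * I * (h * n) * x)) x := by
    intro x
    have := ((hasDerivAt_id (x : ℂ)).const_mul (2 * Real.pi * I * (h * n))).cexp.comp_ofReal
    refine this.congr_deriv ?_
    simp [mul_comm]
  have h2 := integral_mul_deriv_eq_deriv_mul_of_integrable (fun x _ => h1 x) (fun x _ => hG x)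
    (hint (by fun_prop) fun η hη => by simp [hG0' η hη])
    (hint (by fun_prop) fun η hη => by simp [hG0 η hη])
    (hint (by fun_prop) fun η hη => by simp [hG0 η hη])
  rw [h2]
  have h3 : ∀ η : ℝ, 2 * Real.pi * I * (h * n) * exp (2 * Real.pi * I * (h * n) * η) * G η =
      2 * Real.pi * I * (h * n) * (exp (2 * Real.pi * I * (h * n) * η) * G η) :=
    fun η => mul_assoc _ _ _
  simp only [h3]
  rw [integral_const_mul]
  ring

lemma hasDerivAt_cutoff_mul {φ : ℝ → ℂ} (hφ : IsLowFrequencyCutoff φ) (h : ℝ) (ψ : SchwartzMap ℝ ℂ)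
    (x : ℝ) : HasDerivAt (fun η => φ (4 * h * η) * ψ η)
      (4 * h * deriv φ (4 * h * x) * ψ x + φ (4 * h * x) * deriv ψ x) x := by
  have h1 : HasDerivAt φ (deriv φ (4 * h * x)) (4 * h * x) :=
    ((hφ.smooth.differentiable (by norm_num)) _).hasDerivAt
  have h2 := h1.scomp x ((hasDerivAt_id x).const_mul (4 * h))
  refine (h2.mul (ψ.hasDerivAt x)).congr_deriv ?_
  simp

lemma IsLowFrequencyCutoff.exists_deriv_bound {φ : ℝ → ℂ} (hφ : IsLowFrequencyCutoff φ) :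
    ∃ M, 0 ≤ M ∧ ∀ x, ‖deriv φ x‖ ≤ M := by
  have hc : HasCompactSupport φ :=
    (isCompact_closedBall (0 : ℝ) 2).of_isClosed_subset (isClosed_tsupport φ) hφ.support_subset
  obtain ⟨M, hM⟩ := (hφ.smooth.continuous_deriv (by norm_num)).bounded_above_of_compact_support
    hc.deriv
  exact ⟨M, (norm_nonneg _).trans (hM 0), hM⟩

/-- Samples of a smooth function of frequency decay in space, uniformly in the step. -/
lemma exists_norm_mul_sample_le {φ : ℝ → ℂ} (hφ : IsLowFrequencyCutoff φ) (ψ : SchwartzMap ℝ ℂ) :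
    ∃ C, 0 ≤ C ∧ ∀ (h : ℝ) (hh : 0 < h), h ≤ 1 → ∃ d : EllTwo, ‖d‖ ≤ √h * C ∧
      ∀ n : ℤ, |h * n| * ‖sample hh (lowFreq hφ h (ψ.toLp 2)) n‖ ≤ ‖d n‖ := by
  obtain ⟨M, hM0, hM⟩ := hφ.exists_deriv_bound
  set ψ' : SchwartzMap ℝ ℂ := SchwartzMap.derivCLM ℂ ℂ ψ with hψ'
  refine ⟨4 * M * ‖ψ.toLp 2 (volume : Measure ℝ)‖ + ‖ψ'.toLp 2 (volume : Measure ℝ)‖,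
    by positivity, fun h hh h1 => ?_⟩
  have hφ'c : Continuous (deriv φ) := hφ.smooth.continuous_deriv (by norm_num)
  have hφc : Continuous φ := hφ.smooth.continuous
  have hm : ∀ η : ℝ, ‖4 * (h : ℂ) * deriv φ (4 * h * η)‖ ≤ 4 * M := by
    intro η
    rw [norm_mul, norm_mul, norm_real, Real.norm_eq_abs, abs_of_pos hh]
    norm_num
    have := hM (4 * h * η)
    have h0 := norm_nonneg (deriv φ (4 * h * η))
    nlinarith
  have hm' : MemLp (fun η : ℝ => 4 * (h : ℂ) * deriv φ (4 * h * η)) ∞ volume :=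
    memLp_top_of_continuous (by fun_prop) hm
  -- This is the derivative of $\varphi(4h\eta)\psi(\eta)$ by the product rule; the factor $h\le1$
  -- keeps the first term bounded uniformly in $h$.
  set f' : L2R := multiplier _ hm' (ψ.toLp 2) + lowFreq hφ h (ψ'.toLp 2) with hf'
  have hf'n : ‖f'‖ ≤ 4 * M * ‖ψ.toLp 2 (volume : Measure ℝ)‖ + ‖ψ'.toLp 2 (volume : Measure ℝ)‖ :=
    (norm_add_le _ _).trans (add_le_add (norm_multiplier_le hm' hm _) (norm_lowFreq_le hφ h _))
  refine ⟨sample hh f', (norm_sample_le hh f').trans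
    (mul_le_mul_of_nonneg_left hf'n (Real.sqrt_nonneg h)), fun n => ?_⟩
  have hz : ∀ η ∉ band h, 4 * h * η ∉ tsupport φ := fun η hη =>
    hφ.eq_zero (four_mul_abs_of_notMem_band hh hη)
  have hf'ae : f' =ᵐ[volume] fun x => 4 * h * deriv φ (4 * h * x) * ψ x +
      φ (4 * h * x) * deriv ψ x := by
    filter_upwards [Lp.coeFn_add (multiplier _ hm' (ψ.toLp 2)) (lowFreq hφ h (ψ'.toLp 2)),
      multiplier_ae hm' (ψ.toLp 2), lowFreq_ae hφ h (ψ'.toLp 2), ψ.coeFn_toLp 2 volume,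
      ψ'.coeFn_toLp 2 volume] with x e1 e2 e3 e4 e5
    rw [hf', e1, Pi.add_apply, e2, e3, e4, e5, hψ', SchwartzMap.derivCLM_apply]
  have hfae : lowFreq hφ h (ψ.toLp 2) =ᵐ[volume] fun x => φ (4 * h * x) * ψ x := by
    filter_upwards [lowFreq_ae hφ h (ψ.toLp 2), ψ.coeFn_toLp 2 volume] with x e1 e2
    rw [e1, e2]
  have hψ'c : Continuous (deriv ψ) := (ψ.smooth 1).continuous_deriv (by norm_num)
  rw [sample_deriv_apply hh (hasDerivAt_cutoff_mul hφ h ψ)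
    (fun η hη => by rw [image_eq_zero_of_notMem_tsupport (hz η hη), zero_mul])
    (fun η hη => by
      rw [image_eq_zero_of_notMem_tsupport (hz η hη),
        image_eq_zero_of_notMem_tsupport fun h' => hz η hη (tsupport_deriv_subset h')]
      simp)
    (by fun_prop) hfae hf'ae]
  rw [norm_mul, norm_neg, norm_mul, norm_mul, norm_mul, norm_I, norm_real, Real.norm_eq_abs,
    abs_of_pos Real.pi_pos, ← ofReal_intCast, ← ofReal_mul, norm_real, Real.norm_eq_abs]
  norm_num
  have h3 := Real.pi_gt_three
  have h4 : 0 ≤ |h * (n : ℝ)| * ‖sample hh (lowFreq hφ h (ψ.toLp 2)) n‖ := by positivity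
  rw [abs_mul] at h4
  rw [mul_assoc]
  nlinarith

/-- The initial data carry little mass far away, uniformly in the step. -/
lemma exists_weighted_sample_le {φ : ℝ → ℂ} (hφ : IsLowFrequencyCutoff φ) (g : L2R) {ε : ℝ}
    (hε : 0 < ε) : ∃ R₀, 0 < R₀ ∧ ∀ (h : ℝ) (hh : 0 < h), h ≤ 1 → ∀ R, R₀ ≤ R →
      ∑' n : ℤ, weight (h / R * n) * ‖sample hh (lowFreq hφ h g) n‖ ^ 2 ≤ ε * h := by
  obtain ⟨ψ, hψ⟩ : ∃ ψ : SchwartzMap ℝ ℂ, ‖g - ψ.toLp 2 (volume : Measure ℝ)‖ < √(ε / 4) := by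
    obtain ⟨ψ, hψ⟩ := (SchwartzMap.denseRange_toLpCLM (E := ℝ) (F := ℂ) (p := 2) (by norm_num)
      (μ := volume)).exists_dist_lt g (ε := √(ε / 4)) (by positivity)
    exact ⟨ψ, by simpa [dist_eq_norm] using hψ⟩
  obtain ⟨C, hC0, hC⟩ := exists_norm_mul_sample_le hφ ψ
  -- The Schwartz part contributes at most $2hC^2/R^2\le\varepsilon h/2$, and the error `b` at most
  -- $2h\varepsilon/4$. The `+ 1` keeps the radius positive when `C = 0`.
  refine ⟨√(4 * (C ^ 2 + 1) / ε), by positivity, fun h hh h1 R hR => ?_⟩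
  have hR0 : 0 < R := lt_of_lt_of_le (by positivity) hR
  have hR2 : 4 * C ^ 2 ≤ ε * R ^ 2 := by
    have := (Real.sqrt_le_left hR0.le).mp hR
    rw [div_le_iff₀ hε] at this
    linarith
  obtain ⟨d, hd, hdn⟩ := hC h hh h1
  set a := sample hh (lowFreq hφ h (ψ.toLp 2 volume)) with ha
  set b := sample hh (lowFreq hφ h (g - ψ.toLp 2 volume)) with hb
  have hab : sample hh (lowFreq hφ h g) = a + b := by
    rw [ha, hb, ← map_add, ← map_add, add_sub_cancel]
  have hbn : ‖b‖ ^ 2 ≤ h * (ε / 4) := by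
    have h2 : ‖b‖ ≤ √h * √(ε / 4) := (norm_sample_le hh _).trans
      (mul_le_mul_of_nonneg_left ((norm_lowFreq_le hφ h _).trans hψ.le) (Real.sqrt_nonneg _))
    calc ‖b‖ ^ 2 ≤ (√h * √(ε / 4)) ^ 2 := by gcongr
      _ = _ := by rw [mul_pow, Real.sq_sqrt hh.le, Real.sq_sqrt (by positivity)]
  have hdn2 : ‖d‖ ^ 2 ≤ h * C ^ 2 := by
    calc ‖d‖ ^ 2 ≤ (√h * C) ^ 2 := by gcongr
      _ = _ := by rw [mul_pow, Real.sq_sqrt hh.le]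
  rw [hab]
  have hsum := ((hasSum_sq d).mul_left (2 / R ^ 2)).add ((hasSum_sq b).mul_left 2)
  have hle : ∀ n : ℤ, weight (h / R * n) * ‖(a + b) n‖ ^ 2 ≤
      2 / R ^ 2 * ‖d n‖ ^ 2 + 2 * ‖b n‖ ^ 2 := by
    intro n
    have h2 : ‖(a + b) n‖ ^ 2 ≤ 2 * ‖a n‖ ^ 2 + 2 * ‖b n‖ ^ 2 := by
      have : ‖(a + b) n‖ ≤ ‖a n‖ + ‖b n‖ := norm_add_le (a n) (b n)
      have h3 : ‖(a + b) n‖ ^ 2 ≤ (‖a n‖ + ‖b n‖) ^ 2 := by gcongr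
      nlinarith [sq_nonneg (‖a n‖ - ‖b n‖)]
    have h3 : weight (h / R * n) * ‖a n‖ ^ 2 ≤ 1 / R ^ 2 * ‖d n‖ ^ 2 := by
      calc _ ≤ (h / R * n) ^ 2 * ‖a n‖ ^ 2 := by gcongr; exact weight_le_sq _
        _ = 1 / R ^ 2 * (|h * n| * ‖a n‖) ^ 2 := by rw [mul_pow |h * (n : ℝ)|, sq_abs]; field_simp
        _ ≤ _ := by gcongr; exact hdn n
    have h4 : weight (h / R * n) * ‖b n‖ ^ 2 ≤ ‖b n‖ ^ 2 :=
      mul_le_of_le_one_left (by positivity) (weight_le_one _)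
    calc _ ≤ weight (h / R * n) * (2 * ‖a n‖ ^ 2 + 2 * ‖b n‖ ^ 2) := by
          gcongr; exact weight_nonneg _
      _ = 2 * (weight (h / R * n) * ‖a n‖ ^ 2) + 2 * (weight (h / R * n) * ‖b n‖ ^ 2) := by ring
      _ ≤ 2 * (1 / R ^ 2 * ‖d n‖ ^ 2) + 2 * ‖b n‖ ^ 2 := by gcongr
      _ = _ := by ring
  have h5 := (summable_weight_mul (a + b) fun n : ℤ => abs_weight_le_one (h / R * n)).tsum_le_tsum
    hle hsum.summable
  rw [hsum.tsum_eq] at h5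
  refine h5.trans ?_
  have h6 : 2 / R ^ 2 * ‖d‖ ^ 2 ≤ ε / 2 * h := by
    rw [div_mul_eq_mul_div, div_le_iff₀ (by positivity)]
    nlinarith [mul_le_mul_of_nonneg_left hR2 hh.le]
  linarith

/-! ### Oscillating multipliers -/

lemma memLp_top_of_measurable {m : ℝ → ℂ} (hm : Measurable m) {B : ℝ} (hB : ∀ x, ‖m x‖ ≤ B) :
    MemLp m ∞ (volume : Measure ℝ) :=
  memLp_top_of_bound hm.aestronglyMeasurable B (Filter.Eventually.of_forall hB)

lemma norm_exp_ofReal_mul_ofReal_mul_I (t b : ℝ) : ‖exp (t * b * I)‖ = 1 := by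
  rw [← ofReal_mul]
  exact norm_exp_ofReal_mul_I _

lemma memLp_top_exp {b : ℝ → ℝ} (hb : Measurable b) (t : ℝ) :
    MemLp (fun η : ℝ => exp (t * b η * I)) ∞ volume :=
  memLp_top_of_measurable (by fun_prop) fun η => (norm_exp_ofReal_mul_ofReal_mul_I t (b η)).le

/-- The unitary multiplication by `exp (i t b)`. -/
def oscillate {b : ℝ → ℝ} (hb : Measurable b) (t : ℝ) : L2R →L[ℂ] L2R :=
  multiplier _ (memLp_top_exp hb t)

lemma oscillate_ae {b : ℝ → ℝ} (hb : Measurable b) (t : ℝ) (f : L2R) :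
    oscillate hb t f =ᵐ[volume] fun η => exp (t * b η * I) * f η := multiplier_ae _ f

lemma norm_oscillate_le {b : ℝ → ℝ} (hb : Measurable b) (t : ℝ) (f : L2R) :
    ‖oscillate hb t f‖ ≤ ‖f‖ :=
  (norm_multiplier_le _ (fun η => (norm_exp_ofReal_mul_ofReal_mul_I t (b η)).le) f).trans
    (one_mul _).le

lemma memLp_top_ofReal_mul_I {b : ℝ → ℝ} (hb : Measurable b) {B : ℝ} (hB : ∀ x, |b x| ≤ B) :
    MemLp (fun η : ℝ => (b η : ℂ) * I) ∞ volume :=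
  memLp_top_of_measurable (B := B) (by fun_prop) fun η => by simpa using hB η

/-- For bounded `b` the remainder $|e^{isb}-1-isb|\le(sB)^2$ is uniform in frequency, so
differentiability holds in operator norm. -/
lemma hasDerivAt_oscillate {b : ℝ → ℝ} (hb : Measurable b) {B : ℝ} (hB : ∀ x, |b x| ≤ B) (t : ℝ) :
    HasDerivAt (oscillate hb)
      ((oscillate hb t).comp (multiplier _ (memLp_top_ofReal_mul_I hb hB))) t := by
  have hB0 : 0 ≤ B := (abs_nonneg _).trans (hB 0)
  rw [hasDerivAt_iff_isLittleO_nhds_zero]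
  refine Asymptotics.IsBigO.trans_isLittleO (g := fun s : ℝ => s ^ 2) ?_
    (Asymptotics.isLittleO_pow_id one_lt_two)
  refine Asymptotics.IsBigO.of_bound (B ^ 2) ?_
  have hs : ∀ᶠ s : ℝ in nhds 0, |s| * B ≤ 1 := by
    have : Filter.Tendsto (fun s : ℝ => |s| * B) (nhds 0) (nhds (|0| * B)) :=
      (by fun_prop : Continuous fun s : ℝ => |s| * B).tendsto 0
    rw [abs_zero, zero_mul] at this
    exact (this.eventually_lt_const one_pos).mono fun s hs => hs.le
  filter_upwards [hs] with s hs
  refine ContinuousLinearMap.opNorm_le_bound _ (by positivity) fun f => ?_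
  refine Lp.norm_le_mul_norm_of_ae_le_mul ?_
  simp only [sub_apply, smul_apply, ContinuousLinearMap.comp_apply]
  set g := multiplier _ (memLp_top_ofReal_mul_I hb hB) f with hg
  filter_upwards [Lp.coeFn_sub (oscillate hb (t + s) f - oscillate hb t f) (s • oscillate hb t g),
    Lp.coeFn_sub (oscillate hb (t + s) f) (oscillate hb t f), Lp.coeFn_smul s (oscillate hb t g),
    oscillate_ae hb (t + s) f, oscillate_ae hb t f, oscillate_ae hb t g,
    multiplier_ae (memLp_top_ofReal_mul_I hb hB) f] with η e1 e2 e3 e4 e5 e6 e7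
  rw [e1, Pi.sub_apply, e2, Pi.sub_apply, e3, Pi.smul_apply, e4, e5, e6, hg, e7]
  have h1 : exp (((t + s : ℝ) : ℂ) * b η * I) * f η - exp (t * b η * I) * f η -
      s • (exp (t * b η * I) * (b η * I * f η)) =
      exp (t * b η * I) * (exp ((s * b η : ℝ) * I) - 1 - (s * b η : ℝ) * I) * f η := by
    rw [real_smul, ofReal_add, add_mul, add_mul, exp_add]
    push_cast
    ring
  rw [h1, norm_mul, norm_mul, norm_exp_ofReal_mul_ofReal_mul_I, one_mul]
  refine mul_le_mul_of_nonneg_right ?_ (norm_nonneg _)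
  have h2 : ‖((s * b η : ℝ) : ℂ) * I‖ = |s| * |b η| := by
    rw [norm_mul, norm_I, mul_one, norm_real, Real.norm_eq_abs, abs_mul]
  have h3 : |s| * |b η| ≤ |s| * B := mul_le_mul_of_nonneg_left (hB η) (abs_nonneg s)
  refine (norm_exp_sub_one_sub_id_le (by rw [h2]; exact h3.trans hs)).trans ?_
  rw [h2, Real.norm_eq_abs, abs_pow, ← mul_pow, mul_comm B]
  gcongr

/-- The sharp frequency cutoff to `|η| ≤ K`. -/
def sharpCutoff (K : ℝ) : L2R →L[ℂ] L2R :=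
  multiplier ((Set.Icc (-K) K).indicator fun _ => 1)
    (memLp_top_of_measurable (B := 1) (measurable_const.indicator measurableSet_Icc) fun η => by
      refine (norm_indicator_le_norm_self _ _).trans ?_
      simp)

lemma sharpCutoff_ae (K : ℝ) (f : L2R) :
    sharpCutoff K f =ᵐ[volume] (Set.Icc (-K) K).indicator f := by
  filter_upwards [multiplier_ae _ f] with η h1
  rw [sharpCutoff, h1]
  by_cases hη : η ∈ Set.Icc (-K) K
  · simp [Set.indicator_of_mem hη]
  · simp [Set.indicator_of_notMem hη]

lemma norm_sharpCutoff_le (K : ℝ) (f : L2R) : ‖sharpCutoff K f‖ ≤ ‖f‖ := by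
  refine Lp.norm_le_norm_of_ae_le ?_
  filter_upwards [sharpCutoff_ae K f] with η h1
  rw [h1]
  exact norm_indicator_le_norm_self _ _

/-! ### Differences on the Fourier side -/

lemma toBand_ae_eq_zero {h : ℝ} (hh : 0 < h) (c : EllTwo) :
    ∀ᵐ η : ℝ, η ∉ band h → toBand hh c η = 0 := by
  filter_upwards [toBand_ae hh c] with η h1 hη
  rw [h1, Set.indicator_of_notMem hη]

/-- Both sides are continuous and linear in `c`, so it suffices to compare them on unit sequences,
where they are explicit exponentials. -/
lemma toBand_shift {h : ℝ} (hh : 0 < h) (k : ℤ) (c : EllTwo) :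
    toBand hh (shift k c) =ᵐ[volume] fun η : ℝ => exp (2 * Real.pi * I * (h * k) * η) *
      toBand hh c η := by
  have hm : MemLp (fun η : ℝ => exp (2 * Real.pi * I * (h * k) * η)) ∞ volume :=
    memLp_top_of_continuous (B := 1) (by fun_prop) fun η => by
      simpa using (norm_exp_mul_I_mul h k η).le
  have key : (toBand hh).comp (shift k).toContinuousLinearMap =
      (multiplier _ hm).comp (toBand hh) := by
    refine lp.ext_continuousLinearMap (by norm_num) fun m => ?_
    ext1
    change toBand hh (shift k (lp.single 2 m (1 : ℂ))) =
      multiplier _ hm (toBand hh (lp.single 2 m (1 : ℂ)))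
    have h1 : shift k (lp.single 2 m (1 : ℂ)) = lp.single 2 (m - k) (1 : ℂ) := by
      ext n
      change (lp.single 2 m (1 : ℂ) : EllTwo) (n + k) = _
      rw [lp.coeFn_single, lp.coeFn_single, Pi.single_apply, Pi.single_apply]
      simp only [eq_sub_iff_add_eq]
    rw [h1]
    refine Lp.ext ?_
    filter_upwards [toBand_single hh m, toBand_single hh (m - k),
      multiplier_ae hm (toBand hh (lp.single 2 m (1 : ℂ)))] with η e1 e2 e3
    rw [e3, e2, e1]
    by_cases hη : η ∈ band h
    · rw [Set.indicator_of_mem hη, Set.indicator_of_mem hη, ← exp_add]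
      congr 1
      push_cast
      ring
    · rw [Set.indicator_of_notMem hη, Set.indicator_of_notMem hη, mul_zero]
  have h2 := DFunLike.congr_fun key c
  change toBand hh (shift k c) = multiplier _ hm (toBand hh c) at h2
  rw [h2]
  exact multiplier_ae hm _

lemma toBand_forwardDiff {h : ℝ} (hh : 0 < h) (c : EllTwo) :
    toBand hh (forwardDiff c) =ᵐ[volume] fun η : ℝ => (exp (2 * Real.pi * I * h * η) - 1) *
      toBand hh c η := by
  have h1 : toBand hh (forwardDiff c) = toBand hh (shift 1 c) - toBand hh c := by
    rw [← map_sub]; rfl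
  filter_upwards [toBand_shift hh 1 c, Lp.coeFn_sub (toBand hh (shift 1 c)) (toBand hh c)]
    with η e1 e2
  rw [h1, e2, Pi.sub_apply, e1]
  simp [sub_mul, mul_assoc]

lemma toBand_symmetricDiff {h : ℝ} (hh : 0 < h) (c : EllTwo) :
    toBand hh (symmetricDiff c) =ᵐ[volume] fun η : ℝ =>
      ((2 * Real.sin (2 * Real.pi * h * η) : ℝ) : ℂ) * I * toBand hh c η := by
  have h1 : toBand hh (symmetricDiff c) = toBand hh (shift 1 c) - toBand hh (shift (-1) c) := by
    rw [← map_sub]; rfl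
  filter_upwards [toBand_shift hh 1 c, toBand_shift hh (-1) c,
    Lp.coeFn_sub (toBand hh (shift 1 c)) (toBand hh (shift (-1) c))] with η e1 e2 e3
  rw [h1, e3, Pi.sub_apply, e1, e2, ← sub_mul]
  congr 1
  push_cast
  rw [two_sin, mul_assoc _ I I, I_mul_I]
  ring_nf

/-- The part of the `L²` norm at high frequencies is controlled by the difference quotient. -/
lemma norm_sub_sharpCutoff_le {h : ℝ} (hh : 0 < h) {K : ℝ} (hK : 0 < K) {b : ℝ → ℝ}
    (hb : Measurable b) (t : ℝ) (c : EllTwo) :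
    ‖oscillate hb t (toBand hh c) - sharpCutoff K (oscillate hb t (toBand hh c))‖ ≤
      1 / (4 * h * K) * (‖forwardDiff c‖ / √h) := by
  rw [← norm_toBand hh]
  refine Lp.norm_le_mul_norm_of_ae_le_mul ?_
  filter_upwards [Lp.coeFn_sub (oscillate hb t (toBand hh c))
    (sharpCutoff K (oscillate hb t (toBand hh c))), oscillate_ae hb t (toBand hh c),
    sharpCutoff_ae K (oscillate hb t (toBand hh c)), toBand_forwardDiff hh c,
    toBand_ae_eq_zero hh c] with η e1 e2 e3 e4 e5
  rw [e1, Pi.sub_apply, e3]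
  by_cases hη : η ∈ Set.Icc (-K) K
  · rw [Set.indicator_of_mem hη, sub_self, norm_zero]
    positivity
  rw [Set.indicator_of_notMem hη, sub_zero, e2, norm_mul, norm_exp_ofReal_mul_ofReal_mul_I, one_mul,
    e4, norm_mul]
  by_cases hηb : η ∈ band h
  · rw [← mul_assoc]
    refine le_mul_of_one_le_left (norm_nonneg _) ?_
    rw [div_mul_eq_mul_div, one_mul, one_le_div (by positivity),
      show 2 * Real.pi * I * h * η = I * ((2 * Real.pi * h * η : ℝ) : ℂ) by push_cast; ring,
      norm_exp_I_mul_ofReal_sub_one, norm_mul, Real.norm_eq_abs, Real.norm_eq_abs,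
      abs_of_pos two_pos]
    rw [band, Set.mem_Icc, ← abs_le, le_div_iff₀ (by positivity)] at hηb
    rw [Set.mem_Icc, ← abs_le, not_le] at hη
    have h0 : |2 * Real.pi * h * η / 2| = Real.pi * h * |η| := by
      rw [show 2 * Real.pi * h * η / 2 = Real.pi * h * η by ring, abs_mul,
        abs_of_pos (by positivity)]
    -- On the band $|\pi h\eta|\le\pi/2$, so Jordan's inequality gives $|e^{2\pi
    -- ih\eta}-1|=2|\sin(\pi h\eta)|\ge4h|\eta|\ge4hK$.
    have h1 := Real.mul_abs_le_abs_sin (x := 2 * Real.pi * h * η / 2) (by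
      rw [h0]
      nlinarith [Real.pi_pos])
    rw [h0] at h1
    have h2 : 2 / Real.pi * (Real.pi * h * |η|) = 2 * h * |η| := by
      have := Real.pi_ne_zero
      field_simp
    rw [h2] at h1
    nlinarith
  · rw [e5 hηb]; simp

/-! ### Slow evolution in the interaction picture -/

/-- The phase compensating the translation of speed two. -/
def transportPhase (h η : ℝ) : ℝ := 4 * Real.pi * h * η

lemma measurable_transportPhase (h : ℝ) : Measurable (transportPhase h) := by
  unfold transportPhase
  fun_prop

/-- The Fourier transform of the interpolated sequence, seen in the moving frame. -/
def moving {h : ℝ} (hh : 0 < h) (a : ℝ → EllTwo) (t : ℝ) : L2R :=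
  oscillate (measurable_transportPhase h) t (toBand hh (a t))

lemma measurable_truncPhase (h K : ℝ) :
    Measurable ((Set.Icc (-K) K).indicator (transportPhase h)) :=
  (measurable_transportPhase h).indicator measurableSet_Icc

lemma abs_truncPhase_le {h : ℝ} (hh : 0 < h) {K : ℝ} (hK : 0 < K) (η : ℝ) :
    |(Set.Icc (-K) K).indicator (transportPhase h) η| ≤ 4 * Real.pi * h * K := by
  have hpi := Real.pi_pos
  by_cases hη : η ∈ Set.Icc (-K) K
  · rw [Set.indicator_of_mem hη, transportPhase, abs_mul, abs_of_pos (by positivity)]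
    rw [Set.mem_Icc, ← abs_le] at hη
    gcongr
  · rw [Set.indicator_of_notMem hη, abs_zero]
    positivity

/-- Below the cutoff the unbounded `transportPhase` may be replaced by its truncation, to which
`hasDerivAt_oscillate` applies. -/
lemma sharpCutoff_oscillate_congr {b b' : ℝ → ℝ} (hb : Measurable b) (hb' : Measurable b') {K : ℝ}
    (h : ∀ η ∈ Set.Icc (-K) K, b η = b' η) (t : ℝ) (f : L2R) :
    sharpCutoff K (oscillate hb t f) = sharpCutoff K (oscillate hb' t f) := by
  refine Lp.ext ?_
  filter_upwards [sharpCutoff_ae K (oscillate hb t f), sharpCutoff_ae K (oscillate hb' t f),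
    oscillate_ae hb t f, oscillate_ae hb' t f] with η e1 e2 e3 e4
  rw [e1, e2]
  by_cases hη : η ∈ Set.Icc (-K) K
  · rw [Set.indicator_of_mem hη, Set.indicator_of_mem hη, e3, e4, h η hη]
  · rw [Set.indicator_of_notMem hη, Set.indicator_of_notMem hη]

lemma norm_fieldSeq_add_le {σ : ℝ} (hσ : |σ| ≤ 1) (c : EllTwo) :
    ‖fieldSeq σ c + symmetricDiff c‖ ≤ 4 * ‖c‖ * ‖forwardDiff c‖ ^ 2 := by
  have h1 : ‖fieldSeq σ c + symmetricDiff c‖ ≤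
      2 * ‖c‖ * ‖forwardDiff c‖ * ‖symmetricDiff c‖ := by
    refine norm_le_of_norm_apply_le_mul (by positivity) fun n => ?_
    rw [lp.coeFn_add, Pi.add_apply, fieldSeq_apply hσ, mALField, symmetricDiff_apply,
      show -(1 - c n * ((σ : ℂ) * conj (c n : ℂ))) * (c (n + 1) - c (n - 1)) +
        (c (n + 1) - c (n - 1)) = c n * ((σ : ℂ) * conj (c n : ℂ)) * (c (n + 1) - c (n - 1)) by
        ring, norm_mul]
    gcongr
    rw [norm_mul, norm_mul, norm_conj, norm_real, Real.norm_eq_abs]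
    have h2 := sq_apply_le c n
    have h3 := mul_le_mul_of_nonneg_right hσ (sq_nonneg ‖c n‖)
    nlinarith
  refine h1.trans ((mul_le_mul_of_nonneg_left (norm_symmetricDiff_le_forwardDiff c)
    (by positivity)).trans (le_of_eq (by ring)))

/-- At low frequencies the interpolated solution in the moving frame evolves slowly: the symbol
of the linear part vanishes to third order and the nonlinear part is quadratic in the
difference quotient. -/
lemma norm_sharpCutoff_moving_sub_le {σ : ℝ} (hσ : |σ| ≤ 1) {a : ℝ → EllTwo}
    (ha : ∀ t, HasDerivAt a (fieldSeq σ (a t)) t) {A E : ℝ} (hA : ∀ t, ‖a t‖ ≤ A)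
    (hE : ∀ t, ‖forwardDiff (a t)‖ ≤ E) {h : ℝ} (hh : 0 < h) {K : ℝ} (hK : 0 < K) (t s : ℝ) :
    ‖sharpCutoff K (moving hh a t) - sharpCutoff K (moving hh a s)‖ ≤
      ((2 * Real.pi * h * K) ^ 3 * (A / √h) + 4 * A * E ^ 2 / √h) * |t - s| := by
  have hA0 : 0 ≤ A := (norm_nonneg _).trans (hA 0)
  have hE0 : 0 ≤ E := (norm_nonneg _).trans (hE 0)
  have hpi := Real.pi_pos
  set b := (Set.Icc (-K) K).indicator (transportPhase h) with hb
  have hbm : Measurable b := measurable_truncPhase h K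
  have hbB := abs_truncPhase_le hh hK
  set m := multiplier _ (memLp_top_ofReal_mul_I hbm hbB) with hm
  set F : ℝ → L2R := fun t => sharpCutoff K (oscillate hbm t (toBand hh (a t))) with hF
  have hFm : ∀ t, sharpCutoff K (moving hh a t) = F t := fun t =>
    sharpCutoff_oscillate_congr _ _ (fun η hη => by rw [hb, Set.indicator_of_mem hη]) t _
  have hFd : ∀ t, HasDerivAt F (sharpCutoff K (oscillate hbm t (m (toBand hh (a t)) +
      toBand hh (fieldSeq σ (a t))))) t := by
    intro t
    have h1 := ((toBand hh).restrictScalars ℝ).hasFDerivAt.comp_hasDerivAt t (ha t)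
    have h2 := ((ContinuousLinearMap.restrictScalarsL ℂ L2R L2R ℝ ℝ).hasFDerivAt.comp_hasDerivAt t
      (hasDerivAt_oscillate hbm hbB t)).clm_apply h1
    have h3 := ((sharpCutoff K).restrictScalars ℝ).hasFDerivAt.comp_hasDerivAt t h2
    refine h3.congr_deriv ?_
    rw [map_add (oscillate hbm t)]
    rfl
  have hbound : ∀ t, ‖sharpCutoff K (oscillate hbm t (m (toBand hh (a t)) +
      toBand hh (fieldSeq σ (a t))))‖ ≤
      (2 * Real.pi * h * K) ^ 3 * (A / √h) + 4 * A * E ^ 2 / √h := by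
    intro t
    set w := toBand hh (a t) with hw
    set g := fieldSeq σ (a t) + symmetricDiff (a t) with hg
    -- The linear part of the field is added and subtracted: the first term has symbol $4\pi
    -- h\eta-2\sin(2\pi h\eta)$, the second is purely nonlinear.
    have h1 : m w + toBand hh (fieldSeq σ (a t)) =
        (m w - toBand hh (symmetricDiff (a t))) + toBand hh g := by
      rw [hg, map_add]; abel
    rw [h1, map_add, map_add]
    refine (norm_add_le _ _).trans (add_le_add ?_ ?_)
    · have h2 : ‖sharpCutoff K (oscillate hbm t (m w - toBand hh (symmetricDiff (a t))))‖ ≤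
          (2 * Real.pi * h * K) ^ 3 * ‖w‖ := by
        refine Lp.norm_le_mul_norm_of_ae_le_mul ?_
        filter_upwards [sharpCutoff_ae K
          (oscillate hbm t (m w - toBand hh (symmetricDiff (a t)))),
          oscillate_ae hbm t (m w - toBand hh (symmetricDiff (a t))),
          Lp.coeFn_sub (m w) (toBand hh (symmetricDiff (a t))),
          multiplier_ae (memLp_top_ofReal_mul_I hbm hbB) w, toBand_symmetricDiff hh (a t)]
          with η e1 e2 e3 e4 e5
        rw [e1]
        by_cases hη : η ∈ Set.Icc (-K) K
        · rw [Set.indicator_of_mem hη, e2, e3, Pi.sub_apply, hm, e4, e5, norm_mul,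
            norm_exp_ofReal_mul_ofReal_mul_I, one_mul, ← sub_mul, ← sub_mul, ← ofReal_sub, norm_mul,
            norm_mul, norm_I, mul_one, norm_real, Real.norm_eq_abs]
          refine mul_le_mul_of_nonneg_right ?_ (norm_nonneg _)
          rw [hb, Set.indicator_of_mem hη, transportPhase,
            show 4 * Real.pi * h * η - 2 * Real.sin (2 * Real.pi * h * η) =
              2 * (2 * Real.pi * h * η - Real.sin (2 * Real.pi * h * η)) by ring, abs_mul,
            abs_of_pos two_pos]
          have h3 := Real.abs_sub_sin_le (2 * Real.pi * h * η)
          rw [Set.mem_Icc, ← abs_le] at hη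
          have h4 : |2 * Real.pi * h * η| ^ 3 ≤ (2 * Real.pi * h * K) ^ 3 := by
            rw [abs_mul, abs_of_pos (by positivity)]
            gcongr
          have h5 : 0 ≤ |2 * Real.pi * h * η| ^ 3 := by positivity
          linarith
        · rw [Set.indicator_of_notMem hη, norm_zero]
          positivity
      refine h2.trans ?_
      rw [hw, norm_toBand]
      gcongr
      exact hA t
    · refine (norm_sharpCutoff_le K _).trans ((norm_oscillate_le hbm t _).trans ?_)
      rw [norm_toBand]
      gcongr
      refine (norm_fieldSeq_add_le hσ (a t)).trans ?_
      gcongr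
      · exact hA t
      · exact hE t
  rw [hFm, hFm, ← Real.norm_eq_abs]
  exact convex_univ.norm_image_sub_le_of_norm_hasDerivWithin_le
    (fun r _ => (hFd r).hasDerivWithinAt) (fun r _ => hbound r) (Set.mem_univ s) (Set.mem_univ t)

/-! ### Spatial truncation -/

/-- The indices `n` with `|h (n - 2 t)| ≤ L`. -/
def window (h L t : ℝ) : Finset ℤ := Finset.Icc ⌈2 * t - L / h⌉ ⌊2 * t + L / h⌋

lemma mem_window {h L : ℝ} (hh : 0 < h) (t : ℝ) (n : ℤ) :
    n ∈ window h L t ↔ |h * (n - 2 * t)| ≤ L := by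
  rw [window, Finset.mem_Icc, Int.ceil_le, Int.le_floor, abs_mul, abs_of_pos hh, ← le_div_iff₀' hh,
    abs_le]
  constructor <;> rintro ⟨h1, h2⟩ <;> constructor <;> linarith

lemma card_window_le {h L : ℝ} (hh : 0 < h) (hL : 0 ≤ L) (t : ℝ) :
    ((window h L t).card : ℝ) ≤ 2 * L / h + 1 := by
  rw [window, Int.card_Icc]
  have h0 : 0 ≤ L / h := by positivity
  have h1 := Int.floor_le (2 * t + L / h)
  have h2 := Int.le_ceil (2 * t - L / h)
  have h3 : 0 ≤ 2 * L / h + 1 := by positivity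
  rcases le_total 0 (⌊2 * t + L / h⌋ + 1 - ⌈2 * t - L / h⌉) with h4 | h4
  · have h5 : (((⌊2 * t + L / h⌋ + 1 - ⌈2 * t - L / h⌉).toNat : ℤ) : ℝ) =
        ((⌊2 * t + L / h⌋ + 1 - ⌈2 * t - L / h⌉ : ℤ) : ℝ) := by rw [Int.toNat_of_nonneg h4]
    rw [Int.cast_natCast] at h5
    rw [h5]
    push_cast
    rw [mul_div_assoc]
    linarith
  · rw [Int.toNat_of_nonpos h4]
    simpa using h3

/-- Restriction of a sequence to finitely many indices. -/
def truncate (S : Finset ℤ) (c : EllTwo) : EllTwo := ∑ n ∈ S, lp.single 2 n (c n)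

lemma norm_sub_truncate_sq (S : Finset ℤ) (c : EllTwo) :
    ‖c - truncate S c‖ ^ 2 = ‖c‖ ^ 2 - ∑ n ∈ S, ‖c n‖ ^ 2 := by
  have := lp.norm_compl_sum_single (p := 2) (by norm_num) c S
  simpa [truncate] using this

/-- Outside the window the weight is at least $1/2$, whence the factor $2$. -/
lemma norm_sub_truncate_window_le {h L : ℝ} (hh : 0 < h) (hL : 0 < L) (t : ℝ) (c : EllTwo) :
    ‖c - truncate (window h L t) c‖ ^ 2 ≤
      2 * ∑' n : ℤ, weight (h / L * (n - 2 * t)) * ‖c n‖ ^ 2 := by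
  rw [norm_sub_truncate_sq, ← tsum_mul_left]
  have h1 : HasSum (fun n => (window h L t : Set ℤ).indicator (fun n => ‖c n‖ ^ 2) n)
      (∑ n ∈ window h L t, ‖c n‖ ^ 2) := by
    have := hasSum_sum_of_ne_finset_zero (s := window h L t) (L := SummationFilter.unconditional ℤ)
      (f := fun n => (window h L t : Set ℤ).indicator (fun n => ‖c n‖ ^ 2) n)
      (fun n hn => Set.indicator_of_notMem (by simpa using hn) _)
    rwa [Finset.sum_congr rfl fun n hn => Set.indicator_of_mem (by simpa using hn) _] at this
  refine hasSum_le (fun n => ?_) ((hasSum_sq c).sub h1) ((summable_weight_mul c fun n : ℤ =>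
    abs_weight_le_one (h / L * (n - 2 * t))).mul_left 2).hasSum
  have h0 := weight_nonneg (h / L * (n - 2 * t))
  by_cases hn : n ∈ window h L t
  · rw [Set.indicator_of_mem (by simpa using hn), sub_self]
    positivity
  · rw [Set.indicator_of_notMem (by simpa using hn), sub_zero]
    rw [mem_window hh, not_le] at hn
    have h2 : 1 ≤ |h / L * (n - 2 * t)| := by
      rw [div_mul_eq_mul_div, abs_div, abs_of_pos hL, one_le_div hL]
      exact hn.le
    have h3 := half_le_weight h2
    nlinarith [sq_nonneg ‖c n‖]

lemma toBand_truncate {h : ℝ} (hh : 0 < h) (S : Finset ℤ) (c : EllTwo) :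
    toBand hh (truncate S c) =ᵐ[volume] (band h).indicator fun η : ℝ =>
      ∑ n ∈ S, c n * exp (-(2 * Real.pi * I * (h * n) * η)) := by
  unfold truncate
  induction S using Finset.induction_on with
  | empty =>
    simp only [Finset.sum_empty, map_zero]
    filter_upwards [Lp.coeFn_zero ℂ 2 (volume : Measure ℝ)] with η h1
    rw [h1]
    simp
  | insert m S hm ih =>
    rw [Finset.sum_insert hm, map_add]
    have h1 : lp.single 2 m (c m) = c m • (lp.single 2 m (1 : ℂ) : EllTwo) := by
      rw [← lp.single_smul]
      simp
    rw [h1, map_smul]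
    filter_upwards [ih, toBand_single hh m,
      Lp.coeFn_add (c m • toBand hh (lp.single 2 m (1 : ℂ)))
        (toBand hh (∑ n ∈ S, lp.single 2 n (c n))),
      Lp.coeFn_smul (c m) (toBand hh (lp.single 2 m (1 : ℂ)))] with η e1 e2 e3 e4
    rw [e3, Pi.add_apply, e4, e1, Pi.smul_apply, e2]
    by_cases hη : η ∈ band h
    · simp only [Set.indicator_of_mem hη]
      rw [Finset.sum_insert hm, smul_eq_mul]
    · simp only [Set.indicator_of_notMem hη]
      simp

/-- A trigonometric polynomial in the frequency, with the phases seen in the moving frame. -/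
def movingSum (h t : ℝ) (S : Finset ℤ) (c : ℤ → ℂ) (η : ℝ) : ℂ :=
  ∑ n ∈ S, c n * exp (((-(2 * Real.pi * (h * (n - 2 * t))) * η : ℝ) : ℂ) * I)

lemma sum_norm_le (S : Finset ℤ) (c : EllTwo) : ∑ n ∈ S, ‖c n‖ ≤ √S.card * ‖c‖ := by
  have h1 := sq_sum_le_card_mul_sum_sq (s := S) (f := fun n => ‖c n‖)
  have h2 : ∑ n ∈ S, ‖c n‖ ^ 2 ≤ ‖c‖ ^ 2 := sum_le_hasSum S (fun n _ => by positivity) (hasSum_sq c)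
  have h3 : (∑ n ∈ S, ‖c n‖) ^ 2 ≤ (√S.card * ‖c‖) ^ 2 := by
    rw [mul_pow, Real.sq_sqrt (by positivity)]
    exact h1.trans (by gcongr)
  exact (sq_le_sq₀ (by positivity) (by positivity)).mp h3

lemma norm_movingSum_le (h t : ℝ) (S : Finset ℤ) (c : ℤ → ℂ) (η : ℝ) :
    ‖movingSum h t S c η‖ ≤ ∑ n ∈ S, ‖c n‖ := by
  refine (norm_sum_le _ _).trans (Finset.sum_le_sum fun n _ => ?_)
  rw [norm_mul, norm_exp_ofReal_mul_I, mul_one]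

lemma norm_exp_mul_I_sub_le (x y : ℝ) : ‖exp (x * I) - exp (y * I)‖ ≤ |x - y| := by
  have h1 : exp (x * I) - exp (y * I) = exp (y * I) * (exp (I * ((x - y : ℝ) : ℂ)) - 1) := by
    rw [mul_sub, ← exp_add, mul_one]
    congr 2
    push_cast
    ring
  rw [h1, norm_mul, norm_exp_ofReal_mul_I, one_mul]
  exact Real.norm_exp_I_mul_ofReal_sub_one_le

/-- In the moving frame the phases are $2\pi h(n-2t)\eta$ with $|h(n-2t)|\le L$ on the window. The
Lipschitz constant thus does not see that $n$ itself may be as large as $t$. -/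
lemma norm_movingSum_sub_le {h L : ℝ} (hh : 0 < h) (t : ℝ) (c : ℤ → ℂ) (x y : ℝ) :
    ‖movingSum h t (window h L t) c x - movingSum h t (window h L t) c y‖ ≤
      (2 * Real.pi * L * ∑ n ∈ window h L t, ‖c n‖) * |x - y| := by
  rw [movingSum, movingSum, ← Finset.sum_sub_distrib, Finset.mul_sum, Finset.sum_mul]
  refine (norm_sum_le _ _).trans (Finset.sum_le_sum fun n hn => ?_)
  rw [mem_window hh] at hn
  rw [← mul_sub, norm_mul]
  have h1 := norm_exp_mul_I_sub_le (-(2 * Real.pi * (h * (n - 2 * t))) * x)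
    (-(2 * Real.pi * (h * (n - 2 * t))) * y)
  rw [← mul_sub, abs_mul, abs_neg, abs_mul, abs_of_pos Real.two_pi_pos] at h1
  have hpi := Real.pi_pos
  calc _ ≤ ‖c n‖ * (2 * Real.pi * |h * (n - 2 * t)| * |x - y|) := by gcongr
    _ ≤ ‖c n‖ * (2 * Real.pi * L * |x - y|) := by gcongr
    _ = _ := by ring

lemma sharpCutoff_oscillate_truncate_ae {h : ℝ} (hh : 0 < h) (K t : ℝ) (S : Finset ℤ)
    (c : EllTwo) :
    sharpCutoff K (oscillate (measurable_transportPhase h) t (toBand hh (truncate S c)))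
      =ᵐ[volume] (Set.Icc (-(min K (1 / (2 * h)))) (min K (1 / (2 * h)))).indicator
        (movingSum h t S c) := by
  filter_upwards [sharpCutoff_ae K
      (oscillate (measurable_transportPhase h) t (toBand hh (truncate S c))),
    oscillate_ae (measurable_transportPhase h) t (toBand hh (truncate S c)),
    toBand_truncate hh S c] with η e1 e2 e3
  have hset : Set.Icc (-(min K (1 / (2 * h)))) (min K (1 / (2 * h))) =
      Set.Icc (-K) K ∩ band h := by
    rw [band, Set.Icc_inter_Icc, ← max_neg_neg]
  rw [e1, hset]
  by_cases h1 : η ∈ Set.Icc (-K) K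
  · by_cases h2 : η ∈ band h
    · rw [Set.indicator_of_mem h1, e2, e3, Set.indicator_of_mem h2, Set.indicator_of_mem (Set.mem_inter h1 h2),
        movingSum, Finset.mul_sum]
      refine Finset.sum_congr rfl fun n _ => ?_
      rw [mul_left_comm, ← exp_add]
      congr 2
      rw [transportPhase]
      push_cast
      ring
    · rw [Set.indicator_of_mem h1, e2, e3, Set.indicator_of_notMem h2,
        Set.indicator_of_notMem fun h => h2 h.2, mul_zero]
  · rw [Set.indicator_of_notMem h1, Set.indicator_of_notMem fun h => h1 h.1]

/-- In the moving frame, a sequence with small tails and small difference quotient is close to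
a band-limited, bounded and Lipschitz function of frequency. -/
lemma exists_band_approx {h L K : ℝ} (hh : 0 < h) (hL : 0 < L) (hK : 0 < K) (t : ℝ) (c : EllTwo)
    {B : ℝ} (hB : √(2 * L / h + 1) * ‖c‖ ≤ B) {C : NNReal} (hC : 2 * Real.pi * L * B ≤ C) :
    ∃ f ∈ {f : L2R | ∃ G : ℝ → ℂ, ∃ κ ∈ Set.Icc 0 K, (∀ x, ‖G x‖ ≤ B) ∧ LipschitzWith C G ∧
      f =ᵐ[volume] (Set.Icc (-κ) κ).indicator G},
      ‖oscillate (measurable_transportPhase h) t (toBand hh c) - f‖ ≤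
        1 / (4 * h * K) * (‖forwardDiff c‖ / √h) +
          √(2 * ∑' n : ℤ, weight (h / L * (n - 2 * t)) * ‖c n‖ ^ 2) / √h := by
  set S := window h L t with hS
  set O := oscillate (measurable_transportPhase h) t with hO
  have hsum : ∑ n ∈ S, ‖c n‖ ≤ B := by
    refine (sum_norm_le S c).trans (le_trans ?_ hB)
    gcongr
    exact card_window_le hh hL.le t
  -- The transform lives on the intersection of $|\eta|\le K$ with the band, so the edge is `min K
  -- (1 / (2 * h))`.
  refine ⟨sharpCutoff K (O (toBand hh (truncate S c))), ⟨movingSum h t S c, min K (1 / (2 * h)),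
    ⟨by positivity, min_le_left _ _⟩, fun x => (norm_movingSum_le h t S c x).trans hsum,
    LipschitzWith.of_dist_le_mul fun x y => ?_, sharpCutoff_oscillate_truncate_ae hh K t S c⟩, ?_⟩
  · rw [dist_eq_norm, Real.dist_eq]
    refine (norm_movingSum_sub_le hh t c x y).trans ?_
    gcongr
    refine le_trans ?_ hC
    have := Real.pi_pos
    gcongr
  · rw [← sub_add_sub_cancel _ (sharpCutoff K (O (toBand hh c)))]
    refine (norm_add_le _ _).trans (add_le_add (norm_sub_sharpCutoff_le hh hK _ t c) ?_)
    rw [← map_sub, ← map_sub, ← map_sub]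
    refine (norm_sharpCutoff_le K _).trans ((norm_oscillate_le _ t _).trans ?_)
    rw [norm_toBand]
    gcongr
    exact Real.le_sqrt_of_sq_le (norm_sub_truncate_window_le hh hL t c)

section

/-! ### The continuum representative -/

lemma integrable_moving {h : ℝ} (hh : 0 < h) (a : ℝ → EllTwo) (t : ℝ) :
    Integrable (moving hh a t) := by
  have : IsFiniteMeasure (volume.restrict (band h)) := ⟨by simp [band]⟩
  have h1 : IntegrableOn (moving hh a t) (band h) :=
    ((Lp.memLp (moving hh a t)).restrict _).integrable (q := 2) (by norm_num)
  refine (h1.integrable_indicator (measurableSet_band h)).congr ?_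
  filter_upwards [oscillate_ae (measurable_transportPhase h) t (toBand hh (a t)),
    toBand_ae_eq_zero hh (a t)] with η e1 e2
  by_cases hη : η ∈ band h
  · rw [Set.indicator_of_mem hη]
  · rw [Set.indicator_of_notMem hη, moving, e1, e2 hη, mul_zero]

lemma interp_eq {h : ℝ} (hh : 0 < h) (c : EllTwo) (y : ℝ) :
    interp h c y = ∫ η in band h, exp ((2 * Real.pi * (y * η) : ℝ) * I) *
      seqHat c (2 * Real.pi * h * η) := by
  have hpi := Real.pi_pos
  have h1 := intervalIntegral.integral_comp_mul_left (a := -(1 / (2 * h))) (b := 1 / (2 * h))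
    (fun θ : ℝ => exp (I * y * θ / h) * seqHat c θ / (2 * Real.pi))
    (c := 2 * Real.pi * h) (by positivity)
  have h2 : 2 * Real.pi * h * (1 / (2 * h)) = Real.pi := by field_simp
  rw [mul_neg, h2] at h1
  have h3 := (inv_smul_eq_iff₀ (by positivity : 2 * Real.pi * h ≠ 0)).mp h1.symm
  have h0 : -(1 / (2 * h)) ≤ 1 / (2 * h) := by
    have : 0 ≤ 1 / (2 * h) := by positivity
    linarith
  have hpc : (Real.pi : ℂ) ≠ 0 := by exact_mod_cast Real.pi_ne_zero
  have hhc : (h : ℂ) ≠ 0 := by exact_mod_cast hh.ne'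
  rw [interp, h3, intervalIntegral.integral_of_le h0, ← integral_Icc_eq_integral_Ioc, ← band,
    ← integral_smul, ← integral_const_mul]
  refine integral_congr_ae (Filter.Eventually.of_forall fun η => ?_)
  simp only
  have h4 : I * y * ((2 * Real.pi * h * η : ℝ) : ℂ) / h = ((2 * Real.pi * (y * η) : ℝ) : ℂ) * I := by
    push_cast
    field_simp
  rw [h4, real_smul]
  push_cast
  field_simp

/-- At time $3t/h^3$ the transport phase is $4\pi h\eta\cdot3t/h^3=2\pi\eta\cdot6t/h^2$, which is
exactly the translation in `continuumRep`. -/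
lemma fourierInv_moving_ae {h : ℝ} (hh : 0 < h) (a : ℝ → EllTwo) (t : ℝ) :
    ((𝓕⁻ (moving hh a (3 * t / h ^ 3)) : L2R) : ℝ → ℂ) =ᵐ[volume] continuumRep h a t := by
  refine (fourierInv_ae_eq _ (integrable_moving hh a _)).trans
    (Filter.Eventually.of_forall fun x => ?_)
  rw [Real.fourierInv_eq', continuumRep, interp_eq hh, ← integral_indicator (measurableSet_band h)]
  refine integral_congr_ae ?_
  filter_upwards [oscillate_ae (measurable_transportPhase h) (3 * t / h ^ 3)
    (toBand hh (a (3 * t / h ^ 3))), toBand_ae hh (a (3 * t / h ^ 3))] with η e1 e2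
  rw [moving, e1, e2]
  by_cases hη : η ∈ band h
  · rw [Set.indicator_of_mem hη, Set.indicator_of_mem hη, smul_eq_mul, ← mul_assoc, ← exp_add]
    congr 2
    have hhc : (h : ℂ) ≠ 0 := by exact_mod_cast hh.ne'
    rw [transportPhase]
    simp only [RCLike.inner_apply, conj_trivial]
    push_cast
    field_simp
    ring
  · rw [Set.indicator_of_notMem hη, Set.indicator_of_notMem hη, mul_zero, smul_zero]

/-! ### Compactness of equicontinuous families of curves -/

lemma exists_curves_isCompact_closure {ι X : Type*} [NormedAddCommGroup X] [CompleteSpace X]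
    (T : ℝ) (v : ι → ℝ → X)
    (htb : TotallyBounded {x | ∃ i, ∃ t ∈ Set.Icc (-T) T, v i t = x})
    (heq : ∀ ε > 0, ∃ δ > 0, ∀ i s t, |t - s| < δ → ‖v i t - v i s‖ < ε) :
    ∃ Φ : ι → C(Set.Icc (-T) T, X), (∀ i t, Φ i t = v i t) ∧
      IsCompact (closure (Set.range Φ)) := by
  have hcont : ∀ i, Continuous (v i) := fun i => by
    rw [Metric.continuous_iff]
    intro s ε hε
    obtain ⟨δ, hδ, h⟩ := heq ε hε
    exact ⟨δ, hδ, fun t ht => by simpa [dist_eq_norm] using h i s t (by simpa [Real.dist_eq] using ht)⟩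
  set Φ : ι → C(Set.Icc (-T) T, X) := fun i =>
    ⟨fun t => v i t, (hcont i).comp continuous_subtype_val⟩
  refine ⟨Φ, fun _ _ => rfl, ?_⟩
  set e := ContinuousMap.isometryEquivBoundedOfCompact (Set.Icc (-T) T) X
  have hc : IsCompact (closure (e '' Set.range Φ)) := by
    refine BoundedContinuousFunction.arzela_ascoli (closure {x | ∃ i, ∃ t ∈ Set.Icc (-T) T, v i t = x})
      (isCompact_iff_totallyBounded_isComplete.mpr ⟨htb.closure, isClosed_closure.isComplete⟩) _ ?_ ?_
    · rintro f t ⟨_, ⟨i, rfl⟩, rfl⟩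
      exact subset_closure ⟨i, t, t.2, rfl⟩
    · refine UniformEquicontinuous.equicontinuous ?_
      rw [Metric.uniformEquicontinuous_iff]
      intro ε hε
      obtain ⟨δ, hδ, h⟩ := heq ε hε
      refine ⟨δ, hδ, fun s t hst f => ?_⟩
      obtain ⟨f, _, ⟨i, rfl⟩, rfl⟩ := f
      rw [dist_comm, dist_eq_norm]
      exact h i s t (by rwa [dist_comm, Subtype.dist_eq, Real.dist_eq] at hst)
  rw [← e.toHomeomorph.isCompact_image, Homeomorph.image_closure]
  exact hc

/-! ### Uniform bounds -/

/-- The bounds, uniform in the step `h`, on the solution issuing from a fixed `H¹` function. -/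
structure HasUniformBounds (σ A E h : ℝ) (a : ℝ → EllTwo) : Prop where
  isSmallSolution : IsSmallSolution σ a
  norm_le : ∀ t, ‖a t‖ ≤ √h * A
  norm_forwardDiff_le : ∀ t, ‖forwardDiff (a t)‖ ≤ √h * (h * E)

lemma hZero_spec {φ₀ : L2R} {h : ℝ} (hh : h ∈ Set.Ioc 0 (hZero φ₀)) :
    h ≤ 1 ∧ h * ‖φ₀‖ ^ 2 ≤ 1 / 100 := by
  obtain ⟨h0, h1⟩ := hh
  rw [hZero] at h1
  split_ifs at h1 with h2
  · rw [h2, norm_zero]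
    exact ⟨h1, by norm_num⟩
  · have h3 : 0 < ‖φ₀‖ := norm_pos_iff.mpr h2
    refine ⟨h1.trans (min_le_left _ _), ?_⟩
    have h4 := h1.trans (min_le_right _ _)
    rw [le_div_iff₀ (by positivity)] at h4
    linarith

variable {σ : ℝ} {φ : ℝ → ℂ} {φ₀ : L2R} {h : ℝ}

lemma norm_initial_le (hφ : IsLowFrequencyCutoff φ) (hh : 0 < h) :
    ‖sample hh (lowFreq hφ h (𝓕 φ₀ : L2R))‖ ≤ √h * ‖φ₀‖ := by
  refine (norm_sample_le hh _).trans ?_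
  gcongr
  refine (norm_lowFreq_le hφ h _).trans ?_
  rw [Lp.norm_fourier_eq]

lemma norm_initial_sq_le (hφ : IsLowFrequencyCutoff φ) (hh : 0 < h) :
    ‖sample hh (lowFreq hφ h (𝓕 φ₀ : L2R))‖ ^ 2 ≤ h * ‖φ₀‖ ^ 2 := by
  refine (pow_le_pow_left₀ (norm_nonneg _) (norm_initial_le hφ hh) 2).trans ?_
  rw [mul_pow, Real.sq_sqrt hh.le]

lemma exists_isGlobalSolution (hσ : |σ| ≤ 1) (hφ : IsLowFrequencyCutoff φ)
    (hh : h ∈ Set.Ioc 0 (hZero φ₀)) :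
    ∃ a, IsGlobalSolution σ φ φ₀ h a ∧ ∀ t, ‖a t‖ ^ 2 ≤ 5 / 3 * (h * ‖φ₀‖ ^ 2) := by
  have h1 := norm_initial_sq_le (φ₀ := φ₀) hφ hh.1
  obtain ⟨a, hac, ha0, han, had⟩ := exists_solution hσ
    (sample hh.1 (lowFreq hφ h (𝓕 φ₀ : L2R))) (by linarith [(hZero_spec hh).2])
  refine ⟨a, ⟨hac, had, fun n => ?_⟩, fun t => (han t).trans (by gcongr)⟩
  rw [ha0, sample_lowFreq hφ hh.1]

lemma IsGlobalSolution.unique (hσ : |σ| ≤ 1) {a b : ℝ → EllTwo}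
    (ha : IsGlobalSolution σ φ φ₀ h a) (hb : IsGlobalSolution σ φ φ₀ h b) : a = b :=
  solution_unique hσ ha.continuous ha.hasDerivAt hb.continuous hb.hasDerivAt
    (lp.ext (funext fun n => (ha.initial n).trans (hb.initial n).symm))

lemma IsGlobalSolution.apply_zero (hφ : IsLowFrequencyCutoff φ) (hh : 0 < h) {a : ℝ → EllTwo}
    (ha : IsGlobalSolution σ φ φ₀ h a) : a 0 = sample hh (lowFreq hφ h (𝓕 φ₀ : L2R)) :=
  lp.ext (funext fun n => (ha.initial n).trans (sample_lowFreq hφ hh φ₀ n).symm)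

/-- Uniqueness identifies the given solution with the small one constructed. Then $A^3$ with
$A=\sqrt h\cdot2\|\phi_0\|$ scales as $h^{3/2}$, the same power as the forward difference of the
data. -/
lemma IsGlobalSolution.hasUniformBounds (hσ : |σ| ≤ 1) (hφ : IsLowFrequencyCutoff φ)
    (hφ₀ : MemHOne φ₀) (hh : h ∈ Set.Ioc 0 (hZero φ₀)) {a : ℝ → EllTwo}
    (ha : IsGlobalSolution σ φ φ₀ h a) :
    HasUniformBounds σ (2 * ‖φ₀‖)
      (2 * Real.pi * ‖(memLp_mul_fourier hφ₀).toLp‖ + 6 * (2 * ‖φ₀‖) ^ 3) h a := by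
  obtain ⟨h1, h2⟩ := hZero_spec hh
  obtain ⟨b, hb, hbn⟩ := exists_isGlobalSolution hσ hφ hh
  obtain rfl := ha.unique hσ hb
  have hs : IsSmallSolution σ a :=
    ⟨ha.continuous, ha.hasDerivAt, fun t => (hbn t).trans (by linarith)⟩
  have hA : ∀ t, ‖a t‖ ≤ √h * (2 * ‖φ₀‖) := fun t => by
    refine (sq_le_sq₀ (norm_nonneg _) (by positivity)).mp ((hbn t).trans ?_)
    rw [mul_pow, Real.sq_sqrt hh.1.le, mul_pow]
    have : 0 ≤ h * ‖φ₀‖ ^ 2 := mul_nonneg hh.1.le (sq_nonneg _)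
    linarith
  refine ⟨hs, hA, fun t => (hs.norm_forwardDiff_le hσ hA t).trans ?_⟩
  have h3 := norm_forwardDiff_sample_lowFreq_le hφ hh.1 hφ₀
  rw [← ha.apply_zero hφ hh.1] at h3
  refine (add_le_add_left h3 _).trans (le_of_eq ?_)
  rw [mul_pow, pow_succ √h, Real.sq_sqrt hh.1.le]
  ring

end

/-! ### Uniform tails, equicontinuity and conclusion -/

section

variable {σ : ℝ} {φ : ℝ → ℂ} {φ₀ : L2R}

lemma abs_rescaled_time_le {h t T : ℝ} (hh : 0 < h) (ht : |t| ≤ T) :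
    |3 * t / h ^ 3| ≤ 3 * T / h ^ 3 := by
  rw [abs_div, abs_of_pos (by positivity : 0 < h ^ 3), abs_mul, abs_of_pos three_pos]
  gcongr

/-- Uniform smallness of the spatial tails on compact time intervals. -/
lemma exists_tail_le (hσ : |σ| ≤ 1) (hφ : IsLowFrequencyCutoff φ) (A E T : ℝ) {ε : ℝ}
    (hε : 0 < ε) (φ₀ : L2R) : ∃ L, 1 ≤ L ∧ ∀ (h : ℝ) (hh : 0 < h), h ≤ 1 → ∀ a : ℝ → EllTwo,
      HasUniformBounds σ A E h a → a 0 = sample hh (lowFreq hφ h (𝓕 φ₀ : L2R)) →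
      ∀ t, |t| ≤ T → ∑' n : ℤ, weight (h / L * (n - 2 * (3 * t / h ^ 3))) *
        ‖a (3 * t / h ^ 3) n‖ ^ 2 ≤ ε * h := by
  -- The initial tail is multiplied by $5/3$ in the growth estimate, and
  -- $\tfrac53\cdot\tfrac3{10}=\tfrac12$; the other half of `ε` is left for the flux.
  obtain ⟨R₀, hR₀, hR⟩ := exists_weighted_sample_le hφ (𝓕 φ₀ : L2R) (ε := 3 / 10 * ε) (by positivity)
  set M := |E ^ 2 + 6 * A ^ 2 + 6 * A ^ 3 * E| * |T| with hM
  have hM0 : 0 ≤ M := by positivity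
  refine ⟨max 1 (max R₀ (15 / 2 * M / ε)), le_max_left _ _, ?_⟩
  intro h hh h1 a ha ha0 t ht
  set L := max 1 (max R₀ (15 / 2 * M / ε)) with hL
  have hL1 : 1 ≤ L := le_max_left _ _
  have hL0 : 0 < L := one_pos.trans_le hL1
  have hLR : R₀ ≤ L := (le_max_left _ _).trans (le_max_right _ _)
  have hLM : 15 / 2 * M ≤ L * ε := by
    rw [← div_le_iff₀ hε]
    exact (le_max_right _ _).trans (le_max_right _ _)
  have h2 := hR h hh h1 L hLR
  rw [← ha0] at h2
  have hs1 : h / L ≤ 1 := (div_le_one hL0).mpr (h1.trans hL1)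
  have h3 := ha.isSmallSolution.weighted_mass_growth hσ ha.norm_le ha.norm_forwardDiff_le
    (s := h / L) (by positivity) hs1 (3 * t / h ^ 3)
  refine h3.trans ?_
  have h4 := abs_rescaled_time_le hh ht
  -- All three flux terms are $O(h^4/L)$, the cubic one because $h^3/L^3\le h^3/L$ for $L\ge1$.
  -- Multiplication by the time $3|T|/h^3$ leaves $O(h/L)$.
  have hX : h / L * (√h * (h * E)) ^ 2 + 6 * (h / L) ^ 3 * (√h * A) ^ 2 +
      6 * (h / L) * (√h * A) ^ 3 * (√h * (h * E)) ≤
      h ^ 4 / L * |E ^ 2 + 6 * A ^ 2 + 6 * A ^ 3 * E| := by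
    have e1 : h / L * (√h * (h * E)) ^ 2 + 6 * (h / L) ^ 3 * (√h * A) ^ 2 +
        6 * (h / L) * (√h * A) ^ 3 * (√h * (h * E)) =
        h / L * ((√h) ^ 2 * (h * E) ^ 2) + 6 * (h / L) ^ 3 * ((√h) ^ 2 * A ^ 2) +
        6 * (h / L) * ((√h) ^ 2) ^ 2 * A ^ 3 * (h * E) := by ring
    rw [e1, Real.sq_sqrt hh.le]
    have e2 : (h / L) ^ 3 ≤ h ^ 3 / L := by
      rw [div_pow]
      gcongr
      exact le_self_pow₀ hL1 (by norm_num)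
    have e3 : 6 * (h / L) ^ 3 * (h * A ^ 2) ≤ 6 * (h ^ 3 / L) * (h * A ^ 2) := by gcongr
    refine (add_le_add_left (add_le_add_right e3 _) _).trans ?_
    calc _ = h ^ 4 / L * (E ^ 2 + 6 * A ^ 2 + 6 * A ^ 3 * E) := by ring
      _ ≤ _ := by gcongr; exact le_abs_self _
  have h5 : 5 / 4 * (h / L * (√h * (h * E)) ^ 2 + 6 * (h / L) ^ 3 * (√h * A) ^ 2 +
      6 * (h / L) * (√h * A) ^ 3 * (√h * (h * E))) * |3 * t / h ^ 3| ≤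
      5 / 4 * (h ^ 4 / L * |E ^ 2 + 6 * A ^ 2 + 6 * A ^ 3 * E|) * (3 * |T| / h ^ 3) := by
    have := h4.trans (by gcongr; exact le_abs_self T : 3 * T / h ^ 3 ≤ 3 * |T| / h ^ 3)
    gcongr
  have h6 : 5 / 4 * (h ^ 4 / L * |E ^ 2 + 6 * A ^ 2 + 6 * A ^ 3 * E|) * (3 * |T| / h ^ 3) =
      h * (15 / 4 * M / L) := by
    rw [hM]
    field_simp
    ring
  have h7 : 15 / 4 * M / L ≤ ε / 2 := by
    rw [div_le_iff₀ hL0]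
    linarith
  have h8 := mul_le_mul_of_nonneg_left h7 hh.le
  linarith

lemma HasUniformBounds.norm_sub_sharpCutoff_le {A E h : ℝ} {a : ℝ → EllTwo}
    (ha : HasUniformBounds σ A E h a) (hh : 0 < h) {K : ℝ} (hK : 0 < K) (t : ℝ) :
    1 / (4 * h * K) * (‖forwardDiff (a t)‖ / √h) ≤ E / (4 * K) := by
  have hs : 0 < √h := Real.sqrt_pos.mpr hh
  calc _ ≤ 1 / (4 * h * K) * (√h * (h * E) / √h) := by
        gcongr
        exact ha.norm_forwardDiff_le t
    _ = _ := by field_simp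

/-- The frequencies above `K` cost `E / (4 * K)` at each of the two times. Below `K` the speed is
$O(h^3)$ in the original time, and the rescaling by $3/h^3$ removes every power of $h$. -/
lemma HasUniformBounds.norm_moving_sub_le (hσ : |σ| ≤ 1) {A E h : ℝ} {a : ℝ → EllTwo}
    (ha : HasUniformBounds σ A E h a) (hh : 0 < h) {K : ℝ} (hK : 0 < K) (t s : ℝ) :
    ‖moving hh a (3 * t / h ^ 3) - moving hh a (3 * s / h ^ 3)‖ ≤ E / (2 * K) +
      3 * ((2 * Real.pi * K) ^ 3 * A + 4 * A * E ^ 2) * |t - s| := by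
  have hs : 0 < √h := Real.sqrt_pos.mpr hh
  have hA0 : 0 ≤ A := by
    have := (norm_nonneg _).trans (ha.norm_le 0)
    exact (mul_nonneg_iff_of_pos_left hs).mp this
  set x := moving hh a (3 * t / h ^ 3)
  set y := moving hh a (3 * s / h ^ 3)
  have e1 : ‖x - sharpCutoff K x‖ ≤ E / (4 * K) :=
    (AblowitzLadik.norm_sub_sharpCutoff_le hh hK _ _ _).trans (ha.norm_sub_sharpCutoff_le hh hK _)
  have e2 : ‖y - sharpCutoff K y‖ ≤ E / (4 * K) :=
    (AblowitzLadik.norm_sub_sharpCutoff_le hh hK _ _ _).trans (ha.norm_sub_sharpCutoff_le hh hK _)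
  have hd := hasDerivAt_fieldSeq hσ ha.isSmallSolution.continuous ha.isSmallSolution.hasDerivAt
  have e3 := norm_sharpCutoff_moving_sub_le hσ hd ha.norm_le ha.norm_forwardDiff_le hh hK
    (3 * t / h ^ 3) (3 * s / h ^ 3)
  have e4 : ((2 * Real.pi * h * K) ^ 3 * (√h * A / √h) + 4 * (√h * A) * (√h * (h * E)) ^ 2 / √h) *
      |3 * t / h ^ 3 - 3 * s / h ^ 3| =
      3 * ((2 * Real.pi * K) ^ 3 * A + 4 * A * E ^ 2) * |t - s| := by
    have e5 : |3 * t / h ^ 3 - 3 * s / h ^ 3| = 3 / h ^ 3 * |t - s| := by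
      rw [show 3 * t / h ^ 3 - 3 * s / h ^ 3 = 3 / h ^ 3 * (t - s) by ring, abs_mul,
        abs_of_pos (by positivity)]
    rw [e5, mul_pow √h, Real.sq_sqrt hh.le]
    field_simp
  rw [e4] at e3
  have e6 : x - y = (x - sharpCutoff K x) + (sharpCutoff K x - sharpCutoff K y) -
      (y - sharpCutoff K y) := by abel
  have e7 : E / (2 * K) = E / (4 * K) + E / (4 * K) := by field_simp; ring
  rw [e6, e7]
  refine (norm_sub_le _ _).trans ?_
  have := norm_add_le (x - sharpCutoff K x) (sharpCutoff K x - sharpCutoff K y)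
  linarith

lemma totallyBounded_moving (hσ : |σ| ≤ 1) (hφ : IsLowFrequencyCutoff φ) {A E : ℝ}
    {α : ℝ → ℝ → EllTwo} (hα : ∀ h (hh : h ∈ Set.Ioc 0 (hZero φ₀)),
      HasUniformBounds σ A E h (α h) ∧ α h 0 = sample hh.1 (lowFreq hφ h (𝓕 φ₀ : L2R))) (T : ℝ) :
    TotallyBounded {f : L2R | ∃ h : Set.Ioc 0 (hZero φ₀), ∃ t ∈ Set.Icc (-T) T,
      moving h.2.1 (α h) (3 * t / (h : ℝ) ^ 3) = f} := by
  refine totallyBounded_of_approx fun ε hε => ?_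
  set K : ℝ := max 1 (E / ε) with hK
  have hK0 : 0 < K := one_pos.trans_le (le_max_left _ _)
  have hKE : E / (4 * K) ≤ ε / 4 := by
    rw [div_le_iff₀ (by positivity)]
    have := le_max_right 1 (E / ε)
    rw [div_le_iff₀ hε] at this
    linarith
  -- With this tail the spatial error is $\sqrt{2\varepsilon^2/16}\le\varepsilon/2$ after division
  -- by $\sqrt h$; together with $\varepsilon/4$ from high frequencies it stays below `ε`.
  obtain ⟨L, hL1, hL⟩ := exists_tail_le hσ hφ A E T (ε := ε ^ 2 / 16) (by positivity) φ₀
  have hL0 : 0 < L := one_pos.trans_le hL1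
  set B : ℝ := √(2 * L + 1) * |A|
  refine ⟨_, totallyBounded_band K B (2 * Real.pi * L * B).toNNReal, ?_⟩
  rintro _ ⟨⟨h, hh⟩, t, ht, rfl⟩
  obtain ⟨hb, hi⟩ := hα h hh
  have h1 := (hZero_spec hh).1
  have hs : 0 < √h := Real.sqrt_pos.mpr hh.1
  -- The window has about $2L/h$ points and the sequence has norm $O(\sqrt h)$, so Cauchy–Schwarz
  -- gives a bound free of $h$.
  have hB : √(2 * L / h + 1) * ‖α h (3 * t / h ^ 3)‖ ≤ B := by
    calc _ ≤ √(2 * L / h + 1) * (√h * |A|) := by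
          gcongr
          exact (hb.norm_le _).trans (by gcongr; exact le_abs_self A)
      _ = √(2 * L + h) * |A| := by
          rw [← mul_assoc, ← Real.sqrt_mul' _ hh.1.le]
          congr 2
          have := hh.1.ne'
          field_simp
      _ ≤ _ := by
          change _ ≤ √(2 * L + 1) * |A|
          gcongr
  obtain ⟨f, hf, hd⟩ := exists_band_approx hh.1 hL0 hK0 (3 * t / h ^ 3) (α h (3 * t / h ^ 3)) hB
    (Real.le_coe_toNNReal (2 * Real.pi * L * B))
  refine ⟨f, hf, ?_⟩
  rw [dist_eq_norm]
  refine hd.trans_lt ?_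
  have e1 := (hb.norm_sub_sharpCutoff_le hh.1 hK0 (3 * t / h ^ 3)).trans hKE
  have e2 : √(2 * ∑' n : ℤ, weight (h / L * (n - 2 * (3 * t / h ^ 3))) *
      ‖α h (3 * t / h ^ 3) n‖ ^ 2) / √h ≤ ε / 2 := by
    rw [div_le_iff₀ hs]
    refine Real.sqrt_le_iff.mpr ⟨by positivity, ?_⟩
    have e3 := hL h hh.1 h1 (α h) hb hi t (abs_le.mpr ht)
    rw [mul_pow, Real.sq_sqrt hh.1.le]
    have : 0 ≤ ε ^ 2 * h := mul_nonneg (sq_nonneg _) hh.1.le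
    linarith
  linarith

/-- `K` is fixed first, to make the high-frequency error at most `ε / 2`; only then is `δ` chosen
against the resulting speed. The `+ 1` in `M` avoids a division by zero. -/
lemma exists_equicontinuity_modulus (hσ : |σ| ≤ 1) {A E : ℝ} {α : ℝ → ℝ → EllTwo} {h₀ : ℝ}
    (hα : ∀ h ∈ Set.Ioc 0 h₀, HasUniformBounds σ A E h (α h)) {ε : ℝ} (hε : 0 < ε) :
    ∃ δ > 0, ∀ (h : Set.Ioc 0 h₀) (s t : ℝ), |t - s| < δ →
      ‖moving h.2.1 (α h) (3 * t / (h : ℝ) ^ 3) - moving h.2.1 (α h) (3 * s / (h : ℝ) ^ 3)‖ < ε := by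
  set K : ℝ := max 1 (E / ε) with hK
  have hK0 : 0 < K := one_pos.trans_le (le_max_left _ _)
  have hKE : E / (2 * K) ≤ ε / 2 := by
    rw [div_le_iff₀ (by positivity)]
    have := le_max_right 1 (E / ε)
    rw [div_le_iff₀ hε] at this
    linarith
  set M := |3 * ((2 * Real.pi * K) ^ 3 * A + 4 * A * E ^ 2)| + 1 with hM
  have hM0 : 0 < M := by positivity
  refine ⟨ε / 2 / M, by positivity, fun h s t hst => ?_⟩
  refine ((hα h h.2).norm_moving_sub_le hσ h.2.1 hK0 t s).trans_lt ?_
  have h1 : 3 * ((2 * Real.pi * K) ^ 3 * A + 4 * A * E ^ 2) * |t - s| ≤ M * |t - s| := by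
    gcongr
    exact (le_abs_self _).trans (by linarith)
  rw [lt_div_iff₀' hM0] at hst
  linarith

/-- Total boundedness and equicontinuity are carried from the Fourier side to $\phi^h$ by the
inverse transform, a linear isometry. -/
lemma exists_isCompact_closure_continuumRep (hσ : |σ| ≤ 1) (hφ : IsLowFrequencyCutoff φ)
    (hφ₀ : MemHOne φ₀) {α : ℝ → ℝ → EllTwo}
    (hα : ∀ h ∈ Set.Ioc 0 (hZero φ₀), IsGlobalSolution σ φ φ₀ h (α h)) (T : ℝ) :
    ∃ Φ : Set.Ioc 0 (hZero φ₀) → C(Set.Icc (-T) T, L2R),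
      (∀ (h : Set.Ioc 0 (hZero φ₀)) (t : Set.Icc (-T) T),
        (Φ h t : ℝ → ℂ) =ᵐ[volume] continuumRep h (α h) t) ∧
      IsCompact (closure (Set.range Φ)) := by
  have hb := fun h hh => (hα h hh).hasUniformBounds hσ hφ hφ₀ hh
  have htb := totallyBounded_moving hσ hφ
    (fun h hh => ⟨hb h hh, (hα h hh).apply_zero hφ hh.1⟩) T
  set e := (Lp.fourierTransformₗᵢ ℝ ℂ).symm with he
  obtain ⟨Φ, hΦ, hc⟩ := exists_curves_isCompact_closure T
    (fun (h : Set.Ioc 0 (hZero φ₀)) t => e (moving h.2.1 (α h) (3 * t / (h : ℝ) ^ 3)))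
    ((htb.image e.isometry.uniformContinuous).subset (by
      rintro _ ⟨h, t, ht, rfl⟩
      exact ⟨_, ⟨h, t, ht, rfl⟩, rfl⟩))
    (fun ε hε => by
      obtain ⟨δ, hδ, h⟩ := exists_equicontinuity_modulus hσ hb hε
      refine ⟨δ, hδ, fun i s t hst => ?_⟩
      rw [← map_sub, LinearIsometryEquiv.norm_map]
      exact h i s t hst)
  refine ⟨Φ, fun h t => ?_, hc⟩
  rw [hΦ]
  exact fourierInv_moving_ae h.2.1 (α h) t

end

end AblowitzLadik

end

theorem proposition4p1 (σ : ℝ) (hσ : σ = 1 ∨ σ = -1)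
    (φ : ℝ → ℂ) (hφ : AblowitzLadik.IsLowFrequencyCutoff φ)
    (φ₀ : AblowitzLadik.L2R) (hφ₀ : AblowitzLadik.MemHOne φ₀) :
    (∀ h ∈ Set.Ioc (0 : ℝ) (AblowitzLadik.hZero φ₀),
      ∃! α : ℝ → AblowitzLadik.EllTwo, AblowitzLadik.IsGlobalSolution σ φ φ₀ h α) ∧
    ∀ α : ℝ → ℝ → AblowitzLadik.EllTwo,
      (∀ h ∈ Set.Ioc (0 : ℝ) (AblowitzLadik.hZero φ₀),
        AblowitzLadik.IsGlobalSolution σ φ φ₀ h (α h)) →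
      ∀ T : ℝ, 0 < T →
        ∃ Φ : Set.Ioc (0 : ℝ) (AblowitzLadik.hZero φ₀) →
            C(Set.Icc (-T) T, AblowitzLadik.L2R),
          (∀ (h : Set.Ioc (0 : ℝ) (AblowitzLadik.hZero φ₀)) (t : Set.Icc (-T) T),
            (Φ h t : ℝ → ℂ) =ᵐ[volume]
              AblowitzLadik.continuumRep (h : ℝ) (α (h : ℝ)) (t : ℝ)) ∧
          IsCompact (closure (Set.range Φ)) := by
  have hσ' := AblowitzLadik.abs_sign_le hσ
  refine ⟨fun h hh => ?_, fun α hα T _ =>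
    AblowitzLadik.exists_isCompact_closure_continuumRep hσ' hφ hφ₀ hα T⟩
  obtain ⟨a, ha, -⟩ := AblowitzLadik.exists_isGlobalSolution (φ := φ) hσ' hφ hh
  exact ⟨a, ha, fun b hb => hb.unique hσ' ha⟩
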